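/- \textbf{Theorem (second variation of $\mathcal F$).} Let $M$ be a smooth $n$-dimensional manifold without boundary (Hausdorff, second countable), $X:M\to\mathbb R^{n+1}$ a smooth immersion with a smooth unit normal field $N$, and $\lambda\in\mathbb R$. Let $d\mu$ be the area measure of the metric induced by $X$, $H$ the mean curvature (sum of the principal curvatures with respect to $N$, so that the mean curvature vector is $HN$), $S$ the squared norm of the second fundamental form, $\Delta$ and $\nabla$ the Laplacian and the gradient of the induced metric, and $$\mathcal L u=\Delta u-\langle X,\nabla u\rangle,\qquad L=\mathcal L+S+1-\lambda^2 .$$ Let $X(s):M\to\mathbb R^{n+1}$ ($|s|<\varepsilon$) be a smooth variation of $X=X(0)$ through immersions which is constant in $s$ outside a compact subset of $M$ and satisfies $\frac{\partial X(s)}{\partial s}\big|_{s=0}=fN$ for a function $f:M\to\mathbb R$ (a normal variation). Let $X_s\in\mathbb R^{n+1}$ and $t_s\in\mathbb R$ be smooth variations of $X_0\in\mathbb R^{n+1}$ and $t_0>0$ with $\frac{dX_s}{ds}\big|_{s=0}=y$ and $\frac{dt_s}{ds}\big|_{s=0}=h$. With $d\mu_s$ the area measure of $X(s)$, put $$\mathcal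 F(s)=(4\pi t_s)^{-\frac n2}\int_M e^{-\frac{|X(s)-X_s|^2}{2t_s}}\,d\mu_s+\lambda(4\pi t_0)^{-\frac n2}\Bigl(\frac{t_0}{t_s}\Bigr)^{\frac12}\int_M\langle X(s)-X_s,N\rangle e^{-\frac{|X-X_0|^2}{2t_0}}\,d\mu .$$ $X$ is called a critical point of $\mathcal F$ (at $(X_0,t_0)$) if $\mathcal F'(0)=0$ for all such normal variations $X(s)$ and all such variations $X_s,t_s$. Let $X_0=0$ and $t_0=1$, assume that $\int_M e^{-|X|^2/(2t)}\,d\mu<\infty$ for some $t>1$ (equivalently, the area integral in $\mathcal F$ is finite for all parameters near $(0,1)$; this holds, for instance, if $M$ is compact or has polynomial area growth), and let $X$ be a critical point of $\mathcal F$. Then, for all variations as above, $\mathcal F$ is differentiable near $s=0$ and twice differentiable at $s=0$, all the integrals below converge absolutely, and $$\begin{aligned} (4\pi)^{\frac n2}\mathcal F''(0)={}&-\int_M fLf\,e^{-\frac{|X|^2}2}d\mu+\int_M\bigl(-|y|^2+\langle X,y\rangle^2\bigr)e^{-\frac{|X|^2}2}d\mu\\ &+\int_M\bigl\{2\langle N,y\rangle+(n+1-|X|^2)\lambda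 h-2hH-2\lambda\langle X,y\rangle\bigr\}f\,e^{-\frac{|X|^2}2}d\mu\\ &+\int_M(|X|^2-n-1)\langle X,y\rangle\,h\,e^{-\frac{|X|^2}2}d\mu\\ &+\int_M\Bigl\{\frac{n^2+2n}4-\frac{n+2}2|X|^2+\frac{|X|^4}4+\frac{3\lambda}4(\lambda-H)\Bigr\}h^2e^{-\frac{|X|^2}2}d\mu . \end{aligned}$$ -/

import Mathlib

open scoped Manifold ContDiff Topology InnerProductSpace

noncomputable section

namespace LambdaHypersurface

/-- Euclidean space `ℝᵏ`. -/
abbrev Euc (k : ℕ) : Type := EuclideanSpace ℝ (Fin k)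

/-- The `i`-th coordinate partial derivative of a map defined on `ℝⁿ`. -/
def pd {n : ℕ} {V : Type*} [NormedAddCommGroup V] [NormedSpace ℝ V]
    (i : Fin n) (u : Euc n → V) (x : Euc n) : V :=
  fderiv ℝ u x (EuclideanSpace.single i 1)

section Geometry

variable {n : ℕ} {M : Type*} [TopologicalSpace M] [ChartedSpace (Euc n) M]

/-- A map `u` on `M`, read in the preferred chart around `p`. -/
def rep {V : Type*} (u : M → V) (p : M) : Euc n → V :=
  fun x => u ((chartAt (Euc n) p).symm x)

/-- `X : M → ℝⁿ⁺¹` is a smooth immersion. -/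
def IsSmoothImmersion (X : M → Euc (n + 1)) : Prop :=
  ContMDiff (𝓡 n) 𝓘(ℝ, Euc (n + 1)) ∞ X ∧
    ∀ p, Function.Injective (mfderiv (𝓡 n) 𝓘(ℝ, Euc (n + 1)) X p)

/-- `N` is a smooth unit normal field along the immersion `X`. -/
def IsUnitNormal (X N : M → Euc (n + 1)) : Prop :=
  ContMDiff (𝓡 n) 𝓘(ℝ, Euc (n + 1)) ∞ N ∧
    ∀ p, ‖N p‖ = 1 ∧
      ∀ v : TangentSpace (𝓡 n) p,
        inner (E := Euc (n + 1)) ℝ (mfderiv (𝓡 n) 𝓘(ℝ, Euc (n + 1)) X p v) (N p) = 0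

/-- The induced metric `g_ij = ⟨∂ᵢX, ∂ⱼX⟩` in the preferred chart around `p`, at the point of that
chart with coordinates `x`. -/
def metric (X : M → Euc (n + 1)) (p : M) (x : Euc n) : Matrix (Fin n) (Fin n) ℝ :=
  Matrix.of fun i j => ⟪pd i (rep X p) x, pd j (rep X p) x⟫_ℝ

/-- The area density `√det g` in the preferred chart around `p`. -/
def areaDensity (X : M → Euc (n + 1)) (p : M) (x : Euc n) : ℝ :=
  Real.sqrt (metric X p x).det

/-- The area of `X` on the domain of the preferred chart around `p`: the measure `√det g dx` on
the image of the chart, transported to `M`; it vanishes outside the domain of the chart. -/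
def chartArea [MeasurableSpace M] (X : M → Euc (n + 1)) (p : M) : MeasureTheory.Measure M :=
  ((MeasureTheory.volume.restrict (chartAt (Euc n) p).target).withDensity
    fun x => ENNReal.ofReal (areaDensity X p x)).map (chartAt (Euc n) p).symm

/-- The area (Riemannian volume) measure `dμ` of the metric induced by `X`. For an immersion the
chart measures agree on overlaps, so the least measure dominating all of them is the measure which
equals `√det g dx` in each chart. -/
def areaMeasure [MeasurableSpace M] (X : M → Euc (n + 1)) : MeasureTheory.Measure M :=
  ⨆ p : M, chartArea X p

/-- The second fundamental form `b_ij = ⟨∂ᵢ∂ⱼX, N⟩` at `p`, in the preferred chart around `p`. -/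
def secondForm (X N : M → Euc (n + 1)) (p : M) : Matrix (Fin n) (Fin n) ℝ :=
  Matrix.of fun i j => ⟪pd i (pd j (rep X p)) (chartAt (Euc n) p p), N p⟫_ℝ

/-- The inverse metric `g^ij` at `p`. -/
def invMetric (X : M → Euc (n + 1)) (p : M) : Matrix (Fin n) (Fin n) ℝ :=
  (metric X p (chartAt (Euc n) p p))⁻¹

/-- The mean curvature `H = g^ij b_ij` (the sum of the principal curvatures with respect to `N`;
the mean curvature vector is `H N`). -/
def meanCurvature (X N : M → Euc (n + 1)) (p : M) : ℝ :=
  (invMetric X p * secondForm X N p).trace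

/-- The squared norm `S = g^ik g^jl b_ij b_kl` of the second fundamental form. -/
def sqNormSecondForm (X N : M → Euc (n + 1)) (p : M) : ℝ :=
  (invMetric X p * secondForm X N p * (invMetric X p * secondForm X N p)).trace

/-- The gradient `∇f = g^ij ∂ᵢf ∂ⱼX` of `f` for the induced metric, as a vector of `ℝⁿ⁺¹` tangent
to the hypersurface. -/
def grad (X : M → Euc (n + 1)) (f : M → ℝ) (p : M) : Euc (n + 1) :=
  ∑ i, ∑ j, (invMetric X p i j * pd i (rep f p) (chartAt (Euc n) p p)) •
    pd j (rep X p) (chartAt (Euc n) p p)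

/-- The Laplace–Beltrami operator `Δf = (det g)^(-1/2) ∂ᵢ((det g)^(1/2) g^ij ∂ⱼf)` of the induced
metric. -/
def laplacian (X : M → Euc (n + 1)) (f : M → ℝ) (p : M) : ℝ :=
  (areaDensity X p (chartAt (Euc n) p p))⁻¹ *
    ∑ i, pd i (fun x => areaDensity X p x *
      ∑ j, (metric X p x)⁻¹ i j * pd j (rep f p) x) (chartAt (Euc n) p p)

/-- The operator `𝓛f = Δf - ⟨X, ∇f⟩`. -/
def driftLaplacian (X : M → Euc (n + 1)) (f : M → ℝ) (p : M) : ℝ :=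
  laplacian X f p - ⟪X p, grad X f p⟫_ℝ

/-- The operator `L = 𝓛 + S + 1 - λ²`. -/
def stabilityOp (X N : M → Euc (n + 1)) (lam : ℝ) (f : M → ℝ) (p : M) : ℝ :=
  driftLaplacian X f p + (sqNormSecondForm X N p + 1 - lam ^ 2) * f p

/-- `Xv s`, for `s` near `0`, is a smooth, compactly supported variation of `X` through immersions
with normal variation field `∂Xv/∂s = f N` at `s = 0`. -/
def IsNormalVariation (X N : M → Euc (n + 1)) (f : M → ℝ) (Xv : ℝ → M → Euc (n + 1)) : Prop :=
  Xv 0 = X ∧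
  (∀ p, HasDerivAt (fun s => Xv s p) (f p • N p) 0) ∧
  ∃ ε > 0,
    ContMDiffOn (𝓘(ℝ, ℝ).prod (𝓡 n)) 𝓘(ℝ, Euc (n + 1)) ∞
      (fun q : ℝ × M => Xv q.1 q.2) (Set.Ioo (-ε) ε ×ˢ Set.univ) ∧
    (∀ s ∈ Set.Ioo (-ε) ε, IsSmoothImmersion (Xv s)) ∧
    ∃ K : Set M, IsCompact K ∧ ∀ s ∈ Set.Ioo (-ε) ε, ∀ p ∉ K, Xv s p = X p

/-- `c` is a smooth curve, defined near `0`, with `c 0 = c₀` and `c' 0 = v`: a variation of the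
point `c₀` with initial velocity `v`. -/
def IsPointVariation {V : Type*} [NormedAddCommGroup V] [NormedSpace ℝ V]
    (c₀ v : V) (c : ℝ → V) : Prop :=
  c 0 = c₀ ∧ HasDerivAt c v 0 ∧ ∃ ε > 0, ContDiffOn ℝ ∞ c (Set.Ioo (-ε) ε)

/-- The functional `𝓕(s) = 𝓕_{X_s, t_s}(X(s))` along variations `Xv` of the hypersurface `X`, `Xc`
of the point `X₀` and `tc` of the number `t₀`. -/
def functionalF [MeasurableSpace M] (X N : M → Euc (n + 1)) (lam : ℝ)
    (X₀ : Euc (n + 1)) (t₀ : ℝ)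
    (Xv : ℝ → M → Euc (n + 1)) (Xc : ℝ → Euc (n + 1)) (tc : ℝ → ℝ) (s : ℝ) : ℝ :=
  (4 * Real.pi * tc s) ^ (-(n : ℝ) / 2) *
      ∫ p, Real.exp (-‖Xv s p - Xc s‖ ^ 2 / (2 * tc s)) ∂(areaMeasure (Xv s)) +
    lam * (4 * Real.pi * t₀) ^ (-(n : ℝ) / 2) * (t₀ / tc s) ^ (1 / 2 : ℝ) *
      ∫ p, ⟪Xv s p - Xc s, N p⟫_ℝ * Real.exp (-‖X p - X₀‖ ^ 2 / (2 * t₀)) ∂(areaMeasure X)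

/-- `X` is a critical point of the `𝓕`-functional based at `(X₀, t₀)`: the first derivative at
`s = 0` vanishes for all normal variations of `X` and all variations of `X₀` and `t₀`. -/
def IsCriticalPoint [MeasurableSpace M] (X N : M → Euc (n + 1)) (lam : ℝ)
    (X₀ : Euc (n + 1)) (t₀ : ℝ) : Prop :=
  ∀ (f : M → ℝ) (y : Euc (n + 1)) (h : ℝ)
    (Xv : ℝ → M → Euc (n + 1)) (Xc : ℝ → Euc (n + 1)) (tc : ℝ → ℝ),
    IsNormalVariation X N f Xv → IsPointVariation X₀ y Xc → IsPointVariation t₀ h tc →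
      HasDerivAt (functionalF X N lam X₀ t₀ Xv Xc tc) 0 0

/-- The Gaussian weight `e^{-|X|²/2}`. -/
def gaussWeight (X : M → Euc (n + 1)) (p : M) : ℝ := Real.exp (-‖X p‖ ^ 2 / 2)

/-- The integrand `f Lf e^{-|X|²/2}`. -/
def termL (X N : M → Euc (n + 1)) (lam : ℝ) (f : M → ℝ) (p : M) : ℝ :=
  f p * stabilityOp X N lam f p * gaussWeight X p

/-- The integrand `(-|y|² + ⟨X, y⟩²) e^{-|X|²/2}`. -/
def termY (X : M → Euc (n + 1)) (y : Euc (n + 1)) (p : M) : ℝ :=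
  (-‖y‖ ^ 2 + ⟪X p, y⟫_ℝ ^ 2) * gaussWeight X p

/-- The integrand `{2⟨N, y⟩ + (n + 1 - |X|²) λ h - 2 h H - 2 λ ⟨X, y⟩} f e^{-|X|²/2}`. -/
def termF (X N : M → Euc (n + 1)) (lam : ℝ) (f : M → ℝ) (y : Euc (n + 1)) (h : ℝ) (p : M) : ℝ :=
  (2 * ⟪N p, y⟫_ℝ + ((n : ℝ) + 1 - ‖X p‖ ^ 2) * lam * h - 2 * h * meanCurvature X N p
    - 2 * lam * ⟪X p, y⟫_ℝ) * f p * gaussWeight X p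

/-- The integrand `(|X|² - n - 1) ⟨X, y⟩ h e^{-|X|²/2}`. -/
def termYH (X : M → Euc (n + 1)) (y : Euc (n + 1)) (h : ℝ) (p : M) : ℝ :=
  (‖X p‖ ^ 2 - (n : ℝ) - 1) * ⟪X p, y⟫_ℝ * h * gaussWeight X p

/-- The integrand
`{(n² + 2n)/4 - (n + 2)/2 |X|² + |X|⁴/4 + (3λ/4)(λ - H)} h² e^{-|X|²/2}`. -/
def termH (X N : M → Euc (n + 1)) (lam h : ℝ) (p : M) : ℝ :=
  (((n : ℝ) ^ 2 + 2 * n) / 4 - ((n : ℝ) + 2) / 2 * ‖X p‖ ^ 2 + ‖X p‖ ^ 4 / 4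
    + 3 * lam / 4 * (lam - meanCurvature X N p)) * h ^ 2 * gaussWeight X p

end Geometry

end LambdaHypersurface

end

/-! Everything is pulled back to the fixed measure dμ. The area element of X(s) is a smooth positive
density (`relDensity`) times dμ, so up to the constant (4π)^(-n/2) the functional is t_s^(-n/2)
times one parameter integral plus λ t_s^(-1/2) times another. Off the compact set where X(s) moves,
the integrands depend on s only through the center and the scale; they and their first two
s-derivatives are dominated by a multiple of e^(-|X|²/(2t)), where t > 1 comes from the finiteness
assumption. This justifies differentiating twice under the integral sign
(`IsJointVariation.exists_derivs`), and (4π)^(n/2) 𝓕''(0) becomes the integral of `secondIntegrand`,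
which involves f, y, h and also the accelerations W, z, k of X(s), X_s, t_s.

Pointwise, if ℓ is the logarithmic s-derivative of the weighted area element, its second derivative
is the weight times ℓ² + ℓ'. The geometric part of ℓ' is |∇f|² - f²S + div W
(`hasDerivAt_surfaceDiv_velocity`).

Criticality enters twice. Arbitrary normal speeds and the fundamental lemma of the calculus of
variations give H + ⟨X, N⟩ = λ (`IsCriticalPoint.meanCurvature_eq`). Variations of center and scale
alone show that `firstIntegrand` with f = 0 has integral zero in every direction (y, h).

By `secondIntegrand_eq` the second integrand is the asserted one plus four terms of integral zero.
The accelerations z, k occur exactly as a first variation in the direction (z, k). The acceleration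
W occurs as div W - ⟨X, W⟩ + λ⟨W, N⟩, which integrates to zero against the Gaussian by the
divergence theorem and the equation for H. The term |∇f|² + f𝓛f vanishes by Green's formula.
Finally, -h times the first variation in the direction y accounts for the difference between the
coefficients |X|² - n - 2 and |X|² - n - 1 of h⟨X, y⟩, together with the term λh⟨N, y⟩. -/

open scoped Manifold ContDiff Topology InnerProductSpace

set_option linter.unusedSectionVars false

noncomputable section

namespace LambdaHypersurface

/-! ### Linear algebra of frames and Gram matrices. -/

section Frames

open Matrix

variable {n : ℕ} {E : Type*} [NormedAddCommGroup E] [InnerProductSpace ℝ E]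

/-- The divergence `g^ij ⟨dᵢ, eⱼ⟩` of a field with partial derivatives `d` relative to a frame `e`. -/
def frameDiv (e d : Fin n → E) : ℝ := ∑ i, ∑ j, (gram ℝ e)⁻¹ i j * ⟪d i, e j⟫_ℝ

/-- The tangent vector `g^ij aᵢ eⱼ` with inner products `a` with the frame `e`. -/
def frameGrad (e : Fin n → E) (a : Fin n → ℝ) : E := ∑ i, ∑ j, ((gram ℝ e)⁻¹ i j * a i) • e j

/-- The matrix of inner products of two families of vectors. -/
def innerMat (u v : Fin n → E) : Matrix (Fin n) (Fin n) ℝ := Matrix.of fun i j => ⟪u i, v j⟫_ℝ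

lemma innerMat_transpose (u v : Fin n → E) : (innerMat u v)ᵀ = innerMat v u := by
  ext i j; simp [innerMat, real_inner_comm]

lemma frameDiv_eq_trace (e d : Fin n → E) :
    frameDiv e d = ((gram ℝ e)⁻¹ * innerMat e d).trace := by
  simp [frameDiv, Matrix.trace, Matrix.mul_apply, innerMat, real_inner_comm]

lemma gram_transpose (e : Fin n → E) : (gram ℝ e)ᵀ = gram ℝ e := innerMat_transpose e e

lemma gram_inv_symm (e : Fin n → E) (i j : Fin n) : (gram ℝ e)⁻¹ i j = (gram ℝ e)⁻¹ j i := by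
  have h : ((gram ℝ e)⁻¹)ᵀ = (gram ℝ e)⁻¹ := by
    rw [Matrix.transpose_nonsing_inv, gram_transpose]
  exact congrFun (congrFun h j) i

lemma gram_det_pos {e : Fin n → E} (he : LinearIndependent ℝ e) : 0 < (gram ℝ e).det :=
  (posDef_gram_of_linearIndependent he).det_pos

lemma innerMat_lin (A : Matrix (Fin n) (Fin n) ℝ) (u v : Fin n → E) :
    innerMat (fun i => ∑ k, A i k • u k) (fun i => ∑ k, A i k • v k) = A * innerMat u v * Aᵀ := by
  ext i j
  simp only [innerMat, Matrix.of_apply, sum_inner, inner_sum, real_inner_smul_left,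
    real_inner_smul_right, Matrix.mul_apply, Matrix.transpose_apply, Finset.sum_mul]
  exact Finset.sum_congr rfl fun _ _ => Finset.sum_congr rfl fun _ _ => by ring

lemma gram_lin (A : Matrix (Fin n) (Fin n) ℝ) (e : Fin n → E) :
    gram ℝ (fun i => ∑ k, A i k • e k) = A * gram ℝ e * Aᵀ := innerMat_lin A e e

lemma sqrt_det_gram_lin (A : Matrix (Fin n) (Fin n) ℝ) (e : Fin n → E) :
    Real.sqrt (gram ℝ (fun i => ∑ k, A i k • e k)).det
      = |A.det| * Real.sqrt (gram ℝ e).det := by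
  rw [gram_lin, Matrix.det_mul, Matrix.det_mul, Matrix.det_transpose,
    show A.det * (gram ℝ e).det * A.det = A.det ^ 2 * (gram ℝ e).det by ring,
    Real.sqrt_mul (sq_nonneg _), Real.sqrt_sq_eq_abs]

lemma gram_lin_inv {A : Matrix (Fin n) (Fin n) ℝ} (hA : IsUnit A.det) (e : Fin n → E) :
    (gram ℝ e)⁻¹ = Aᵀ * (gram ℝ (fun i => ∑ k, A i k • e k))⁻¹ * A := by
  have hAt : IsUnit (Aᵀ).det := by rwa [Matrix.det_transpose]
  rw [gram_lin, Matrix.mul_inv_rev, Matrix.mul_inv_rev, ← Matrix.mul_assoc, ← Matrix.mul_assoc,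
    Matrix.mul_nonsing_inv _ hAt, Matrix.one_mul, Matrix.mul_assoc, Matrix.nonsing_inv_mul _ hA,
    Matrix.mul_one]

/-- The factors A and Aᵀ produced by the inverse Gram matrix and by the inner products cancel
cyclically under the trace. This makes the divergence independent of coordinates. -/
lemma frameDiv_lin {A : Matrix (Fin n) (Fin n) ℝ} (hA : IsUnit A.det) (e d : Fin n → E) :
    frameDiv (fun i => ∑ k, A i k • e k) (fun i => ∑ k, A i k • d k) = frameDiv e d := by
  rw [frameDiv_eq_trace, frameDiv_eq_trace, gram_lin_inv hA e, innerMat_lin, ← Matrix.mul_assoc,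
    Matrix.trace_mul_comm]
  simp only [Matrix.mul_assoc]

lemma frameGrad_eq (e : Fin n → E) (a : Fin n → ℝ) :
    frameGrad e a = ∑ j, ((gram ℝ e)⁻¹ *ᵥ a) j • e j := by
  simp only [frameGrad, Matrix.mulVec, dotProduct, Finset.sum_smul]
  rw [Finset.sum_comm]
  exact Finset.sum_congr rfl fun j _ => Finset.sum_congr rfl fun i _ => by rw [gram_inv_symm]

lemma frameGrad_lin {A : Matrix (Fin n) (Fin n) ℝ} (hA : IsUnit A.det) (e : Fin n → E)
    (a : Fin n → ℝ) :
    frameGrad (fun i => ∑ k, A i k • e k) (fun i => ∑ k, A i k * a k) = frameGrad e a := by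
  rw [frameGrad_eq, frameGrad_eq, gram_lin_inv hA e]
  have h1 : (fun i => ∑ k, A i k * a k) = A *ᵥ a := rfl
  rw [h1, ← Matrix.mulVec_mulVec, ← Matrix.mulVec_mulVec]
  simp only [Finset.smul_sum]
  rw [Finset.sum_comm]
  refine Finset.sum_congr rfl fun j _ => ?_
  simp only [smul_smul, ← Finset.sum_smul]
  congr 1
  generalize (gram ℝ fun i => ∑ k, A i k • e k)⁻¹ *ᵥ A *ᵥ a = b
  simp only [Matrix.mulVec, dotProduct, Matrix.transpose_apply]
  exact Finset.sum_congr rfl fun i _ => mul_comm _ _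

/-- The coefficients of the gradient are g⁻¹a, and pairing with the frame multiplies them by g
again. -/
lemma inner_frameGrad {e : Fin n → E} (he : LinearIndependent ℝ e) (a : Fin n → ℝ) (k : Fin n) :
    ⟪frameGrad e a, e k⟫_ℝ = a k := by
  have h : gram ℝ e *ᵥ ((gram ℝ e)⁻¹ *ᵥ a) = a := by
    rw [Matrix.mulVec_mulVec, Matrix.mul_nonsing_inv _ (gram_det_pos he).ne'.isUnit,
      Matrix.one_mulVec]
  rw [frameGrad_eq, sum_inner]
  conv_rhs => rw [← h]
  rw [Matrix.mulVec, dotProduct]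
  refine Finset.sum_congr rfl fun j _ => ?_
  rw [real_inner_smul_left, gram_apply, real_inner_comm, mul_comm]

lemma inner_frameGrad_left (e : Fin n → E) (a : Fin n → ℝ) (v : E) :
    ⟪frameGrad e a, v⟫_ℝ = ∑ i, ∑ j, (gram ℝ e)⁻¹ i j * a i * ⟪e j, v⟫_ℝ := by
  simp only [frameGrad, sum_inner, real_inner_smul_left]

lemma inner_frameGrad_frameGrad {e : Fin n → E} (he : LinearIndependent ℝ e) (a b : Fin n → ℝ) :
    ⟪frameGrad e a, frameGrad e b⟫_ℝ = ∑ i, ∑ j, (gram ℝ e)⁻¹ i j * a i * b j := by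
  rw [inner_frameGrad_left]
  exact Finset.sum_congr rfl fun i _ => Finset.sum_congr rfl fun j _ => by
    rw [real_inner_comm, inner_frameGrad he]

lemma inner_frameGrad_normal {e : Fin n → E} {ν : E} (h : ∀ i, ⟪e i, ν⟫_ℝ = 0) (a : Fin n → ℝ) :
    ⟪frameGrad e a, ν⟫_ℝ = 0 := by
  rw [inner_frameGrad_left]; simp [h]

lemma frameDiv_add (e d d' : Fin n → E) :
    frameDiv e (fun i => d i + d' i) = frameDiv e d + frameDiv e d' := by
  simp only [frameDiv, inner_add_left, mul_add, Finset.sum_add_distrib]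

lemma frameDiv_smul (e d : Fin n → E) (c : ℝ) :
    frameDiv e (fun i => c • d i) = c * frameDiv e d := by
  simp only [frameDiv, real_inner_smul_left, Finset.mul_sum]
  exact Finset.sum_congr rfl fun i _ => Finset.sum_congr rfl fun j _ => by ring

lemma frameDiv_smul_vec (e : Fin n → E) (a : Fin n → ℝ) (v : E) :
    frameDiv e (fun i => a i • v) = ⟪frameGrad e a, v⟫_ℝ := by
  rw [inner_frameGrad_left]
  simp only [frameDiv, real_inner_smul_left]
  exact Finset.sum_congr rfl fun i _ => Finset.sum_congr rfl fun j _ => by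
    rw [real_inner_comm]; ring

end Frames

/-! ### Tangent frames completed by a unit normal. -/

section Normal

open Matrix

variable {n : ℕ}

/-- The normal is orthogonal to the span of the frame and nonzero, so adjoining it gives n + 1
independent vectors in dimension n + 1, hence a spanning family. -/
lemma eq_zero_of_orthogonal_frame {e : Fin n → Euc (n + 1)} {ν : Euc (n + 1)}
    (he : LinearIndependent ℝ e) (hν : ‖ν‖ = 1) (h : ∀ i, ⟪e i, ν⟫_ℝ = 0)
    {v : Euc (n + 1)} (hv : ∀ i, ⟪v, e i⟫_ℝ = 0) (hvν : ⟪v, ν⟫_ℝ = 0) : v = 0 := by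
  have hli : LinearIndependent ℝ (Fin.cons ν e : Fin (n + 1) → Euc (n + 1)) := by
    refine LinearIndependent.finCons he fun hmem => ?_
    have : ⟪ν, ν⟫_ℝ = 0 := by
      refine Submodule.span_induction (p := fun x _ => ⟪x, ν⟫_ℝ = 0) ?_ ?_ ?_ ?_ hmem
      · rintro x ⟨i, rfl⟩; exact h i
      · simp
      · intro x z _ _ hx hz; rw [inner_add_left, hx, hz, add_zero]
      · intro a x _ hx; rw [real_inner_smul_left, hx, mul_zero]
    rw [real_inner_self_eq_norm_sq, hν] at this
    norm_num at this
  have hspan := hli.span_eq_top_of_card_eq_finrank' (by simp)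
  have hmem : v ∈ Submodule.span ℝ (Set.range (Fin.cons ν e : Fin (n + 1) → Euc (n + 1))) := by
    rw [hspan]; trivial
  have : ⟪v, v⟫_ℝ = 0 := by
    refine Submodule.span_induction (p := fun x _ => ⟪v, x⟫_ℝ = 0) ?_ ?_ ?_ ?_ hmem
    · rintro x ⟨i, rfl⟩
      refine Fin.cases ?_ (fun i => ?_) i
      · simpa using hvν
      · simpa using hv i
    · simp
    · intro x z _ _ hx hz; rw [inner_add_right, hx, hz, add_zero]
    · intro a x _ hx; rw [real_inner_smul_right, hx, mul_zero]
  exact inner_self_eq_zero.1 this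

lemma frame_decomposition {e : Fin n → Euc (n + 1)} {ν : Euc (n + 1)}
    (he : LinearIndependent ℝ e) (hν : ‖ν‖ = 1) (h : ∀ i, ⟪e i, ν⟫_ℝ = 0) (v : Euc (n + 1)) :
    v = frameGrad e (fun i => ⟪v, e i⟫_ℝ) + ⟪v, ν⟫_ℝ • ν := by
  refine sub_eq_zero.1 (eq_zero_of_orthogonal_frame he hν h (fun i => ?_) ?_)
  · rw [inner_sub_left, inner_add_left, inner_frameGrad he, real_inner_smul_left,
      real_inner_comm, real_inner_comm _ ν, h]; ring
  · rw [inner_sub_left, inner_add_left, inner_frameGrad_normal h, real_inner_smul_left,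
      real_inner_self_eq_norm_sq, hν]; ring

/-- Parseval's identity in a frame that need not be orthonormal: the inverse metric contracts the
tangential components. -/
lemma inner_of_orthogonal_normal {e : Fin n → Euc (n + 1)} {ν : Euc (n + 1)}
    (he : LinearIndependent ℝ e) (hν : ‖ν‖ = 1) (h : ∀ i, ⟪e i, ν⟫_ℝ = 0) (u v : Euc (n + 1)) :
    ⟪u, v⟫_ℝ = (∑ i, ∑ j, (gram ℝ e)⁻¹ i j * ⟪u, e i⟫_ℝ * ⟪v, e j⟫_ℝ) + ⟪u, ν⟫_ℝ * ⟪v, ν⟫_ℝ := by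
  conv_lhs => rw [frame_decomposition he hν h u]
  rw [inner_add_left, inner_frameGrad_left, real_inner_smul_left, real_inner_comm v ν]
  congr 1
  exact Finset.sum_congr rfl fun i _ => Finset.sum_congr rfl fun j _ => by
    rw [real_inner_comm v (e j)]

end Normal

/-! ### Derivatives of Gram determinants, inverse matrices and frame divergences. -/

section Derivatives

open Matrix

variable {n : ℕ}

/-- Jacobi's formula: the product rule in the Leibniz expansion differentiates one column at a time.
-/
lemma hasDerivAt_det {G : ℝ → Matrix (Fin n) (Fin n) ℝ} {G' : Matrix (Fin n) (Fin n) ℝ} {s : ℝ}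
    (hG : ∀ i j, HasDerivAt (fun s => G s i j) (G' i j) s) :
    HasDerivAt (fun s => (G s).det) ((adjugate (G s) * G').trace) s := by
  have h1 : HasDerivAt (fun s => (G s).det)
      (∑ σ : Equiv.Perm (Fin n), ((Equiv.Perm.sign σ : ℤ) : ℝ) *
        ∑ k, (∏ i ∈ Finset.univ.erase k, G s (σ i) i) * G' (σ k) k) s := by
    simp only [Matrix.det_apply']
    refine HasDerivAt.fun_sum fun σ _ => HasDerivAt.const_mul _ ?_
    have := HasDerivAt.fun_finsetProd (u := Finset.univ) (f := fun i s => G s (σ i) i)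
      (f' := fun i => G' (σ i) i) (x := s) fun i _ => hG (σ i) i
    simpa [smul_eq_mul] using this
  convert h1 using 1
  -- Cramer's rule: the k-th diagonal entry of adj(G) G' is the determinant of G with its k-th
  -- column replaced by that of G'.
  have h2 : ∀ k, (adjugate (G s) * G') k k = ((G s).updateCol k (fun i => G' i k)).det := by
    intro k
    rw [← Matrix.cramer_apply, Matrix.cramer_eq_adjugate_mulVec]
    rfl
  simp only [Matrix.trace, Matrix.diag_apply, h2, Matrix.det_apply', Finset.mul_sum]
  rw [Finset.sum_comm]
  refine Finset.sum_congr rfl fun σ _ => Finset.sum_congr rfl fun k _ => ?_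
  congr 1
  rw [← Finset.prod_erase_mul _ _ (Finset.mem_univ k), Matrix.updateCol_self]
  congr 1
  refine Finset.prod_congr rfl fun i hi => ?_
  rw [Matrix.updateCol_ne (Finset.ne_of_mem_erase hi)]

/-- The cofactor formula gives differentiability; the value of the derivative then follows by
differentiating G G⁻¹ = 1, which holds near the point because the determinant stays nonzero. -/
lemma hasDerivAt_inv_matrix {G : ℝ → Matrix (Fin n) (Fin n) ℝ} {G' : Matrix (Fin n) (Fin n) ℝ}
    {s : ℝ} (hdet : (G s).det ≠ 0) (hG : ∀ i j, HasDerivAt (fun s => G s i j) (G' i j) s)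
    (i j : Fin n) :
    HasDerivAt (fun s => (G s)⁻¹ i j) ((-((G s)⁻¹ * G' * (G s)⁻¹)) i j) s := by
  have hd : ∀ i j, DifferentiableAt ℝ (fun s => (G s)⁻¹ i j) s := by
    intro i j
    have h1 : ∀ s, (G s)⁻¹ i j = (G s).det⁻¹ * ((G s).updateRow j (Pi.single i 1)).det := by
      intro s
      rw [Matrix.inv_def, Matrix.smul_apply, Matrix.adjugate_apply, smul_eq_mul,
        Ring.inverse_eq_inv']
    simp only [h1]
    refine ((hasDerivAt_det hG).differentiableAt.inv hdet).mul ?_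
    refine (hasDerivAt_det (G' := G'.updateRow j 0) fun k l => ?_).differentiableAt
    by_cases hk : k = j
    · subst hk; simp only [Matrix.updateRow_self]; exact hasDerivAt_const _ _
    · simp only [Matrix.updateRow_ne hk]; exact hG k l
  set D : Matrix (Fin n) (Fin n) ℝ := Matrix.of fun i j => deriv (fun s => (G s)⁻¹ i j) s with hD
  have hdD : ∀ i j, HasDerivAt (fun s => (G s)⁻¹ i j) (D i j) s := fun i j => (hd i j).hasDerivAt
  have hev : ∀ᶠ r in 𝓝 s, G r * (G r)⁻¹ = 1 := by
    have hc : ContinuousAt (fun s => (G s).det) s := (hasDerivAt_det hG).continuousAt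
    filter_upwards [hc.eventually_ne hdet] with r hr
    exact Matrix.mul_nonsing_inv _ hr.isUnit
  have hz : G' * (G s)⁻¹ + G s * D = 0 := by
    ext a b
    have h1 : HasDerivAt (fun r => (G r * (G r)⁻¹) a b) ((G' * (G s)⁻¹ + G s * D) a b) s := by
      simp only [Matrix.mul_apply, Matrix.add_apply, ← Finset.sum_add_distrib]
      exact HasDerivAt.fun_sum fun k _ => (hG a k).mul (hdD k b)
    have h2 : HasDerivAt (fun r => (G r * (G r)⁻¹) a b) 0 s :=
      (hasDerivAt_const s ((1 : Matrix (Fin n) (Fin n) ℝ) a b)).congr_of_eventuallyEq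
        (hev.mono fun r hr => by simp only [hr])
    exact h1.unique h2
  have hDe : D = -((G s)⁻¹ * G' * (G s)⁻¹) := by
    have : G s * D = -(G' * (G s)⁻¹) := by
      rw [eq_neg_iff_add_eq_zero, add_comm]; exact hz
    calc D = (G s)⁻¹ * (G s * D) := by
          rw [← Matrix.mul_assoc, Matrix.nonsing_inv_mul _ hdet.isUnit, Matrix.one_mul]
      _ = _ := by rw [this, Matrix.mul_neg, Matrix.mul_assoc]
  rw [← hDe]; exact hdD i j

lemma hasDerivAt_sqrt_det {G : ℝ → Matrix (Fin n) (Fin n) ℝ} {G' : Matrix (Fin n) (Fin n) ℝ}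
    {s : ℝ} (hdet : 0 < (G s).det) (hG : ∀ i j, HasDerivAt (fun s => G s i j) (G' i j) s) :
    HasDerivAt (fun s => Real.sqrt (G s).det)
      (Real.sqrt (G s).det * (((G s)⁻¹ * G').trace / 2)) s := by
  convert (hasDerivAt_det hG).sqrt hdet.ne' using 1
  rw [Matrix.inv_def, Ring.inverse_eq_inv', Matrix.smul_mul, Matrix.trace_smul, smul_eq_mul]
  have h1 : Real.sqrt (G s).det ≠ 0 := (Real.sqrt_pos.2 hdet).ne'
  have h2 : (G s).det = Real.sqrt (G s).det ^ 2 := (Real.sq_sqrt hdet.le).symm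
  rw [eq_div_iff (by positivity)]
  have h3 : Real.sqrt (G s).det * ((G s).det⁻¹ * ((G s).adjugate * G').trace / 2)
      * (2 * Real.sqrt (G s).det)
      = (Real.sqrt (G s).det ^ 2 * (G s).det⁻¹) * ((G s).adjugate * G').trace := by ring
  rw [h3, ← h2, mul_inv_cancel₀ hdet.ne', one_mul]

variable {E : Type*} [NormedAddCommGroup E] [InnerProductSpace ℝ E]

lemma hasDerivAt_innerMat {u v : ℝ → Fin n → E} {u' v' : Fin n → E} {s : ℝ}
    (hu : ∀ i, HasDerivAt (fun s => u s i) (u' i) s)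
    (hv : ∀ i, HasDerivAt (fun s => v s i) (v' i) s) (i j : Fin n) :
    HasDerivAt (fun s => innerMat (u s) (v s) i j) ((innerMat (u s) v' + innerMat u' (v s)) i j) s :=
  (hu i).inner ℝ (hv j)

lemma trace_gram_inv_mul_symm (e d : Fin n → E) :
    ((gram ℝ e)⁻¹ * (innerMat e d + innerMat d e)).trace = 2 * frameDiv e d := by
  have h : ((gram ℝ e)⁻¹ * innerMat d e).trace = ((gram ℝ e)⁻¹ * innerMat e d).trace := by
    rw [← Matrix.trace_transpose, Matrix.transpose_mul, innerMat_transpose,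
      Matrix.transpose_nonsing_inv, gram_transpose, Matrix.trace_mul_comm]
  rw [Matrix.mul_add, Matrix.trace_add, h, ← frameDiv_eq_trace]; ring

/-- First variation of the area density of a frame. -/
lemma hasDerivAt_sqrt_det_gram {e : ℝ → Fin n → E} {e' : Fin n → E} {s : ℝ}
    (hli : LinearIndependent ℝ (e s)) (he : ∀ i, HasDerivAt (fun s => e s i) (e' i) s) :
    HasDerivAt (fun s => Real.sqrt (gram ℝ (e s)).det)
      (Real.sqrt (gram ℝ (e s)).det * frameDiv (e s) e') s := by
  have h := hasDerivAt_sqrt_det (G := fun s => gram ℝ (e s)) (gram_det_pos hli)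
    (fun i j => hasDerivAt_innerMat he he i j)
  rw [trace_gram_inv_mul_symm, mul_div_cancel_left₀ _ two_ne_zero] at h
  exact h

lemma hasDerivAt_frameDiv {e d : ℝ → Fin n → E} {e' d' : Fin n → E} {s : ℝ}
    (hli : LinearIndependent ℝ (e s)) (he : ∀ i, HasDerivAt (fun s => e s i) (e' i) s)
    (hd : ∀ i, HasDerivAt (fun s => d s i) (d' i) s) :
    HasDerivAt (fun s => frameDiv (e s) (d s))
      (((gram ℝ (e s))⁻¹ * (innerMat (e s) d' + innerMat e' (d s))).trace
        - ((gram ℝ (e s))⁻¹ * (innerMat (e s) e' + innerMat e' (e s)) * (gram ℝ (e s))⁻¹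
          * innerMat (e s) (d s)).trace) s := by
  simp only [frameDiv_eq_trace]
  have h1 := hasDerivAt_inv_matrix (G := fun s => gram ℝ (e s)) (gram_det_pos hli).ne'
    (fun i j => hasDerivAt_innerMat he he i j)
  have h2 := hasDerivAt_innerMat he hd
  have h3 : HasDerivAt (fun s => ((gram ℝ (e s))⁻¹ * innerMat (e s) (d s)).trace) _ s :=
    HasDerivAt.fun_sum (u := Finset.univ) fun i _ =>
      HasDerivAt.fun_sum (u := Finset.univ) fun j _ => (h1 i j).mul (h2 j i)
  convert h3 using 1
  rw [sub_eq_add_neg, ← Matrix.trace_neg, ← Matrix.neg_mul, add_comm]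
  simp only [Matrix.trace, Matrix.diag_apply, Finset.sum_add_distrib, Matrix.mul_apply]

/-- Second variation of the divergence term for a normal variation of a frame: `e` is a tangent
frame with unit normal `ν`, `dν` are the derivatives of the normal, `f` and `a` the value and the
derivatives of the normal speed, `e''` the acceleration. -/
lemma hasDerivAt_frameDiv_normal {e d : ℝ → Fin n → Euc (n + 1)} {e'' dν : Fin n → Euc (n + 1)}
    {ν : Euc (n + 1)} {f : ℝ} {a : Fin n → ℝ} {s : ℝ}
    (hli : LinearIndependent ℝ (e s)) (hν : ‖ν‖ = 1) (hort : ∀ i, ⟪e s i, ν⟫_ℝ = 0)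
    (hdν : ∀ i, ⟪dν i, ν⟫_ℝ = 0) (hsymm : ∀ i j, ⟪dν i, e s j⟫_ℝ = ⟪dν j, e s i⟫_ℝ)
    (hd0 : ∀ i, d s i = f • dν i + a i • ν)
    (he : ∀ i, HasDerivAt (fun s => e s i) (d s i) s)
    (hd : ∀ i, HasDerivAt (fun s => d s i) (e'' i) s) :
    HasDerivAt (fun s => frameDiv (e s) (d s))
      (⟪frameGrad (e s) a, frameGrad (e s) a⟫_ℝ
        - f ^ 2 * ((gram ℝ (e s))⁻¹ * innerMat (e s) dν * ((gram ℝ (e s))⁻¹ * innerMat (e s) dν)).trace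
        + frameDiv (e s) e'') s := by
  convert hasDerivAt_frameDiv hli he hd using 1
  set G := (gram ℝ (e s))⁻¹ with hG
  set B := innerMat (e s) dν with hB
  have hBt : innerMat dν (e s) = B := by
    ext i j; simp only [hB, innerMat, Matrix.of_apply]; rw [hsymm, real_inner_comm]
  have h1 : innerMat (e s) (d s) = f • B := by
    ext i j
    simp [innerMat, hB, hd0, inner_add_right, real_inner_smul_right, hort]
  have h2 : innerMat (d s) (e s) = f • B := by
    rw [← innerMat_transpose, h1, Matrix.transpose_smul, hB, innerMat_transpose, hBt]
  -- The vectors dν i are tangential, so their inner products are given by Parseval in the frame as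
  -- B g⁻¹ B, and the mixed terms with ν vanish.
  have h3 : innerMat (d s) (d s) = f ^ 2 • (B * G * B) + Matrix.of fun i j => a i * a j := by
    ext i j
    have hνdν : ∀ i, ⟪ν, dν i⟫_ℝ = 0 := fun i => by rw [real_inner_comm, hdν]
    have h4 : ⟪dν i, dν j⟫_ℝ = (B * G * B) i j := by
      rw [inner_of_orthogonal_normal hli hν hort, hdν, hdν]
      simp only [Matrix.mul_apply, Finset.sum_mul]
      rw [Finset.sum_comm]
      simp only [mul_zero, add_zero]
      refine Finset.sum_congr rfl fun k _ => Finset.sum_congr rfl fun l _ => ?_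
      rw [← hBt]
      conv_rhs => rw [hBt, hB]
      simp only [innerMat, Matrix.of_apply]
      rw [hsymm i l, real_inner_comm (e s i), real_inner_comm (dν j)]; ring
    simp only [innerMat, Matrix.of_apply, hd0, inner_add_left, inner_add_right,
      real_inner_smul_left, real_inner_smul_right, hdν, hνdν, h4, real_inner_self_eq_norm_sq, hν,
      Matrix.add_apply, Matrix.smul_apply, smul_eq_mul]
    ring
  have h5 : (G * Matrix.of fun i j => a i * a j).trace
      = ⟪frameGrad (e s) a, frameGrad (e s) a⟫_ℝ := by
    rw [inner_frameGrad_frameGrad hli]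
    simp only [Matrix.trace, Matrix.diag_apply, Matrix.mul_apply, Matrix.of_apply]
    exact Finset.sum_congr rfl fun i _ => Finset.sum_congr rfl fun j _ => by ring
  -- The products of first derivatives contribute f² tr(g⁻¹B g⁻¹B) and the derivative of the inverse
  -- metric contributes -2f² times the same trace; this leaves the coefficient -f².
  rw [h1, h2, h3, Matrix.mul_add, Matrix.mul_add, Matrix.trace_add, Matrix.trace_add,
    ← frameDiv_eq_trace, h5]
  simp only [← add_smul, Matrix.mul_smul, Matrix.smul_mul, Matrix.trace_smul, smul_eq_mul,
    Matrix.mul_assoc]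
  ring

end Derivatives

end LambdaHypersurface
end

noncomputable section

namespace LambdaHypersurface

/-! ### Smooth maps and smooth families read in charts. -/

section Charts

variable {n : ℕ} {M : Type*} [TopologicalSpace M] [ChartedSpace (Euc n) M]
  {V : Type*} [NormedAddCommGroup V] [NormedSpace ℝ V]

/-- A map whose expressions in all preferred charts are smooth. -/
def SmoothInCharts (u : M → V) : Prop :=
  ∀ p : M, ContDiffOn ℝ ∞ (rep (n := n) u p) (chartAt (Euc n) p).target

/-- A family of maps whose expressions in all preferred charts are jointly smooth. -/
def SmoothFamily (I : Set ℝ) (Φ : ℝ → M → V) : Prop :=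
  ∀ p : M, ContDiffOn ℝ ∞ (fun q : ℝ × Euc n => rep (Φ q.1) p q.2)
    (I ×ˢ (chartAt (Euc n) p).target)

lemma SmoothInCharts.of_contMDiff [IsManifold (𝓡 n) ∞ M] {u : M → V}
    (hu : ContMDiff (𝓡 n) 𝓘(ℝ, V) ∞ u) : SmoothInCharts (n := n) u := by
  intro p
  rw [← contMDiffOn_iff_contDiffOn]
  exact hu.comp_contMDiffOn (contMDiffOn_chart_symm (I := 𝓡 n) (x := p))

lemma SmoothFamily.of_contMDiffOn [IsManifold (𝓡 n) ∞ M] {I : Set ℝ} {Φ : ℝ → M → V}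
    (hΦ : ContMDiffOn (𝓘(ℝ, ℝ).prod (𝓡 n)) 𝓘(ℝ, V) ∞ (fun q : ℝ × M => Φ q.1 q.2)
      (I ×ˢ Set.univ)) : SmoothFamily (n := n) I Φ := by
  intro p
  rw [← contMDiffOn_iff_contDiffOn, modelWithCornersSelf_prod, ← chartedSpaceSelf_prod]
  have h1 : ContMDiffOn (𝓘(ℝ, ℝ).prod (𝓡 n)) (𝓘(ℝ, ℝ).prod (𝓡 n)) ∞
      (fun q : ℝ × Euc n => (q.1, (chartAt (Euc n) p).symm q.2))
      (I ×ˢ (chartAt (Euc n) p).target) := by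
    refine contMDiffOn_fst.prodMk ?_
    exact (contMDiffOn_chart_symm (I := 𝓡 n) (x := p)).comp contMDiffOn_snd fun q hq => hq.2
  exact hΦ.comp h1 fun q hq => ⟨hq.1, trivial⟩

lemma continuous_of_rep {W : Type*} [TopologicalSpace W] {u : M → W}
    (hu : ∀ p : M, ContinuousOn (fun x => u ((chartAt (Euc n) p).symm x))
      (chartAt (Euc n) p).target) : Continuous u := by
  rw [continuous_iff_continuousAt]
  intro p
  have h1 := ((hu p).comp (chartAt (Euc n) p).continuousOn
    (chartAt (Euc n) p).mapsTo).continuousAt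
    ((chartAt (Euc n) p).open_source.mem_nhds (mem_chart_source _ p))
  refine h1.congr ?_
  filter_upwards [(chartAt (Euc n) p).open_source.mem_nhds (mem_chart_source _ p)] with q hq
  simp [(chartAt (Euc n) p).left_inv hq]

lemma SmoothInCharts.continuous {u : M → V} (hu : SmoothInCharts (n := n) u) : Continuous u :=
  continuous_of_rep (n := n) fun p => (hu p).continuousOn

lemma SmoothFamily.continuousOn {I : Set ℝ} {Φ : ℝ → M → V} (hI : IsOpen I)
    (hΦ : SmoothFamily (n := n) I Φ) :
    ContinuousOn (fun q : ℝ × M => Φ q.1 q.2) (I ×ˢ Set.univ) := by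
  rintro ⟨s, p⟩ ⟨hs, -⟩
  refine ContinuousAt.continuousWithinAt ?_
  set c := chartAt (Euc n) p
  have hmem : I ×ˢ c.source ∈ 𝓝 (s, p) :=
    (hI.prod c.open_source).mem_nhds ⟨hs, mem_chart_source _ p⟩
  have h1 : ContinuousOn (fun q : ℝ × M => rep (Φ q.1) p (c q.2)) (I ×ˢ c.source) := by
    refine (hΦ p).continuousOn.comp (f := fun q : ℝ × M => (q.1, c q.2)) ?_ ?_
    · exact continuousOn_fst.prodMk (c.continuousOn.comp continuousOn_snd fun q hq => hq.2)
    · exact fun q hq => ⟨hq.1, c.mapsTo hq.2⟩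
  refine (h1.continuousAt hmem).congr ?_
  filter_upwards [hmem] with q hq
  simp only [rep]
  rw [c.left_inv hq.2]

lemma SmoothFamily.smoothInCharts {I : Set ℝ} {Φ : ℝ → M → V}
    (hΦ : SmoothFamily (n := n) I Φ) {s : ℝ} (hs : s ∈ I) : SmoothInCharts (n := n) (Φ s) :=
  fun p => (hΦ p).comp (f := fun x => (s, x)) (contDiffOn_const.prodMk contDiffOn_id)
    fun _ hx => ⟨hs, hx⟩

lemma SmoothInCharts.family {u : M → V} (hu : SmoothInCharts (n := n) u) (I : Set ℝ) :
    SmoothFamily (n := n) I (fun _ => u) :=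
  fun p => (hu p).comp contDiffOn_snd fun _ hx => hx.2

lemma SmoothFamily.of_curve {I : Set ℝ} {c : ℝ → V} (hc : ContDiffOn ℝ ∞ c I) :
    SmoothFamily (n := n) (M := M) I (fun s _ => c s) :=
  fun _ => hc.comp contDiffOn_fst fun _ hx => hx.1

lemma SmoothFamily.mono {I J : Set ℝ} {Φ : ℝ → M → V} (hΦ : SmoothFamily (n := n) I Φ)
    (h : J ⊆ I) : SmoothFamily (n := n) J Φ :=
  fun p => (hΦ p).mono (Set.prod_mono h subset_rfl)

lemma SmoothFamily.differentiableAt {I : Set ℝ} (hI : IsOpen I) {Φ : ℝ → M → V}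
    (hΦ : SmoothFamily (n := n) I Φ) {s : ℝ} (hs : s ∈ I) (q : M) :
    DifferentiableAt ℝ (fun s => Φ s q) s := by
  set c := chartAt (Euc n) q
  have hmem : I ×ˢ c.target ∈ 𝓝 (s, c q) :=
    (hI.prod c.open_target).mem_nhds ⟨hs, mem_chart_target _ q⟩
  have h1 := ((hΦ q).contDiffAt hmem).differentiableAt (by simp)
  have h2 : DifferentiableAt ℝ (fun s : ℝ => (s, c q)) s :=
    differentiableAt_id.prodMk (differentiableAt_const _)
  have h3 := h1.comp s h2
  have h4 : ((fun q_1 : ℝ × Euc n => rep (Φ q_1.1) q q_1.2) ∘ fun s => (s, c q))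
      = fun s => Φ s q := by
    funext r
    simp only [Function.comp_apply, rep]
    rw [c.left_inv (mem_chart_source _ q)]
  rwa [h4] at h3

lemma SmoothFamily.hasDerivAt_rep {I : Set ℝ} (hI : IsOpen I) {Φ : ℝ → M → V}
    (hΦ : SmoothFamily (n := n) I Φ) {s : ℝ} (hs : s ∈ I) (p : M) {x : Euc n}
    (hx : x ∈ (chartAt (Euc n) p).target) :
    HasDerivAt (fun s => rep (Φ s) p x)
      (fderiv ℝ (fun q : ℝ × Euc n => rep (Φ q.1) p q.2) (s, x) (1, 0)) s := by
  have hmem : I ×ˢ (chartAt (Euc n) p).target ∈ 𝓝 (s, x) :=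
    (hI.prod (chartAt (Euc n) p).open_target).mem_nhds ⟨hs, hx⟩
  have h1 := ((hΦ p).contDiffAt hmem).differentiableAt (by simp)
  exact h1.hasFDerivAt.comp_hasDerivAt s ((hasDerivAt_id s).prodMk (hasDerivAt_const s x))

lemma SmoothFamily.hasFDerivAt_rep {I : Set ℝ} (hI : IsOpen I) {Φ : ℝ → M → V}
    (hΦ : SmoothFamily (n := n) I Φ) {s : ℝ} (hs : s ∈ I) (p : M) {x : Euc n}
    (hx : x ∈ (chartAt (Euc n) p).target) (i : Fin n) :
    pd i (rep (Φ s) p) x = fderiv ℝ (fun q : ℝ × Euc n => rep (Φ q.1) p q.2) (s, x)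
      (0, EuclideanSpace.single i 1) := by
  have hmem : I ×ˢ (chartAt (Euc n) p).target ∈ 𝓝 (s, x) :=
    (hI.prod (chartAt (Euc n) p).open_target).mem_nhds ⟨hs, hx⟩
  have h1 := ((hΦ p).contDiffAt hmem).differentiableAt (by simp)
  have h2 : HasFDerivAt (fun x : Euc n => (s, x))
      (ContinuousLinearMap.inr ℝ ℝ (Euc n)) x := hasFDerivAt_prodMk_right s x
  have h3 := h1.hasFDerivAt.comp x h2
  have h4 : ((fun q : ℝ × Euc n => rep (Φ q.1) p q.2) ∘ fun x => (s, x)) = rep (Φ s) p := rfl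
  rw [h4] at h3
  simp [pd, h3.fderiv]

/-- The derivative of a smooth family with respect to the parameter is a smooth family. -/
lemma SmoothFamily.deriv {I : Set ℝ} (hI : IsOpen I) {Φ : ℝ → M → V}
    (hΦ : SmoothFamily (n := n) I Φ) :
    SmoothFamily (n := n) I (fun s p => deriv (fun s => Φ s p) s) := by
  intro p
  have hU : IsOpen (I ×ˢ (chartAt (Euc n) p).target) := hI.prod (chartAt (Euc n) p).open_target
  have h1 : ContDiffOn ℝ ∞ (fun q => fderiv ℝ (fun q : ℝ × Euc n => rep (Φ q.1) p q.2) q (1, 0))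
      (I ×ˢ (chartAt (Euc n) p).target) :=
    ((hΦ p).fderiv_of_isOpen hU (by simp)).clm_apply contDiffOn_const
  refine h1.congr fun q hq => ?_
  exact (hΦ.hasDerivAt_rep hI hq.1 p hq.2).deriv

lemma SmoothFamily.contDiffOn_pd {I : Set ℝ} (hI : IsOpen I) {Φ : ℝ → M → V}
    (hΦ : SmoothFamily (n := n) I Φ) (p : M) (i : Fin n) :
    ContDiffOn ℝ ∞ (fun q : ℝ × Euc n => pd i (rep (Φ q.1) p) q.2)
      (I ×ˢ (chartAt (Euc n) p).target) := by
  have hU : IsOpen (I ×ˢ (chartAt (Euc n) p).target) := hI.prod (chartAt (Euc n) p).open_target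
  refine (((hΦ p).fderiv_of_isOpen (m := ∞) hU (by simp)).clm_apply
    (contDiffOn_const (c := ((0 : ℝ), EuclideanSpace.single i (1 : ℝ))))).congr fun q hq => ?_
  exact hΦ.hasFDerivAt_rep hI hq.1 p hq.2 i

/-- Parameter derivatives and coordinate derivatives commute. -/
lemma SmoothFamily.hasDerivAt_pd {I : Set ℝ} (hI : IsOpen I) {Φ : ℝ → M → V}
    (hΦ : SmoothFamily (n := n) I Φ) {s : ℝ} (hs : s ∈ I) (p : M) {x : Euc n}
    (hx : x ∈ (chartAt (Euc n) p).target) (i : Fin n) :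
    HasDerivAt (fun s => pd i (rep (Φ s) p) x)
      (pd i (rep (fun q => _root_.deriv (fun s => Φ s q) s) p) x) s := by
  set U := I ×ˢ (chartAt (Euc n) p).target
  have hU : IsOpen U := hI.prod (chartAt (Euc n) p).open_target
  have hmem : U ∈ 𝓝 (s, x) := hU.mem_nhds ⟨hs, hx⟩
  set Ψ : ℝ × Euc n → V := fun q => rep (Φ q.1) p q.2 with hΨ
  have hD : DifferentiableAt ℝ (fderiv ℝ Ψ) (s, x) :=
    (((hΦ p).fderiv_of_isOpen (m := ∞) hU (by simp)).contDiffAt hmem).differentiableAt (by simp)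
  -- Both mixed derivatives are values of the second derivative of the joint map on ℝ × ℝⁿ, which is
  -- symmetric.
  have hsymm : fderiv ℝ (fderiv ℝ Ψ) (s, x) (1, 0) (0, EuclideanSpace.single i 1)
      = fderiv ℝ (fderiv ℝ Ψ) (s, x) (0, EuclideanSpace.single i 1) (1, 0) :=
    ((((hΦ p).contDiffAt hmem).isSymmSndFDerivAt
      (by rw [minSmoothness_of_isRCLikeNormedField]; exact WithTop.coe_le_coe.2 le_top)) _ _)
  have h1 : HasDerivAt (fun s => fderiv ℝ Ψ (s, x) (0, EuclideanSpace.single i 1))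
      (fderiv ℝ (fderiv ℝ Ψ) (s, x) (1, 0) (0, EuclideanSpace.single i 1)) s := by
    have h := hD.hasFDerivAt.comp_hasDerivAt s ((hasDerivAt_id s).prodMk (hasDerivAt_const s x))
    exact ((ContinuousLinearMap.apply ℝ V ((0 : ℝ), EuclideanSpace.single i (1 : ℝ))).hasFDerivAt
      (x := fderiv ℝ Ψ (s, x))).comp_hasDerivAt s h
  have h2 : pd i (rep (fun q => _root_.deriv (fun s => Φ s q) s) p) x
      = fderiv ℝ (fderiv ℝ Ψ) (s, x) (0, EuclideanSpace.single i 1) (1, 0) := by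
    rw [(hΦ.deriv hI).hasFDerivAt_rep hI hs p hx i]
    have hev : (fun q : ℝ × Euc n => rep (fun r => _root_.deriv (fun s => Φ s r) q.1) p q.2)
        =ᶠ[𝓝 (s, x)] fun q => fderiv ℝ Ψ q (1, 0) := by
      filter_upwards [hmem] with q hq
      exact (hΦ.hasDerivAt_rep hI hq.1 p hq.2).deriv
    rw [hev.fderiv_eq]
    have h := ((ContinuousLinearMap.apply ℝ V ((1 : ℝ), (0 : Euc n))).hasFDerivAt
      (x := fderiv ℝ Ψ (s, x))).comp (s, x) hD.hasFDerivAt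
    rw [show (fun q => fderiv ℝ Ψ q (1, 0)) =
      (ContinuousLinearMap.apply ℝ V ((1 : ℝ), (0 : Euc n))) ∘ fderiv ℝ Ψ from rfl, h.fderiv]
    rfl
  rw [h2, ← hsymm]
  refine h1.congr_of_eventuallyEq ?_
  filter_upwards [hI.mem_nhds hs] with r hr
  exact hΦ.hasFDerivAt_rep hI hr p hx i

lemma SmoothInCharts.differentiableAt_rep {u : M → V} (hu : SmoothInCharts (n := n) u) (p : M)
    {x : Euc n} (hx : x ∈ (chartAt (Euc n) p).target) : DifferentiableAt ℝ (rep u p) x :=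
  ((hu p).contDiffAt ((chartAt (Euc n) p).open_target.mem_nhds hx)).differentiableAt (by simp)

lemma SmoothInCharts.contDiffOn_pd {u : M → V} (hu : SmoothInCharts (n := n) u) (p : M)
    (i : Fin n) : ContDiffOn ℝ ∞ (pd i (rep u p)) (chartAt (Euc n) p).target :=
  ((hu p).fderiv_of_isOpen (chartAt (Euc n) p).open_target (by simp)).clm_apply contDiffOn_const

end Charts

/-! ### Independence of the chart. -/

section Covariance

variable {n : ℕ} {M : Type*} [TopologicalSpace M] [ChartedSpace (Euc n) M]
  [IsManifold (𝓡 n) ∞ M]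
  {V : Type*} [NormedAddCommGroup V] [NormedSpace ℝ V]

/-- The change of coordinates from the preferred chart at `p` to the one at `q`. -/
def transition (p q : M) (x : Euc n) : Euc n := chartAt (Euc n) q ((chartAt (Euc n) p).symm x)

/-- The Jacobian matrix of the change of coordinates. -/
def transitionMat (p q : M) (x : Euc n) : Matrix (Fin n) (Fin n) ℝ :=
  Matrix.of fun i k => (pd i (transition p q) x) k

/-- The part of the preferred chart at `p` that is mapped into the domain of the one at `q`. -/
def overlap (p q : M) : Set (Euc n) :=
  (chartAt (Euc n) p).target ∩ (chartAt (Euc n) p).symm ⁻¹' (chartAt (Euc n) q).source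

lemma isOpen_overlap (p q : M) : IsOpen (overlap (n := n) p q) :=
  (chartAt (Euc n) p).isOpen_inter_preimage_symm (chartAt (Euc n) q).open_source

lemma transition_mem {p q : M} {x : Euc n} (hx : x ∈ overlap p q) :
    transition p q x ∈ overlap q p := by
  refine ⟨(chartAt (Euc n) q).mapsTo hx.2, ?_⟩
  simp only [Set.mem_preimage, transition]
  rw [(chartAt (Euc n) q).left_inv hx.2]
  exact (chartAt (Euc n) p).map_target hx.1

lemma transition_transition {p q : M} {x : Euc n} (hx : x ∈ overlap p q) :
    transition q p (transition p q x) = x := by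
  simp only [transition]
  rw [(chartAt (Euc n) q).left_inv hx.2, (chartAt (Euc n) p).right_inv hx.1]

lemma contDiffOn_transition (p q : M) :
    ContDiffOn ℝ ∞ (transition (n := n) p q) (overlap p q) := by
  have h := contDiffOn_ext_coord_change (I := 𝓡 n) (n := ∞) (x := q) (x' := p)
  simp only [mfld_simps] at h
  exact h

lemma differentiableAt_transition {p q : M} {x : Euc n} (hx : x ∈ overlap p q) :
    DifferentiableAt ℝ (transition p q) x :=
  ((contDiffOn_transition p q).contDiffAt ((isOpen_overlap p q).mem_nhds hx)).differentiableAt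
    (by simp)

lemma rep_eventuallyEq (u : M → V) {p q : M} {x : Euc n} (hx : x ∈ overlap p q) :
    rep u p =ᶠ[𝓝 x] rep u q ∘ transition p q := by
  filter_upwards [(isOpen_overlap p q).mem_nhds hx] with z hz
  simp only [rep, transition, Function.comp_apply]
  rw [(chartAt (Euc n) q).left_inv hz.2]

lemma euc_eq_sum (v : Euc n) : v = ∑ k, v k • EuclideanSpace.single k (1 : ℝ) := by
  ext j
  simp [Pi.single_apply]

lemma fderiv_eq_sum_pd (u : Euc n → V) (x v : Euc n) :
    fderiv ℝ u x v = ∑ k, v k • pd k u x := by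
  conv_lhs => rw [euc_eq_sum v]
  simp [pd]

lemma pd_rep_transition {u : M → V} (hu : SmoothInCharts (n := n) u) {p q : M} {x : Euc n}
    (hx : x ∈ overlap p q) (i : Fin n) :
    pd i (rep u p) x = ∑ k, transitionMat p q x i k • pd k (rep u q) (transition p q x) := by
  have h1 := hu.differentiableAt_rep q (transition_mem hx).1
  rw [pd, (rep_eventuallyEq u hx).fderiv_eq, fderiv_comp _ h1 (differentiableAt_transition hx),
    ContinuousLinearMap.comp_apply, fderiv_eq_sum_pd]
  rfl

/-- The rows of `transitionMat` are the partial derivatives, so it is the transpose of the usual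
matrix of the differential; the determinant does not see the difference. -/
lemma transitionMat_eq (p q : M) (x : Euc n) :
    transitionMat p q x = (LinearMap.toMatrix (EuclideanSpace.basisFun (Fin n) ℝ).toBasis
      (EuclideanSpace.basisFun (Fin n) ℝ).toBasis
      (fderiv ℝ (transition p q) x : Euc n →ₗ[ℝ] Euc n)).transpose := by
  ext i k
  simp [transitionMat, pd, LinearMap.toMatrix_apply]

lemma det_transitionMat (p q : M) (x : Euc n) :
    (transitionMat p q x).det = (fderiv ℝ (transition p q) x).det := by
  rw [transitionMat_eq, Matrix.det_transpose, LinearMap.det_toMatrix, ContinuousLinearMap.det]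

/-- The reverse change of coordinates is a local inverse, so by the chain rule the two Jacobian
determinants have product 1. -/
lemma isUnit_det_transitionMat {p q : M} {x : Euc n} (hx : x ∈ overlap p q) :
    IsUnit (transitionMat p q x).det := by
  have h1 : transition q p ∘ transition p q =ᶠ[𝓝 x] id := by
    filter_upwards [(isOpen_overlap p q).mem_nhds hx] with z hz
    exact transition_transition hz
  have h2 := fderiv_comp x (differentiableAt_transition (transition_mem hx))
    (differentiableAt_transition hx)
  rw [h1.fderiv_eq, fderiv_id] at h2
  rw [det_transitionMat]
  have h3 : (1 : ℝ) = (fderiv ℝ (transition q p) (transition p q x)).det *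
      (fderiv ℝ (transition p q) x).det := by
    have := congrArg (fun L : Euc n →L[ℝ] Euc n => LinearMap.det (L : Euc n →ₗ[ℝ] Euc n)) h2
    simpa [ContinuousLinearMap.det] using this
  exact isUnit_iff_ne_zero.2 fun h0 => by simp [h0] at h3

/-- The coordinate frame of `X` in the preferred chart at `p`. -/
def coordFrame (X : M → V) (p : M) (x : Euc n) : Fin n → V := fun i => pd i (rep X p) x

lemma coordFrame_transition {u : M → V} (hu : SmoothInCharts (n := n) u) {p q : M} {x : Euc n}
    (hx : x ∈ overlap p q) :
    coordFrame u p x = fun i => ∑ k, transitionMat p q x i k • coordFrame u q (transition p q x) k :=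
  funext fun i => pd_rep_transition hu hx i

lemma mem_overlap_self {p q : M} (hq : q ∈ (chartAt (Euc n) p).source) :
    chartAt (Euc n) p q ∈ overlap (n := n) p q := by
  refine ⟨(chartAt (Euc n) p).mapsTo hq, ?_⟩
  simp only [Set.mem_preimage]
  rw [(chartAt (Euc n) p).left_inv hq]
  exact mem_chart_source _ q

lemma transition_self {p q : M} (hq : q ∈ (chartAt (Euc n) p).source) :
    transition p q (chartAt (Euc n) p q) = chartAt (Euc n) q q := by
  simp only [transition]
  rw [(chartAt (Euc n) p).left_inv hq]

/-- The manifold derivative at q is read in the preferred chart at q itself. This translates the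
immersion and normality hypotheses into statements about coordinate frames. -/
lemma mfderiv_single {u : M → V} {q : M} (hu : MDifferentiableAt (𝓡 n) 𝓘(ℝ, V) u q) (v : Euc n) :
    mfderiv (𝓡 n) 𝓘(ℝ, V) u q v = fderiv ℝ (rep u q) (chartAt (Euc n) q q) v := by
  obtain ⟨L, hL⟩ : ∃ L : Euc n →L[ℝ] V, L = mfderiv (𝓡 n) 𝓘(ℝ, V) u q := ⟨_, rfl⟩
  have h : HasFDerivAt (rep u q) L (chartAt (Euc n) q q) := by
    have h' := hu.hasMFDerivAt.2
    simp only [mfld_simps] at h'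
    rw [hL]
    exact hasFDerivWithinAt_univ.1 h'
  rw [h.fderiv, hL]
  rfl

variable {X : M → Euc (n + 1)}

lemma IsSmoothImmersion.smoothInCharts (hX : IsSmoothImmersion X) : SmoothInCharts (n := n) X :=
  SmoothInCharts.of_contMDiff hX.1

lemma IsSmoothImmersion.linearIndependent_self (hX : IsSmoothImmersion X) (q : M) :
    LinearIndependent ℝ (coordFrame X q (chartAt (Euc n) q q)) := by
  have h0 := hX.2 q
  have hm : MDifferentiableAt (𝓡 n) 𝓘(ℝ, Euc (n + 1)) X q := hX.1.mdifferentiableAt (by simp)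
  have h1 : Function.Injective (fderiv ℝ (rep X q) (chartAt (Euc n) q q)) := by
    intro a b hab
    exact h0 (by rw [mfderiv_single hm, mfderiv_single hm]; exact hab)
  have h2 := (EuclideanSpace.basisFun (Fin n) ℝ).toBasis.linearIndependent.map'
    (fderiv ℝ (rep X q) (chartAt (Euc n) q q) : Euc n →ₗ[ℝ] Euc (n + 1))
    (LinearMap.ker_eq_bot.2 h1)
  have h3 : coordFrame X q (chartAt (Euc n) q q)
      = ⇑(fderiv ℝ (rep X q) (chartAt (Euc n) q q) : Euc n →ₗ[ℝ] Euc (n + 1)) ∘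
        (EuclideanSpace.basisFun (Fin n) ℝ).toBasis := by
    funext i
    simp [coordFrame, pd]
  rw [h3]
  exact h2

lemma linearIndependent_lin {E : Type*} [NormedAddCommGroup E] [InnerProductSpace ℝ E]
    {A : Matrix (Fin n) (Fin n) ℝ} (hA : IsUnit A.det) {e : Fin n → E}
    (he : LinearIndependent ℝ e) : LinearIndependent ℝ (fun i => ∑ k, A i k • e k) := by
  rw [← Matrix.det_gram_ne_zero_iff_linearIndependent] at he ⊢
  rw [gram_lin, Matrix.det_mul, Matrix.det_mul, Matrix.det_transpose]
  exact mul_ne_zero (mul_ne_zero hA.ne_zero he) hA.ne_zero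

/-- Injectivity of the differential speaks about each point in its own chart; an invertible Jacobian
carries independence to any other chart containing the point. -/
lemma IsSmoothImmersion.linearIndependent (hX : IsSmoothImmersion X) (p : M) {x : Euc n}
    (hx : x ∈ (chartAt (Euc n) p).target) : LinearIndependent ℝ (coordFrame X p x) := by
  set q := (chartAt (Euc n) p).symm x
  have hq : q ∈ (chartAt (Euc n) p).source := (chartAt (Euc n) p).map_target hx
  have hxq : chartAt (Euc n) p q = x := (chartAt (Euc n) p).right_inv hx
  have ho := mem_overlap_self hq
  rw [← hxq, coordFrame_transition hX.smoothInCharts ho, transition_self hq]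
  exact linearIndependent_lin (isUnit_det_transitionMat ho) (hX.linearIndependent_self q)

lemma areaDensity_eq (X : M → Euc (n + 1)) (p : M) (x : Euc n) :
    areaDensity X p x = Real.sqrt (Matrix.gram ℝ (coordFrame X p x)).det := rfl

lemma areaDensity_transition (hX : SmoothInCharts (n := n) X) {p q : M} {x : Euc n}
    (hx : x ∈ overlap p q) :
    areaDensity X p x = |(transitionMat p q x).det| * areaDensity X q (transition p q x) := by
  rw [areaDensity_eq, coordFrame_transition hX hx, sqrt_det_gram_lin]
  rfl

lemma areaDensity_pos (hX : IsSmoothImmersion X) (p : M) {x : Euc n}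
    (hx : x ∈ (chartAt (Euc n) p).target) : 0 < areaDensity X p x :=
  Real.sqrt_pos.2 (gram_det_pos (hX.linearIndependent p hx))

/-- The divergence along `X` of a field `V` with values in the ambient space. -/
def surfaceDiv (X V : M → Euc (n + 1)) (p : M) : ℝ :=
  frameDiv (coordFrame X p (chartAt (Euc n) p p)) (coordFrame V p (chartAt (Euc n) p p))

/-- The quotient of the area densities of two immersions. -/
def relDensity (X Y : M → Euc (n + 1)) (p : M) : ℝ :=
  areaDensity Y p (chartAt (Euc n) p p) / areaDensity X p (chartAt (Euc n) p p)

lemma grad_eq (X : M → Euc (n + 1)) (f : M → ℝ) (p : M) :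
    grad X f p = frameGrad (coordFrame X p (chartAt (Euc n) p p))
      (coordFrame f p (chartAt (Euc n) p p)) := rfl

/-- The value at each point is defined through that point's own preferred chart, which varies
discontinuously with the point. Covariance allows one fixed chart to be used on its whole domain,
and smoothness becomes visible. -/
lemma surfaceDiv_chart {X V : M → Euc (n + 1)} (hX : SmoothInCharts (n := n) X)
    (hV : SmoothInCharts (n := n) V) {p : M} {x : Euc n} (hx : x ∈ (chartAt (Euc n) p).target) :
    surfaceDiv X V ((chartAt (Euc n) p).symm x)
      = frameDiv (coordFrame X p x) (coordFrame V p x) := by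
  set q := (chartAt (Euc n) p).symm x
  have hq : q ∈ (chartAt (Euc n) p).source := (chartAt (Euc n) p).map_target hx
  have hxq : chartAt (Euc n) p q = x := (chartAt (Euc n) p).right_inv hx
  have ho := mem_overlap_self hq
  rw [surfaceDiv, ← transition_self hq, ← frameDiv_lin (isUnit_det_transitionMat ho),
    ← coordFrame_transition hX ho, ← coordFrame_transition hV ho, hxq]

lemma grad_chart {f : M → ℝ} (hX : SmoothInCharts (n := n) X)
    (hf : SmoothInCharts (n := n) f) {p : M} {x : Euc n} (hx : x ∈ (chartAt (Euc n) p).target) :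
    grad X f ((chartAt (Euc n) p).symm x)
      = frameGrad (coordFrame X p x) (coordFrame f p x) := by
  set q := (chartAt (Euc n) p).symm x
  have hq : q ∈ (chartAt (Euc n) p).source := (chartAt (Euc n) p).map_target hx
  have hxq : chartAt (Euc n) p q = x := (chartAt (Euc n) p).right_inv hx
  have ho := mem_overlap_self hq
  rw [grad_eq, ← transition_self hq, ← frameGrad_lin (isUnit_det_transitionMat ho),
    ← coordFrame_transition hX ho, ← hxq, coordFrame_transition hf ho]
  rfl

/-- Both densities pick up the same factor |det| under a change of chart, so their quotient is a
genuine function on M. -/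
lemma relDensity_chart {X Y : M → Euc (n + 1)} (hX : SmoothInCharts (n := n) X)
    (hY : SmoothInCharts (n := n) Y) {p : M} {x : Euc n} (hx : x ∈ (chartAt (Euc n) p).target) :
    relDensity X Y ((chartAt (Euc n) p).symm x) = areaDensity Y p x / areaDensity X p x := by
  set q := (chartAt (Euc n) p).symm x
  have hq : q ∈ (chartAt (Euc n) p).source := (chartAt (Euc n) p).map_target hx
  have hxq : chartAt (Euc n) p q = x := (chartAt (Euc n) p).right_inv hx
  have ho := mem_overlap_self hq
  rw [← hxq, areaDensity_transition hX ho, areaDensity_transition hY ho, transition_self hq,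
    mul_div_mul_left _ _ (abs_ne_zero.2 (isUnit_det_transitionMat ho).ne_zero)]
  rfl

end Covariance

end LambdaHypersurface
end

noncomputable section

namespace LambdaHypersurface

/-! ### Smooth dependence of frame quantities on parameters. -/

section MatrixSmooth

variable {n : ℕ} {F : Type*} [NormedAddCommGroup F] [NormedSpace ℝ F]
  {G : F → Matrix (Fin n) (Fin n) ℝ} {U : Set F}

lemma contDiffOn_det (hG : ∀ i j, ContDiffOn ℝ ∞ (fun x => G x i j) U) :
    ContDiffOn ℝ ∞ (fun x => (G x).det) U := by
  simp only [Matrix.det_apply']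
  exact ContDiffOn.sum fun σ _ => contDiffOn_const.mul (contDiffOn_prod fun i _ => hG _ _)

lemma contDiffOn_inv_matrix (hG : ∀ i j, ContDiffOn ℝ ∞ (fun x => G x i j) U)
    (hdet : ∀ x ∈ U, (G x).det ≠ 0) (i j : Fin n) :
    ContDiffOn ℝ ∞ (fun x => (G x)⁻¹ i j) U := by
  have h1 : ∀ x, (G x)⁻¹ i j = (G x).det⁻¹ * ((G x).updateRow j (Pi.single i 1)).det := by
    intro s
    rw [Matrix.inv_def, Matrix.smul_apply, Matrix.adjugate_apply, smul_eq_mul,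
      Ring.inverse_eq_inv']
  simp only [h1]
  refine ((contDiffOn_det hG).inv hdet).mul (contDiffOn_det fun k l => ?_)
  by_cases hk : k = j
  · subst hk; simp only [Matrix.updateRow_self]; exact contDiffOn_const
  · simp only [Matrix.updateRow_ne hk]; exact hG k l

variable {E : Type*} [NormedAddCommGroup E] [InnerProductSpace ℝ E] {e d : F → Fin n → E}

lemma contDiffOn_gram (he : ∀ i, ContDiffOn ℝ ∞ (fun x => e x i) U) (i j : Fin n) :
    ContDiffOn ℝ ∞ (fun x => Matrix.gram ℝ (e x) i j) U := (he i).inner ℝ (he j)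

lemma contDiffOn_sqrt_det_gram (he : ∀ i, ContDiffOn ℝ ∞ (fun x => e x i) U)
    (hli : ∀ x ∈ U, LinearIndependent ℝ (e x)) :
    ContDiffOn ℝ ∞ (fun x => Real.sqrt (Matrix.gram ℝ (e x)).det) U :=
  (contDiffOn_det (contDiffOn_gram he)).sqrt fun x hx => (gram_det_pos (hli x hx)).ne'

lemma contDiffOn_gram_inv (he : ∀ i, ContDiffOn ℝ ∞ (fun x => e x i) U)
    (hli : ∀ x ∈ U, LinearIndependent ℝ (e x)) (i j : Fin n) :
    ContDiffOn ℝ ∞ (fun x => (Matrix.gram ℝ (e x))⁻¹ i j) U :=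
  contDiffOn_inv_matrix (contDiffOn_gram he) (fun x hx => (gram_det_pos (hli x hx)).ne') i j

lemma contDiffOn_frameDiv (he : ∀ i, ContDiffOn ℝ ∞ (fun x => e x i) U)
    (hli : ∀ x ∈ U, LinearIndependent ℝ (e x))
    (hd : ∀ i, ContDiffOn ℝ ∞ (fun x => d x i) U) :
    ContDiffOn ℝ ∞ (fun x => frameDiv (e x) (d x)) U :=
  ContDiffOn.sum fun i _ => ContDiffOn.sum fun j _ =>
    (contDiffOn_gram_inv he hli i j).mul ((hd i).inner ℝ (he j))

lemma contDiffOn_frameGrad {a : F → Fin n → ℝ} (he : ∀ i, ContDiffOn ℝ ∞ (fun x => e x i) U)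
    (hli : ∀ x ∈ U, LinearIndependent ℝ (e x))
    (ha : ∀ i, ContDiffOn ℝ ∞ (fun x => a x i) U) :
    ContDiffOn ℝ ∞ (fun x => frameGrad (e x) (a x)) U :=
  ContDiffOn.sum fun i _ => ContDiffOn.sum fun j _ =>
    ((contDiffOn_gram_inv he hli i j).mul (ha i)).smul (he j)

end MatrixSmooth

/-! ### Smoothness of divergence, gradient and relative density. -/

section Smoothness

variable {n : ℕ} {M : Type*} [TopologicalSpace M] [ChartedSpace (Euc n) M] [IsManifold (𝓡 n) ∞ M]
  {X V : M → Euc (n + 1)}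

lemma contDiffOn_areaDensity (hX : IsSmoothImmersion X) (p : M) :
    ContDiffOn ℝ ∞ (areaDensity X p) (chartAt (Euc n) p).target :=
  contDiffOn_sqrt_det_gram (fun i => hX.smoothInCharts.contDiffOn_pd p i)
    fun _ hx => hX.linearIndependent p hx

lemma SmoothInCharts.surfaceDiv (hX : IsSmoothImmersion X) (hV : SmoothInCharts (n := n) V) :
    SmoothInCharts (n := n) (surfaceDiv X V) := fun p =>
  (contDiffOn_frameDiv (fun i => hX.smoothInCharts.contDiffOn_pd p i)
    (fun _ hx => hX.linearIndependent p hx) (fun i => hV.contDiffOn_pd p i)).congr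
    fun _ hx => surfaceDiv_chart hX.smoothInCharts hV hx

lemma SmoothInCharts.grad {f : M → ℝ} (hX : IsSmoothImmersion X)
    (hf : SmoothInCharts (n := n) f) : SmoothInCharts (n := n) (grad X f) := fun p =>
  (contDiffOn_frameGrad (fun i => hX.smoothInCharts.contDiffOn_pd p i)
    (fun _ hx => hX.linearIndependent p hx) (fun i => hf.contDiffOn_pd p i)).congr
    fun _ hx => grad_chart hX.smoothInCharts hf hx

lemma SmoothFamily.relDensity {I : Set ℝ} (hI : IsOpen I) {Φ : ℝ → M → Euc (n + 1)}
    (hX : IsSmoothImmersion X) (hΦ : SmoothFamily (n := n) I Φ)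
    (hΦi : ∀ s ∈ I, IsSmoothImmersion (Φ s)) :
    SmoothFamily (n := n) I (fun s => relDensity X (Φ s)) := fun p => by
  have h1 : ContDiffOn ℝ ∞ (fun q : ℝ × Euc n => areaDensity (Φ q.1) p q.2)
      (I ×ˢ (chartAt (Euc n) p).target) :=
    contDiffOn_sqrt_det_gram (e := fun q : ℝ × Euc n => coordFrame (Φ q.1) p q.2)
      (fun i => hΦ.contDiffOn_pd hI p i) fun q hq => (hΦi q.1 hq.1).linearIndependent p hq.2
  have h2 : ContDiffOn ℝ ∞ (fun q : ℝ × Euc n => areaDensity X p q.2)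
      (I ×ˢ (chartAt (Euc n) p).target) :=
    (contDiffOn_areaDensity hX p).comp contDiffOn_snd fun _ hq => hq.2
  refine (h1.div h2 fun q hq => (areaDensity_pos hX p hq.2).ne').congr fun q hq => ?_
  exact relDensity_chart hX.smoothInCharts (hΦ.smoothInCharts hq.1) hq.2

lemma relDensity_pos {Y : M → Euc (n + 1)} (hX : IsSmoothImmersion X) (hY : IsSmoothImmersion Y)
    (p : M) : 0 < relDensity X Y p :=
  div_pos (areaDensity_pos hY p (mem_chart_target _ p)) (areaDensity_pos hX p (mem_chart_target _ p))

lemma continuous_relDensity {Y : M → Euc (n + 1)} (hX : IsSmoothImmersion X)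
    (hY : IsSmoothImmersion Y) : Continuous (relDensity X Y) :=
  ((SmoothFamily.relDensity isOpen_univ hX (hY.smoothInCharts.family Set.univ)
    fun _ _ => hY).smoothInCharts (Set.mem_univ 0)).continuous

end Smoothness

/-! ### The area measure. -/

section Area

open MeasureTheory ENNReal

variable {n : ℕ} {M : Type*} [TopologicalSpace M] [ChartedSpace (Euc n) M] [IsManifold (𝓡 n) ∞ M]
  [MeasurableSpace M] [BorelSpace M] {X : M → Euc (n + 1)}

lemma aemeasurable_density (hX : IsSmoothImmersion X) (p : M) :
    AEMeasurable (fun x => ENNReal.ofReal (areaDensity X p x))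
      (volume.restrict (chartAt (Euc n) p).target) :=
  ((contDiffOn_areaDensity hX p).continuousOn.aemeasurable
    (chartAt (Euc n) p).open_target.measurableSet).ennreal_ofReal

lemma aemeasurable_chart_symm (p : M) : AEMeasurable (chartAt (Euc n) p).symm
    (volume.restrict (chartAt (Euc n) p).target) :=
  (chartAt (Euc n) p).continuousOn_symm.aemeasurable (chartAt (Euc n) p).open_target.measurableSet

lemma aemeasurable_chart_symm_density (X : M → Euc (n + 1)) (p : M) :
    AEMeasurable (chartAt (Euc n) p).symm
      ((volume.restrict (chartAt (Euc n) p).target).withDensity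
        fun x => ENNReal.ofReal (areaDensity X p x)) :=
  (aemeasurable_chart_symm p).mono_ac (withDensity_absolutelyContinuous _ _)

lemma lintegral_chartArea (hX : IsSmoothImmersion X) (p : M) {f : M → ℝ≥0∞} (hf : Measurable f) :
    ∫⁻ q, f q ∂(chartArea X p) = ∫⁻ x in (chartAt (Euc n) p).target,
      ENNReal.ofReal (areaDensity X p x) * f ((chartAt (Euc n) p).symm x) := by
  rw [chartArea, lintegral_map' hf.aemeasurable (aemeasurable_chart_symm_density X p)]
  exact lintegral_withDensity_eq_lintegral_mul₀ (aemeasurable_density hX p)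
    (hf.comp_aemeasurable (aemeasurable_chart_symm p))

lemma chartArea_inter_source (hX : IsSmoothImmersion X) (p q : M) {A : Set M}
    (hA : MeasurableSet A) :
    chartArea X p (A ∩ (chartAt (Euc n) q).source) = ∫⁻ x in overlap p q,
      ENNReal.ofReal (areaDensity X p x) * A.indicator 1 ((chartAt (Euc n) p).symm x) := by
  have hm : MeasurableSet (A ∩ (chartAt (Euc n) q).source) :=
    hA.inter (chartAt (Euc n) q).open_source.measurableSet
  rw [← lintegral_indicator_one hm, lintegral_chartArea hX p (measurable_one.indicator hm),
    ← lintegral_indicator (chartAt (Euc n) p).open_target.measurableSet,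
    ← lintegral_indicator (isOpen_overlap p q).measurableSet]
  refine lintegral_congr fun x => ?_
  by_cases h1 : x ∈ (chartAt (Euc n) p).target
  · rw [Set.indicator_of_mem h1]
    by_cases h2 : (chartAt (Euc n) p).symm x ∈ (chartAt (Euc n) q).source
    · rw [Set.indicator_of_mem (s := overlap p q) ⟨h1, h2⟩]
      by_cases h3 : (chartAt (Euc n) p).symm x ∈ A
      · rw [Set.indicator_of_mem h3, 
          Set.indicator_of_mem (s := A ∩ (chartAt (Euc n) q).source) ⟨h3, h2⟩]
      · rw [Set.indicator_of_notMem h3, Set.indicator_of_notMem fun h => h3 h.1]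
    · rw [Set.indicator_of_notMem (s := overlap p q) (fun h => h2 h.2),
        Set.indicator_of_notMem fun h => h2 h.2, mul_zero]
  · rw [Set.indicator_of_notMem h1, Set.indicator_of_notMem fun h => h1 h.1]

lemma injOn_transition (p q : M) : Set.InjOn (transition (n := n) p q) (overlap p q) :=
  fun x hx z hz h => by
    rw [← transition_transition hx, ← transition_transition hz, h]

lemma image_transition (p q : M) : transition (n := n) p q '' overlap p q = overlap q p := by
  ext x
  constructor
  · rintro ⟨z, hz, rfl⟩; exact transition_mem hz
  · exact fun hx => ⟨_, transition_mem hx, transition_transition hx⟩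

/-- Change of variables along the transition map: the Jacobian factor is exactly the one by which
the area densities differ. -/
lemma chartArea_restrict_comm (hX : IsSmoothImmersion X) (p q : M) :
    (chartArea X p).restrict (chartAt (Euc n) q).source
      = (chartArea X q).restrict (chartAt (Euc n) p).source := by
  ext A hA
  rw [Measure.restrict_apply hA, Measure.restrict_apply hA, chartArea_inter_source hX p q hA,
    chartArea_inter_source hX q p hA, ← image_transition p q,
    lintegral_image_eq_lintegral_abs_det_fderiv_mul volume (isOpen_overlap p q).measurableSet
      (fun x hx => (differentiableAt_transition hx).hasFDerivAt.hasFDerivWithinAt)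
      (injOn_transition p q)]
  refine setLIntegral_congr_fun (isOpen_overlap p q).measurableSet fun x hx => ?_
  rw [areaDensity_transition hX.smoothInCharts hx, ← det_transitionMat,
    ENNReal.ofReal_mul (abs_nonneg _), mul_assoc]
  congr 3
  simp only [transition]
  rw [(chartAt (Euc n) q).left_inv hx.2]

lemma chartArea_restrict_self (hX : IsSmoothImmersion X) (p : M) :
    (chartArea X p).restrict (chartAt (Euc n) p).source = chartArea X p := by
  ext A hA
  rw [Measure.restrict_apply hA, ← lintegral_indicator_one hA, chartArea_inter_source hX p p hA,
    lintegral_chartArea hX p (measurable_one.indicator hA)]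
  congr 2
  ext x
  simp only [overlap, Set.mem_inter_iff, Set.mem_preimage, and_iff_left_iff_imp]
  exact (chartAt (Euc n) p).map_target

/-- The nontrivial inequality concerns a supremum of measures. Each chart measure agrees with the
one at p inside the domain S of the chart at p, so the supremum is at most `chartArea X p` plus a
measure carried by the complement of S. -/
lemma areaMeasure_restrict (hX : IsSmoothImmersion X) (p : M) :
    (areaMeasure X).restrict (chartAt (Euc n) p).source = chartArea X p := by
  set S := (chartAt (Euc n) p).source
  have hS : MeasurableSet S := (chartAt (Euc n) p).open_source.measurableSet
  have hle : ∀ q : M, chartArea X q ≤ areaMeasure X := fun q => le_iSup (chartArea X) q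
  apply le_antisymm
  · have h1 : areaMeasure X ≤ chartArea X p + (areaMeasure X).restrict Sᶜ := by
      refine iSup_le fun q => ?_
      rw [← Measure.restrict_add_restrict_compl (μ := chartArea X q) hS]
      refine add_le_add ?_ (Measure.restrict_mono subset_rfl (hle q))
      rw [chartArea_restrict_comm hX q p]
      exact Measure.restrict_le_self
    refine (Measure.restrict_mono subset_rfl h1).trans ?_
    rw [Measure.restrict_add, Measure.restrict_restrict hS, Set.inter_compl_self,
      Measure.restrict_empty, add_zero]
    exact Measure.restrict_le_self
  · conv_lhs => rw [← chartArea_restrict_self hX p]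
    exact Measure.restrict_mono subset_rfl (hle p)

lemma integral_chartArea (hX : IsSmoothImmersion X) (p : M) {f : M → ℝ} (hf : Continuous f) :
    ∫ q, f q ∂(chartArea X p) = ∫ x in (chartAt (Euc n) p).target,
      areaDensity X p x * rep f p x := by
  have hm : AEStronglyMeasurable f (chartArea X p) :=
    hf.measurable.aestronglyMeasurable
  rw [chartArea, integral_map (aemeasurable_chart_symm_density X p) hm,
    integral_withDensity_eq_integral_toReal_smul₀ (aemeasurable_density hX p)
      (Filter.Eventually.of_forall fun _ => ENNReal.ofReal_lt_top)]
  refine integral_congr_ae (Filter.Eventually.of_forall fun x => ?_)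
  simp only [smul_eq_mul, rep]
  rw [ENNReal.toReal_ofReal (show 0 ≤ areaDensity X p x from Real.sqrt_nonneg _)]

lemma areaMeasure_lt_top_nhds (hX : IsSmoothImmersion X) (p : M) :
    ∃ U ∈ 𝓝 p, areaMeasure X U < ⊤ := by
  set c := chartAt (Euc n) p
  obtain ⟨r, hr, hrt⟩ := Metric.nhds_basis_closedBall.mem_iff.1
    (c.open_target.mem_nhds (mem_chart_target _ p))
  have hopen : IsOpen (c.source ∩ c ⁻¹' Metric.ball (c p) r) :=
    c.isOpen_inter_preimage Metric.isOpen_ball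
  refine ⟨_, hopen.mem_nhds ⟨mem_chart_source _ p, Metric.mem_ball_self hr⟩, ?_⟩
  have h1 : areaMeasure X (c.source ∩ c ⁻¹' Metric.ball (c p) r)
      = chartArea X p (c.source ∩ c ⁻¹' Metric.ball (c p) r) := by
    rw [← areaMeasure_restrict hX p, Measure.restrict_apply hopen.measurableSet]
    congr 1
    exact (Set.inter_eq_left.2 Set.inter_subset_left).symm
  rw [h1, ← lintegral_indicator_one hopen.measurableSet,
    lintegral_chartArea hX p (measurable_one.indicator hopen.measurableSet)]
  have h2 : IntegrableOn (areaDensity X p) (Metric.closedBall (c p) r) volume :=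
    ((contDiffOn_areaDensity hX p).continuousOn.mono hrt).integrableOn_compact
      (isCompact_closedBall _ _)
  refine lt_of_le_of_lt ?_ h2.lintegral_lt_top
  rw [← lintegral_indicator c.open_target.measurableSet,
    ← lintegral_indicator Metric.isClosed_closedBall.measurableSet]
  refine lintegral_mono fun x => ?_
  by_cases hx : x ∈ c.target
  · rw [Set.indicator_of_mem hx]
    by_cases hb : x ∈ Metric.closedBall (c p) r
    · rw [Set.indicator_of_mem hb]
      refine mul_le_of_le_one_right' ?_
      exact Set.indicator_le_self' (by simp) _
    · rw [Set.indicator_of_notMem (s := c.source ∩ c ⁻¹' Metric.ball (c p) r)]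
      · simp
      · rintro ⟨-, h⟩
        rw [Set.mem_preimage, c.right_inv hx] at h
        exact hb (Metric.ball_subset_closedBall h)
  · rw [Set.indicator_of_notMem hx]; exact zero_le

lemma isLocallyFiniteMeasure_areaMeasure (hX : IsSmoothImmersion X) :
    IsLocallyFiniteMeasure (areaMeasure X) := ⟨areaMeasure_lt_top_nhds hX⟩

/-- The density is strictly positive for an immersion. This is what later upgrades an almost
everywhere identity between continuous functions to an identity at every point. -/
lemma isOpenPosMeasure_areaMeasure (hX : IsSmoothImmersion X) :
    (areaMeasure X).IsOpenPosMeasure := by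
  refine ⟨fun U hU ⟨p, hp⟩ h0 => ?_⟩
  set c := chartAt (Euc n) p
  have h1 : chartArea X p U = 0 := by
    rw [← areaMeasure_restrict hX p]
    exact le_antisymm ((Measure.restrict_apply_le _ _).trans h0.le) zero_le
  rw [← lintegral_indicator_one hU.measurableSet,
    lintegral_chartArea hX p (measurable_one.indicator hU.measurableSet)] at h1
  set O := c.target ∩ c.symm ⁻¹' U
  have hO : IsOpen O := c.isOpen_inter_preimage_symm hU
  have hOne : (volume : Measure (Euc n)) O ≠ 0 := by
    refine (hO.measure_pos volume ⟨c p, mem_chart_target _ p, ?_⟩).ne'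
    simp only [Set.mem_preimage]
    rwa [c.left_inv (mem_chart_source _ p)]
  have h2 : ∫⁻ x in O, ENNReal.ofReal (areaDensity X p x) = 0 := by
    refine le_antisymm (le_trans ?_ h1.le) zero_le
    rw [← lintegral_indicator hO.measurableSet, ← lintegral_indicator c.open_target.measurableSet]
    refine lintegral_mono fun x => ?_
    by_cases hx : x ∈ O
    · rw [Set.indicator_of_mem hx, Set.indicator_of_mem hx.1,
        Set.indicator_of_mem (show c.symm x ∈ U from hx.2)]
      simp
    · rw [Set.indicator_of_notMem hx]; exact zero_le
  rw [lintegral_eq_zero_iff' ((aemeasurable_density hX p).mono_measure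
    (Measure.restrict_mono Set.inter_subset_left le_rfl)), Filter.EventuallyEq,
    ae_restrict_iff' hO.measurableSet, ae_iff] at h2
  refine hOne (measure_mono_null
    (t := {a | ¬(a ∈ O → ENNReal.ofReal (areaDensity X p a) = 0)}) ?_ h2)
  intro x hx hcon
  have h3 := hcon hx
  rw [ENNReal.ofReal_eq_zero] at h3
  exact absurd (areaDensity_pos hX p hx.1) (not_lt.2 h3)

/-- Countably many chart domains cover M, and on each of them both measures have explicit densities.
All dependence on s can thereby be moved from the measure into the integrand. -/
lemma areaMeasure_eq_withDensity [SecondCountableTopology M] {Y : M → Euc (n + 1)}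
    (hX : IsSmoothImmersion X) (hY : IsSmoothImmersion Y) :
    areaMeasure Y = (areaMeasure X).withDensity fun p => ENNReal.ofReal (relDensity X Y p) := by
  obtain ⟨S, hS, hSU⟩ := TopologicalSpace.countable_cover_nhds
    (f := fun p : M => (chartAt (Euc n) p).source) fun p => chart_source_mem_nhds _ p
  refine (Measure.ext_iff_of_biUnion_eq_univ hS hSU).2 fun p _ => ?_
  have hms : MeasurableSet (chartAt (Euc n) p).source :=
    (chartAt (Euc n) p).open_source.measurableSet
  have hr : Measurable fun p => ENNReal.ofReal (relDensity X Y p) :=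
    (continuous_relDensity hX hY).measurable.ennreal_ofReal
  rw [restrict_withDensity hms, areaMeasure_restrict hX, areaMeasure_restrict hY]
  refine Measure.ext_of_lintegral _ fun f hf => ?_
  rw [lintegral_withDensity_eq_lintegral_mul _ hr hf, lintegral_chartArea hY p hf,
    lintegral_chartArea hX p (hr.mul hf)]
  refine setLIntegral_congr_fun (chartAt (Euc n) p).open_target.measurableSet fun x hx => ?_
  simp only [Pi.mul_apply]
  rw [relDensity_chart hX.smoothInCharts hY.smoothInCharts hx, ← mul_assoc,
    ← ENNReal.ofReal_mul (areaDensity_pos hX p hx).le, mul_div_cancel₀ _ (areaDensity_pos hX p hx).ne']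

lemma integral_areaMeasure_eq [SecondCountableTopology M] {Y : M → Euc (n + 1)}
    (hX : IsSmoothImmersion X) (hY : IsSmoothImmersion Y) (f : M → ℝ) :
    ∫ p, f p ∂(areaMeasure Y) = ∫ p, relDensity X Y p * f p ∂(areaMeasure X) := by
  rw [areaMeasure_eq_withDensity hX hY, integral_withDensity_eq_integral_toReal_smul
    (continuous_relDensity hX hY).measurable.ennreal_ofReal
    (Filter.Eventually.of_forall fun _ => ENNReal.ofReal_lt_top)]
  refine integral_congr_ae (Filter.Eventually.of_forall fun p => ?_)
  simp only [smul_eq_mul]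
  rw [ENNReal.toReal_ofReal (relDensity_pos hX hY p).le]

end Area

end LambdaHypersurface
end

noncomputable section

namespace LambdaHypersurface

/-! ### Coordinate calculus in Euclidean space. -/

section Euclidean

open MeasureTheory

variable {n : ℕ}

/-- Integration by parts against the constant function 1. -/
lemma integral_pd_eq_zero {u : Euc n → ℝ} (hu : ContDiff ℝ 1 u) (hc : HasCompactSupport u)
    (i : Fin n) : ∫ x, pd i u x = 0 := by
  have h1 : Continuous (fun x => fderiv ℝ u x (EuclideanSpace.single i 1)) :=
    (hu.continuous_fderiv (by simp)).clm_apply continuous_const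
  have h2 : HasCompactSupport (fun x => fderiv ℝ u x (EuclideanSpace.single i 1)) :=
    hc.fderiv_apply ℝ _
  have h := integral_mul_fderiv_eq_neg_fderiv_mul_of_integrable (μ := (volume : Measure (Euc n)))
    (f := fun _ => (1 : ℝ)) (g := u) (v := EuclideanSpace.single i 1)
    (by simp) (by simpa using h1.integrable_of_hasCompactSupport h2)
    (by simpa using hu.continuous.integrable_of_hasCompactSupport hc)
    (fun x _ => by fun_prop) (fun x _ => (hu.differentiable (by simp)) x)
  simpa [pd] using h

/-- Restricting to coordinate lines makes the one-parameter formulas for frames applicable to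
spatial derivatives. -/
lemma hasDerivAt_line {V : Type*} [NormedAddCommGroup V] [NormedSpace ℝ V] {u : Euc n → V}
    {x : Euc n} (hu : DifferentiableAt ℝ u x) (i : Fin n) :
    HasDerivAt (fun t : ℝ => u (x + t • EuclideanSpace.single i 1)) (pd i u x) 0 := by
  have h1 : HasDerivAt (fun t : ℝ => x + t • EuclideanSpace.single i (1 : ℝ))
      (EuclideanSpace.single i 1) 0 := by
    simpa using ((hasDerivAt_id (0 : ℝ)).smul_const (EuclideanSpace.single i (1 : ℝ))).const_add x
  have h2 : HasFDerivAt u (fderiv ℝ u x) (x + (0 : ℝ) • EuclideanSpace.single i (1 : ℝ)) := by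
    simpa using hu.hasFDerivAt
  exact h2.comp_hasDerivAt 0 h1

lemma pd_mul {u v : Euc n → ℝ} {x : Euc n} (hu : DifferentiableAt ℝ u x)
    (hv : DifferentiableAt ℝ v x) (i : Fin n) :
    pd i (fun x => u x * v x) x = pd i u x * v x + u x * pd i v x := by
  simp only [pd]
  rw [fderiv_fun_mul hu hv]
  simp; ring

variable {V : Type*} [NormedAddCommGroup V]

lemma pd_smul [NormedSpace ℝ V] {u : Euc n → ℝ} {v : Euc n → V} {x : Euc n}
    (hu : DifferentiableAt ℝ u x) (hv : DifferentiableAt ℝ v x) (i : Fin n) :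
    pd i (fun x => u x • v x) x = u x • pd i v x + pd i u x • v x := by
  simp only [pd]
  rw [fderiv_fun_smul hu hv]
  simp

lemma pd_sum [NormedSpace ℝ V] {ι : Type*} (s : Finset ι) {u : ι → Euc n → V} {x : Euc n}
    (hu : ∀ k ∈ s, DifferentiableAt ℝ (u k) x) (i : Fin n) :
    pd i (fun x => ∑ k ∈ s, u k x) x = ∑ k ∈ s, pd i (u k) x := by
  simp only [pd]
  rw [fderiv_fun_sum hu]
  simp

lemma pd_inner [InnerProductSpace ℝ V] {u v : Euc n → V} {x : Euc n}
    (hu : DifferentiableAt ℝ u x) (hv : DifferentiableAt ℝ v x) (i : Fin n) :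
    pd i (fun x => ⟪u x, v x⟫_ℝ) x = ⟪u x, pd i v x⟫_ℝ + ⟪pd i u x, v x⟫_ℝ := by
  simp only [pd]
  rw [fderiv_inner_apply ℝ hu hv]

lemma pd_congr [NormedSpace ℝ V] {u v : Euc n → V} {x : Euc n} (h : u =ᶠ[𝓝 x] v) (i : Fin n) :
    pd i u x = pd i v x := by
  simp only [pd, h.fderiv_eq]

lemma pd_comm [NormedSpace ℝ V] {u : Euc n → V} {U : Set (Euc n)} (hU : IsOpen U)
    (hu : ContDiffOn ℝ ∞ u U) {x : Euc n} (hx : x ∈ U) (i j : Fin n) :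
    pd i (pd j u) x = pd j (pd i u) x := by
  have hc := hu.contDiffAt (hU.mem_nhds hx)
  have hD : DifferentiableAt ℝ (fderiv ℝ u) x :=
    ((hu.fderiv_of_isOpen (m := ∞) hU (by simp)).contDiffAt (hU.mem_nhds hx)).differentiableAt
      (by simp)
  have h1 : ∀ i j, pd i (pd j u) x
      = fderiv ℝ (fderiv ℝ u) x (EuclideanSpace.single i 1) (EuclideanSpace.single j 1) := by
    intro i j
    have h := ((ContinuousLinearMap.apply ℝ V (EuclideanSpace.single j (1 : ℝ))).hasFDerivAt
      (x := fderiv ℝ u x)).comp x hD.hasFDerivAt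
    change fderiv ℝ ((ContinuousLinearMap.apply ℝ V (EuclideanSpace.single j (1 : ℝ))) ∘
      fderiv ℝ u) x _ = _
    rw [h.fderiv]; rfl
  rw [h1, h1]
  exact hc.isSymmSndFDerivAt
    (by rw [minSmoothness_of_isRCLikeNormedField]; exact WithTop.coe_le_coe.2 le_top) _ _

end Euclidean

/-! ### The divergence in coordinates. -/

section ChartDivergence

open Matrix

variable {n : ℕ} {M : Type*} [TopologicalSpace M] [ChartedSpace (Euc n) M] [IsManifold (𝓡 n) ∞ M]
  {X : M → Euc (n + 1)}

lemma frameDiv_sum {E : Type*} [NormedAddCommGroup E] [InnerProductSpace ℝ E] {ι : Type*}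
    (s : Finset ι) (e : Fin n → E) (d : ι → Fin n → E) :
    frameDiv e (fun i => ∑ k ∈ s, d k i) = ∑ k ∈ s, frameDiv e (d k) := by
  induction s using Finset.cons_induction with
  | empty => simp [frameDiv]
  | cons a s ha ih => simp only [Finset.sum_cons, frameDiv_add, ih]

lemma frameDiv_tangent {E : Type*} [NormedAddCommGroup E] [InnerProductSpace ℝ E]
    {e : Fin n → E} (he : LinearIndependent ℝ e) (D : Fin n → Fin n → ℝ) :
    frameDiv e (fun i => ∑ j, D i j • e j) = ∑ i, D i i := by
  have h : (gram ℝ e)⁻¹ * gram ℝ e = 1 := Matrix.nonsing_inv_mul _ (gram_det_pos he).ne'.isUnit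
  simp only [frameDiv, sum_inner, real_inner_smul_left]
  refine Finset.sum_congr rfl fun i _ => ?_
  simp only [Finset.mul_sum]
  rw [Finset.sum_comm]
  have h1 : ∀ j, ∑ k, (gram ℝ e)⁻¹ i k * (D i j * ⟪e j, e k⟫_ℝ)
      = D i j * (1 : Matrix (Fin n) (Fin n) ℝ) i j := by
    intro j
    rw [← h, Matrix.mul_apply, Finset.mul_sum]
    exact Finset.sum_congr rfl fun k _ => by rw [gram_apply, real_inner_comm]; ring
  simp only [h1, Matrix.one_apply]
  simp

/-- The first variation of √det g, applied to the frame moving along a coordinate line. -/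
lemma pd_areaDensity (hX : IsSmoothImmersion X) (p : M) {x : Euc n}
    (hx : x ∈ (chartAt (Euc n) p).target) (j : Fin n) :
    pd j (areaDensity X p) x
      = areaDensity X p x * frameDiv (coordFrame X p x) (fun i => pd j (pd i (rep X p)) x) := by
  have ht := (chartAt (Euc n) p).open_target
  have h1 := hasDerivAt_line (((contDiffOn_areaDensity hX p).contDiffAt
    (ht.mem_nhds hx)).differentiableAt (by simp)) j
  have h2 : ∀ i, HasDerivAt (fun t : ℝ => coordFrame X p (x + t • EuclideanSpace.single j 1) i)
      (pd j (pd i (rep X p)) x) 0 := fun i =>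
    hasDerivAt_line (((hX.smoothInCharts.contDiffOn_pd p i).contDiffAt
      (ht.mem_nhds hx)).differentiableAt (by simp)) j
  have h3 := hasDerivAt_sqrt_det_gram
    (e := fun t : ℝ => coordFrame X p (x + t • EuclideanSpace.single j 1)) (s := 0)
    (by simpa using hX.linearIndependent p hx) h2
  simp only [zero_smul, add_zero] at h3
  exact h1.unique h3

/-- The coordinate expression `div V = ρ⁻¹ ∂ⱼ(ρ aʲ)` of the divergence of `V = aʲ ∂ⱼX`. -/
lemma sum_pd_areaDensity_mul (hX : IsSmoothImmersion X) {V : M → Euc (n + 1)} (p : M)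
    {a : Fin n → Euc n → ℝ}
    (ha : ∀ j, ContDiffOn ℝ ∞ (a j) (chartAt (Euc n) p).target)
    (hV : ∀ x ∈ (chartAt (Euc n) p).target, rep V p x = ∑ j, a j x • coordFrame X p x j)
    {x : Euc n} (hx : x ∈ (chartAt (Euc n) p).target) :
    ∑ j, pd j (fun x => areaDensity X p x * a j x) x
      = areaDensity X p x * frameDiv (coordFrame X p x) (coordFrame V p x) := by
  have ht := (chartAt (Euc n) p).open_target
  have hda : ∀ j, DifferentiableAt ℝ (a j) x := fun j =>
    ((ha j).contDiffAt (ht.mem_nhds hx)).differentiableAt (by simp)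
  have hde : ∀ j, DifferentiableAt ℝ (pd j (rep X p)) x := fun j =>
    ((hX.smoothInCharts.contDiffOn_pd p j).contDiffAt (ht.mem_nhds hx)).differentiableAt (by simp)
  have hdr : DifferentiableAt ℝ (areaDensity X p) x :=
    ((contDiffOn_areaDensity hX p).contDiffAt (ht.mem_nhds hx)).differentiableAt (by simp)
  have h1 : coordFrame V p x = fun i =>
      (∑ j, pd i (a j) x • coordFrame X p x j) + ∑ j, a j x • pd j (pd i (rep X p)) x := by
    funext i
    have hev : rep V p =ᶠ[𝓝 x] fun x => ∑ j, a j x • pd j (rep X p) x := by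
      filter_upwards [ht.mem_nhds hx] with z hz using hV z hz
    rw [coordFrame, pd_congr hev, pd_sum (u := fun j x => a j x • pd j (rep X p) x) _
      fun j _ => (hda j).fun_smul (hde j)]
    simp only [pd_smul (hda _) (hde _)]
    rw [← Finset.sum_add_distrib]
    refine Finset.sum_congr rfl fun j _ => ?_
    -- Exchanging ∂ᵢ and ∂ⱼ turns aʲ ∂ᵢ∂ⱼX into aʲ times the derivative of the frame in the j-th
    -- direction, whose divergence is ∂ⱼ log ρ.
    rw [pd_comm ht (hX.smoothInCharts p) hx i j]
    exact add_comm (a j x • pd j (pd i (rep X p)) x) _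
  rw [h1, frameDiv_add, frameDiv_tangent (hX.linearIndependent p hx), frameDiv_sum, mul_add,
    Finset.mul_sum, Finset.mul_sum, ← Finset.sum_add_distrib]
  refine Finset.sum_congr rfl fun j _ => ?_
  rw [pd_mul hdr (hda j), pd_areaDensity hX p hx, frameDiv_smul]
  ring

/-- The gradient has components g^ij ∂ⱼf, so the defining formula is its coordinate divergence. The
Laplacian is handled only in this invariant form afterwards. -/
lemma laplacian_eq_surfaceDiv (hX : IsSmoothImmersion X) {f : M → ℝ}
    (hf : SmoothInCharts (n := n) f) (p : M) : laplacian X f p = surfaceDiv X (grad X f) p := by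
  have hx := mem_chart_target (Euc n) p
  have h := sum_pd_areaDensity_mul hX (V := grad X f) p
    (a := fun i x => ∑ j, (metric X p x)⁻¹ i j * pd j (rep f p) x)
    (fun i => ContDiffOn.sum fun j _ => (contDiffOn_gram_inv
      (fun i => hX.smoothInCharts.contDiffOn_pd p i)
      (fun x hx => hX.linearIndependent p hx) i j).mul (hf.contDiffOn_pd p j))
    (fun x hx => by
      rw [rep, grad_chart hX.smoothInCharts hf hx, frameGrad_eq]; rfl) hx
  rw [laplacian, h, ← mul_assoc, inv_mul_cancel₀ (areaDensity_pos hX p hx).ne', one_mul]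
  rfl

end ChartDivergence

/-! ### Calculus of fields along the hypersurface. -/

section Fields

variable {n : ℕ} {M : Type*} [TopologicalSpace M] [ChartedSpace (Euc n) M] [IsManifold (𝓡 n) ∞ M]
  {X N : M → Euc (n + 1)} {V : Type*} [NormedAddCommGroup V] [NormedSpace ℝ V]

lemma rep_eventuallyEq_of_eventuallyEq {u v : M → V} {p : M} {x : Euc n}
    (hx : x ∈ (chartAt (Euc n) p).target)
    (h : u =ᶠ[𝓝 ((chartAt (Euc n) p).symm x)] v) : rep u p =ᶠ[𝓝 x] rep v p :=
  ((chartAt (Euc n) p).continuousAt_symm hx).eventually h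

lemma coordFrame_congr {u v : M → V} {p : M} {x : Euc n} (hx : x ∈ (chartAt (Euc n) p).target)
    (h : u =ᶠ[𝓝 ((chartAt (Euc n) p).symm x)] v) : coordFrame u p x = coordFrame v p x :=
  funext fun i => pd_congr (rep_eventuallyEq_of_eventuallyEq hx h) i

lemma coordFrame_self_congr {u v : M → V} {p : M} (h : u =ᶠ[𝓝 p] v) :
    coordFrame u p (chartAt (Euc n) p p) = coordFrame v p (chartAt (Euc n) p p) := by
  refine coordFrame_congr (mem_chart_target _ p) ?_
  rwa [(chartAt (Euc n) p).left_inv (mem_chart_source _ p)]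

lemma SmoothInCharts.mul {f g : M → ℝ} (hf : SmoothInCharts (n := n) f)
    (hg : SmoothInCharts (n := n) g) : SmoothInCharts (n := n) (fun p => f p * g p) :=
  fun p => (hf p).mul (hg p)

lemma SmoothInCharts.smul {f : M → ℝ} {v : M → V} (hf : SmoothInCharts (n := n) f)
    (hv : SmoothInCharts (n := n) v) : SmoothInCharts (n := n) (fun p => f p • v p) :=
  fun p => (hf p).smul (hv p)

lemma SmoothInCharts.sub {u v : M → V} (hu : SmoothInCharts (n := n) u)
    (hv : SmoothInCharts (n := n) v) : SmoothInCharts (n := n) (fun p => u p - v p) :=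
  fun p => (hu p).sub (hv p)

lemma SmoothInCharts.inner {E : Type*} [NormedAddCommGroup E] [InnerProductSpace ℝ E]
    {u v : M → E} (hu : SmoothInCharts (n := n) u)
    (hv : SmoothInCharts (n := n) v) : SmoothInCharts (n := n) (fun p => ⟪u p, v p⟫_ℝ) :=
  fun p => (hu p).inner ℝ (hv p)

lemma SmoothInCharts.gaussWeight (hX : SmoothInCharts (n := n) X) :
    SmoothInCharts (n := n) (gaussWeight X) :=
  fun p => (((hX p).norm_sq ℝ).neg.div_const 2).exp

lemma SmoothInCharts.differentiableAt_self {u : M → V} (hu : SmoothInCharts (n := n) u) (p : M) :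
    DifferentiableAt ℝ (rep u p) (chartAt (Euc n) p p) :=
  hu.differentiableAt_rep p (mem_chart_target _ p)

lemma rep_self (u : M → V) (p : M) : rep (n := n) u p (chartAt (Euc n) p p) = u p := by
  rw [rep, (chartAt (Euc n) p).left_inv (mem_chart_source _ p)]

lemma IsUnitNormal.smoothInCharts (hN : IsUnitNormal X N) : SmoothInCharts (n := n) N :=
  SmoothInCharts.of_contMDiff hN.1

lemma IsUnitNormal.inner_coordFrame_self (hX : IsSmoothImmersion X) (hN : IsUnitNormal X N)
    (p : M) (i : Fin n) : ⟪coordFrame X p (chartAt (Euc n) p p) i, N p⟫_ℝ = 0 := by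
  have hm : MDifferentiableAt (𝓡 n) 𝓘(ℝ, Euc (n + 1)) X p := hX.1.mdifferentiableAt (by simp)
  have h := (hN.2 p).2 (EuclideanSpace.single i (1 : ℝ) : Euc n)
  rw [mfderiv_single hm] at h
  exact h

lemma IsUnitNormal.inner_coordFrame (hX : IsSmoothImmersion X) (hN : IsUnitNormal X N)
    (p : M) {x : Euc n} (hx : x ∈ (chartAt (Euc n) p).target) (i : Fin n) :
    ⟪coordFrame X p x i, rep N p x⟫_ℝ = 0 := by
  set q := (chartAt (Euc n) p).symm x with hqd
  have hq : q ∈ (chartAt (Euc n) p).source := (chartAt (Euc n) p).map_target hx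
  have hxq : chartAt (Euc n) p q = x := (chartAt (Euc n) p).right_inv hx
  have ho := mem_overlap_self hq
  rw [← hxq, coordFrame_transition hX.smoothInCharts ho, transition_self hq, hxq, rep, ← hqd,
    sum_inner]
  refine Finset.sum_eq_zero fun k _ => ?_
  rw [real_inner_smul_left, hN.inner_coordFrame_self hX, mul_zero]

lemma inner_grad_normal (hX : IsSmoothImmersion X) (hN : IsUnitNormal X N) (f : M → ℝ) (p : M) :
    ⟪grad X f p, N p⟫_ℝ = 0 := by
  rw [grad_eq]
  exact inner_frameGrad_normal (hN.inner_coordFrame_self hX p) _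

/-- Derivative of the identity |N|² = 1. -/
lemma inner_coordFrame_normal (hN : IsUnitNormal X N) (p : M) (i : Fin n) :
    ⟪coordFrame N p (chartAt (Euc n) p p) i, N p⟫_ℝ = 0 := by
  have h1 := pd_inner (hN.smoothInCharts.differentiableAt_self p)
    (hN.smoothInCharts.differentiableAt_self p) i
  have h2 : (fun x => ⟪rep (n := n) N p x, rep N p x⟫_ℝ) = fun _ => (1 : ℝ) := by
    funext x
    rw [real_inner_self_eq_norm_sq, rep, (hN.2 _).1, one_pow]
  rw [h2, rep_self, real_inner_comm] at h1
  simp only [pd, fderiv_fun_const, Pi.zero_apply, zero_apply] at h1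
  simp only [coordFrame, pd]
  linarith

/-- The Weingarten equation, from differentiating ⟨∂ⱼX, N⟩ = 0 in a neighbourhood within the chart.
-/
lemma inner_coordFrame_eq_neg_secondForm (hX : IsSmoothImmersion X) (hN : IsUnitNormal X N)
    (p : M) (i j : Fin n) :
    ⟪coordFrame N p (chartAt (Euc n) p p) i, coordFrame X p (chartAt (Euc n) p p) j⟫_ℝ
      = -secondForm X N p i j := by
  have hx := mem_chart_target (Euc n) p
  have ht := (chartAt (Euc n) p).open_target
  have h1 := pd_inner (u := pd j (rep X p)) (((hX.smoothInCharts.contDiffOn_pd p j).contDiffAt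
    (ht.mem_nhds hx)).differentiableAt (by simp)) (hN.smoothInCharts.differentiableAt_self p) i
  have h2 : (fun x => ⟪pd j (rep X p) x, rep N p x⟫_ℝ) =ᶠ[𝓝 (chartAt (Euc n) p p)]
      fun _ => (0 : ℝ) := by
    filter_upwards [ht.mem_nhds hx] with z hz using hN.inner_coordFrame hX p hz j
  rw [pd_congr h2, rep_self] at h1
  simp only [pd, fderiv_fun_const, Pi.zero_apply, zero_apply] at h1
  simp only [secondForm, Matrix.of_apply, coordFrame, pd]
  rw [real_inner_comm]
  linarith

lemma secondForm_comm (hX : IsSmoothImmersion X) (N : M → Euc (n + 1)) (p : M) (i j : Fin n) :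
    secondForm X N p i j = secondForm X N p j i := by
  simp only [secondForm, Matrix.of_apply]
  rw [pd_comm (chartAt (Euc n) p).open_target (hX.smoothInCharts p) (mem_chart_target _ p)]

/-- The trace of the Weingarten equation. It also exhibits H as a chart-independent expression, from
which its continuity is read off. -/
lemma surfaceDiv_normal (hX : IsSmoothImmersion X) (hN : IsUnitNormal X N) (p : M) :
    surfaceDiv X N p = -meanCurvature X N p := by
  simp only [surfaceDiv, frameDiv, inner_coordFrame_eq_neg_secondForm hX hN, meanCurvature,
    Matrix.trace, Matrix.diag_apply, Matrix.mul_apply, mul_neg, Finset.sum_neg_distrib]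
  congr 1
  refine Finset.sum_congr rfl fun i _ => Finset.sum_congr rfl fun j _ => ?_
  rw [secondForm_comm hX N p i j]; rfl

lemma coordFrame_smul {f : M → ℝ} {v : M → V} (hf : SmoothInCharts (n := n) f)
    (hv : SmoothInCharts (n := n) v) (p : M) :
    coordFrame (fun p => f p • v p) p (chartAt (Euc n) p p)
      = fun i => f p • coordFrame v p (chartAt (Euc n) p p) i
        + coordFrame f p (chartAt (Euc n) p p) i • v p := by
  funext i
  have h := pd_smul (hf.differentiableAt_self p) (hv.differentiableAt_self p) i
  rw [rep_self, rep_self] at h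
  exact h

lemma surfaceDiv_smul {f : M → ℝ} {v : M → Euc (n + 1)}
    (hf : SmoothInCharts (n := n) f) (hv : SmoothInCharts (n := n) v) (p : M) :
    surfaceDiv X (fun p => f p • v p) p = f p * surfaceDiv X v p + ⟪grad X f p, v p⟫_ℝ := by
  rw [surfaceDiv, coordFrame_smul hf hv, frameDiv_add, frameDiv_smul, frameDiv_smul_vec]
  rfl

lemma surfaceDiv_sub {u v : M → Euc (n + 1)}
    (hu : SmoothInCharts (n := n) u) (hv : SmoothInCharts (n := n) v) (p : M) :
    surfaceDiv X (fun p => u p - v p) p = surfaceDiv X u p - surfaceDiv X v p := by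
  have h : coordFrame (fun p => u p - v p) p (chartAt (Euc n) p p)
      = fun i => coordFrame u p (chartAt (Euc n) p p) i
        + (-1 : ℝ) • coordFrame v p (chartAt (Euc n) p p) i := by
    funext i
    have hr : rep (n := n) (fun p => u p - v p) p = fun x => rep u p x - rep v p x := rfl
    simp only [coordFrame, pd]
    rw [hr, fderiv_fun_sub (hu.differentiableAt_self p) (hv.differentiableAt_self p)]
    simp [sub_eq_add_neg]
  rw [surfaceDiv, h, frameDiv_add, frameDiv_smul, surfaceDiv, surfaceDiv]
  ring

lemma surfaceDiv_sum {ι : Type*} (s : Finset ι) {v : ι → M → Euc (n + 1)}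
    (hv : ∀ k ∈ s, SmoothInCharts (n := n) (v k)) (p : M) :
    surfaceDiv X (fun p => ∑ k ∈ s, v k p) p = ∑ k ∈ s, surfaceDiv X (v k) p := by
  have h : coordFrame (fun p => ∑ k ∈ s, v k p) p (chartAt (Euc n) p p)
      = fun i => ∑ k ∈ s, coordFrame (v k) p (chartAt (Euc n) p p) i :=
    funext fun i => pd_sum s (fun k hk => (hv k hk).differentiableAt_self p) i
  rw [surfaceDiv, h, frameDiv_sum]
  rfl

lemma grad_mul {f g : M → ℝ} (hf : SmoothInCharts (n := n) f) (hg : SmoothInCharts (n := n) g)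
    (p : M) : grad X (fun p => f p * g p) p = f p • grad X g p + g p • grad X f p := by
  have h := coordFrame_smul hf hg p
  simp only [smul_eq_mul] at h
  rw [grad_eq, h, grad_eq, grad_eq, frameGrad, frameGrad, frameGrad]
  simp only [Finset.smul_sum, ← Finset.sum_add_distrib, smul_smul, ← add_smul]
  exact Finset.sum_congr rfl fun i _ => Finset.sum_congr rfl fun j _ => by congr 1; ring

lemma coordFrame_gaussWeight (hX : SmoothInCharts (n := n) X) (p : M) :
    coordFrame (gaussWeight X) p (chartAt (Euc n) p p)
      = fun i => -gaussWeight X p * ⟪X p, coordFrame X p (chartAt (Euc n) p p) i⟫_ℝ := by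
  funext i
  have hd := hX.differentiableAt_self p
  have h1 : HasFDerivAt (fun x => -‖rep X p x‖ ^ 2 / 2) _ (chartAt (Euc n) p p) :=
    (hd.hasFDerivAt.norm_sq.neg).mul_const (2 : ℝ)⁻¹
  have h2 := h1.exp
  have h3 : rep (n := n) (gaussWeight X) p = fun x => Real.exp (-‖rep X p x‖ ^ 2 / 2) := rfl
  rw [coordFrame, pd, h3, h2.fderiv, rep_self]
  simp [gaussWeight, coordFrame, pd]

/-- The gradient of the weight is -w times the tangential part of X; the subtracted product removes
the normal part. -/
lemma inner_grad_gaussWeight (hX : IsSmoothImmersion X) (hN : IsUnitNormal X N) (p : M)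
    (v : Euc (n + 1)) :
    ⟪grad X (gaussWeight X) p, v⟫_ℝ
      = -gaussWeight X p * (⟪X p, v⟫_ℝ - ⟪X p, N p⟫_ℝ * ⟪v, N p⟫_ℝ) := by
  rw [grad_eq, coordFrame_gaussWeight hX.smoothInCharts, inner_frameGrad_left]
  rw [inner_of_orthogonal_normal (hX.linearIndependent_self p) (hN.2 p).1
    (hN.inner_coordFrame_self hX p) (X p) v, add_sub_cancel_right, Finset.mul_sum]
  refine Finset.sum_congr rfl fun i _ => ?_
  rw [Finset.mul_sum]
  exact Finset.sum_congr rfl fun j _ => by rw [real_inner_comm v]; ring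

lemma surfaceDiv_eq_zero_of_notMem_tsupport {v : M → Euc (n + 1)} {p : M} (hp : p ∉ tsupport v) :
    surfaceDiv X v p = 0 := by
  rw [surfaceDiv, coordFrame_self_congr (notMem_tsupport_iff_eventuallyEq.1 hp)]
  have : rep (n := n) (0 : M → Euc (n + 1)) p = fun _ => 0 := rfl
  simp [frameDiv, coordFrame, pd, this]

end Fields

end LambdaHypersurface
end

noncomputable section

namespace LambdaHypersurface

/-! ### The divergence theorem and its two weighted consequences. -/

section DivergenceTheorem

open MeasureTheory

variable {n : ℕ} {M : Type*} [TopologicalSpace M] [T2Space M] [SecondCountableTopology M]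
  [ChartedSpace (Euc n) M] [IsManifold (𝓡 n) ∞ M] [MeasurableSpace M] [BorelSpace M]
  {X N : M → Euc (n + 1)}

lemma integrable_of_compactSupport (hX : IsSmoothImmersion X) {f : M → ℝ} (hf : Continuous f)
    (hc : HasCompactSupport f) : Integrable f (areaMeasure X) := by
  have := isLocallyFiniteMeasure_areaMeasure hX
  exact hf.integrable_of_hasCompactSupport hc

lemma hasCompactSupport_surfaceDiv {V : M → Euc (n + 1)} (hc : HasCompactSupport V) :
    HasCompactSupport (surfaceDiv X V) :=
  HasCompactSupport.intro hc fun _ hp => surfaceDiv_eq_zero_of_notMem_tsupport hp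

/-- In a single chart ρ div V is the Euclidean divergence of the compactly supported field ρ aʲ,
whose integral vanishes. -/
lemma integral_surfaceDiv_of_subset_source (hX : IsSmoothImmersion X) (hN : IsUnitNormal X N)
    {V : M → Euc (n + 1)} (hV : SmoothInCharts (n := n) V) (hc : HasCompactSupport V)
    (htan : ∀ q, ⟪V q, N q⟫_ℝ = 0) {p : M} (hp : tsupport V ⊆ (chartAt (Euc n) p).source) :
    ∫ q, surfaceDiv X V q ∂(areaMeasure X) = 0 := by
  set c := chartAt (Euc n) p with hcd
  have ht : IsOpen c.target := c.open_target
  set a : Fin n → Euc n → ℝ := fun j x =>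
    ∑ i, (Matrix.gram ℝ (coordFrame X p x))⁻¹ j i * ⟪rep V p x, coordFrame X p x i⟫_ℝ with ha
  have hasm : ∀ j, ContDiffOn ℝ ∞ (a j) c.target := fun j => ContDiffOn.sum fun i _ =>
    (contDiffOn_gram_inv (fun i => hX.smoothInCharts.contDiffOn_pd p i)
      (fun x hx => hX.linearIndependent p hx) j i).mul
      ((hV p).inner ℝ (hX.smoothInCharts.contDiffOn_pd p i))
  -- Only here is tangency used: without a normal component V is a combination of the frame vectors.
  have hVa : ∀ x ∈ c.target, rep V p x = ∑ j, a j x • coordFrame X p x j := by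
    intro x hx
    have h1 := frame_decomposition (hX.linearIndependent p hx) (hN.2 (c.symm x)).1
      (fun i => hN.inner_coordFrame hX p hx i) (rep V p x)
    have h2 : ⟪rep V p x, N (c.symm x)⟫_ℝ = 0 := htan _
    rw [h2, zero_smul, add_zero, frameGrad_eq] at h1
    exact h1
  set L : Set (Euc n) := c '' tsupport V with hL
  have hLc : IsCompact L := hc.isCompact.image_of_continuousOn (c.continuousOn.mono hp)
  have hLt : L ⊆ c.target := by rintro _ ⟨q, hq, rfl⟩; exact c.mapsTo (hp hq)
  have ha0 : ∀ j, ∀ x ∈ c.target, x ∉ L → a j x = 0 := by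
    intro j x hx hxL
    have h1 : rep V p x = 0 := by
      by_contra hne
      refine hxL ⟨c.symm x, subset_tsupport V hne, c.right_inv hx⟩
    simp [ha, h1]
  -- Extension by zero to all of ℝⁿ. It is C¹ because the field vanishes off the compact set L,
  -- which lies inside the open image of the chart.
  set b : Fin n → Euc n → ℝ := fun j => c.target.indicator fun x => areaDensity X p x * a j x
  have hb0 : ∀ j, ∀ x ∉ L, b j x = 0 := by
    intro j x hxL
    by_cases hx : x ∈ c.target
    · simp only [b]
      rw [Set.indicator_of_mem hx, ha0 j x hx hxL, mul_zero]
    · exact Set.indicator_of_notMem hx _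
  have hbe : ∀ j, ∀ x ∈ c.target, b j =ᶠ[𝓝 x] fun x => areaDensity X p x * a j x := by
    intro j x hx
    filter_upwards [ht.mem_nhds hx] with z hz
    exact Set.indicator_of_mem hz _
  have hb0e : ∀ j, ∀ x ∉ L, b j =ᶠ[𝓝 x] fun _ => 0 := by
    intro j x hx
    filter_upwards [hLc.isClosed.isOpen_compl.mem_nhds hx] with z hz
    exact hb0 j z hz
  have hbs : ∀ j, ContDiff ℝ 1 (b j) := by
    intro j
    rw [contDiff_iff_contDiffAt]
    intro x
    by_cases hx : x ∈ c.target
    · have h1 : ContDiffAt ℝ ∞ (fun x => areaDensity X p x * a j x) x :=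
        ((contDiffOn_areaDensity hX p).mul (hasm j)).contDiffAt (ht.mem_nhds hx)
      exact (h1.of_le (by exact_mod_cast le_top)).congr_of_eventuallyEq (hbe j x hx)
    · exact contDiffAt_const.congr_of_eventuallyEq (hb0e j x fun h => hx (hLt h))
  have hbc : ∀ j, HasCompactSupport (b j) := fun j => HasCompactSupport.intro hLc (hb0 j)
  have hpdi : ∀ j, Integrable (pd j (b j)) volume := fun j =>
    (((hbs j).continuous_fderiv (by simp)).clm_apply
      continuous_const).integrable_of_hasCompactSupport ((hbc j).fderiv_apply ℝ _)
  have h1 : ∫ q, surfaceDiv X V q ∂(areaMeasure X)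
      = ∫ q in c.source, surfaceDiv X V q ∂(areaMeasure X) :=
    (setIntegral_eq_integral_of_forall_compl_eq_zero fun q hq =>
      surfaceDiv_eq_zero_of_notMem_tsupport fun h => hq (hp h)).symm
  rw [h1, areaMeasure_restrict hX p, integral_chartArea hX p (hV.surfaceDiv hX).continuous]
  have h2 : ∫ x in c.target, areaDensity X p x * rep (surfaceDiv X V) p x
      = ∫ x in c.target, ∑ j, pd j (b j) x := by
    refine setIntegral_congr_fun ht.measurableSet fun x hx => ?_
    simp only [rep]
    rw [surfaceDiv_chart hX.smoothInCharts hV hx, ← sum_pd_areaDensity_mul hX p hasm hVa hx]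
    exact Finset.sum_congr rfl fun j _ => (pd_congr (hbe j x hx) j).symm
  rw [h2, setIntegral_eq_integral_of_forall_compl_eq_zero]
  · rw [integral_finsetSum _ fun j _ => hpdi j]
    exact Finset.sum_eq_zero fun j _ => integral_pd_eq_zero (hbs j) (hbc j) j
  · intro x hx
    refine Finset.sum_eq_zero fun j _ => ?_
    rw [pd_congr (hb0e j x fun h => hx (hLt h))]
    simp [pd]

/-- The divergence theorem for compactly supported tangential fields. -/
theorem integral_surfaceDiv (hX : IsSmoothImmersion X) (hN : IsUnitNormal X N)
    {V : M → Euc (n + 1)} (hV : SmoothInCharts (n := n) V) (hc : HasCompactSupport V)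
    (htan : ∀ q, ⟪V q, N q⟫_ℝ = 0) : ∫ q, surfaceDiv X V q ∂(areaMeasure X) = 0 := by
  have := ChartedSpace.locallyCompactSpace (Euc n) M
  obtain ⟨t, -, ht⟩ := hc.isCompact.elim_nhds_subcover
    (fun p : M => (chartAt (Euc n) p).source) fun p _ => chart_source_mem_nhds _ p
  have hcov : tsupport V ⊆ ⋃ i : t, (chartAt (Euc n) (i : M)).source := by
    intro q hq
    obtain ⟨i, hi, hqi⟩ := Set.mem_iUnion₂.1 (ht hq)
    exact Set.mem_iUnion.2 ⟨⟨i, hi⟩, hqi⟩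
  -- The functions sum to 1 only on the support of V, which suffices because V vanishes elsewhere.
  obtain ⟨ρ, hρ⟩ := SmoothPartitionOfUnity.exists_isSubordinate (𝓡 n)
    (isClosed_tsupport V) (fun i : t => (chartAt (Euc n) (i : M)).source)
    (fun i => (chartAt (Euc n) (i : M)).open_source) hcov
  set W : t → M → Euc (n + 1) := fun i q => ρ i q • V q with hW
  have hWs : ∀ i, SmoothInCharts (n := n) (W i) := fun i =>
    (SmoothInCharts.of_contMDiff (ρ i).contMDiff).smul hV
  have hWc : ∀ i, HasCompactSupport (W i) := fun i => HasCompactSupport.intro hc fun q hq => by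
    simp only [hW]
    rw [image_eq_zero_of_notMem_tsupport hq, smul_zero]
  have hsum : (fun q => ∑ i, W i q) = V := by
    funext q
    by_cases hq : q ∈ tsupport V
    · have h1 := ρ.sum_eq_one hq
      rw [finsum_eq_sum_of_fintype] at h1
      simp only [hW]
      rw [← Finset.sum_smul, h1, one_smul]
    · have h1 : V q = 0 := image_eq_zero_of_notMem_tsupport hq
      simp [hW, h1]
  have h1 : ∀ q, surfaceDiv X V q = ∑ i, surfaceDiv X (W i) q := by
    intro q
    conv_lhs => rw [← hsum]
    exact surfaceDiv_sum _ (fun i _ => hWs i) q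
  have h2 : ∀ i, ∫ q, surfaceDiv X (W i) q ∂(areaMeasure X) = 0 := by
    intro i
    refine integral_surfaceDiv_of_subset_source hX hN (hWs i) (hWc i) (fun q => ?_) (p := i) ?_
    · simp only [hW]
      rw [real_inner_smul_left, htan, mul_zero]
    · exact (closure_mono (Function.support_smul_subset_left _ _)).trans (hρ i)
  simp only [h1]
  rw [integral_finsetSum _ fun i _ => integrable_of_compactSupport hX
    ((hWs i).surfaceDiv hX).continuous (hasCompactSupport_surfaceDiv (hWc i))]
  exact Finset.sum_eq_zero fun i _ => h2 i

/-- Green's formula for the weighted Laplacian. -/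
lemma integral_grad_sq_add_driftLaplacian (hX : IsSmoothImmersion X) (hN : IsUnitNormal X N)
    {f : M → ℝ} (hf : SmoothInCharts (n := n) f) (hc : HasCompactSupport f) :
    ∫ p, (⟪grad X f p, grad X f p⟫_ℝ + f p * driftLaplacian X f p) * gaussWeight X p
      ∂(areaMeasure X) = 0 := by
  have hg := hf.grad hX
  have hw := hX.smoothInCharts.gaussWeight
  -- The field f w ∇f is tangential with divergence w(|∇f|² + fΔf - f⟨X, ∇f⟩).
  have hs : HasCompactSupport fun p => (f p * gaussWeight X p) • grad X f p :=
    hc.mul_right.smul_right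
  have h : ∫ q, surfaceDiv X (fun p => (f p * gaussWeight X p) • grad X f p) q
      ∂(areaMeasure X) = 0 := by
    refine integral_surfaceDiv hX hN ((hf.mul hw).smul hg) hs fun q => ?_
    rw [real_inner_smul_left, inner_grad_normal hX hN, mul_zero]
  rw [← h]
  refine integral_congr_ae (Filter.Eventually.of_forall fun p => ?_)
  beta_reduce
  rw [surfaceDiv_smul (hf.mul hw) hg, grad_mul hf hw, inner_add_left, real_inner_smul_left,
    real_inner_smul_left, inner_grad_gaussWeight hX hN, inner_grad_normal hX hN,
    driftLaplacian, laplacian_eq_surfaceDiv hX hf]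
  ring

/-- The first variation of the weighted area for an arbitrary compactly supported field. -/
lemma integral_first_variation (hX : IsSmoothImmersion X) (hN : IsUnitNormal X N)
    {W : M → Euc (n + 1)} (hW : SmoothInCharts (n := n) W) (hc : HasCompactSupport W) :
    ∫ p, (surfaceDiv X W p - ⟪X p, W p⟫_ℝ
      + ⟪W p, N p⟫_ℝ * (meanCurvature X N p + ⟪X p, N p⟫_ℝ)) * gaussWeight X p
      ∂(areaMeasure X) = 0 := by
  have hn := hN.smoothInCharts
  have hw := hX.smoothInCharts.gaussWeight
  -- The divergence theorem applies to w times the tangential part of W; the removed normal part has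
  -- divergence -⟨W, N⟩H.
  have hT : SmoothInCharts (n := n) (fun p => W p - ⟪W p, N p⟫_ℝ • N p) :=
    hW.sub ((hW.inner hn).smul hn)
  have hTc : HasCompactSupport (fun p => W p - ⟪W p, N p⟫_ℝ • N p) :=
    HasCompactSupport.intro hc fun p hp => by
      simp [image_eq_zero_of_notMem_tsupport hp]
  have hs : HasCompactSupport fun p => gaussWeight X p • (W p - ⟪W p, N p⟫_ℝ • N p) :=
    HasCompactSupport.intro hTc fun p hp => by
      beta_reduce
      rw [image_eq_zero_of_notMem_tsupport (f := fun p => W p - ⟪W p, N p⟫_ℝ • N p) hp, smul_zero]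
  have h : ∫ q, surfaceDiv X (fun p => gaussWeight X p • (W p - ⟪W p, N p⟫_ℝ • N p)) q
      ∂(areaMeasure X) = 0 := by
    refine integral_surfaceDiv hX hN (hw.smul hT) hs fun q => ?_
    rw [real_inner_smul_left, inner_sub_left, real_inner_smul_left, real_inner_self_eq_norm_sq,
      (hN.2 q).1]
    ring
  rw [← h]
  refine integral_congr_ae (Filter.Eventually.of_forall fun p => ?_)
  beta_reduce
  rw [surfaceDiv_smul hw hT, surfaceDiv_sub hW ((hW.inner hn).smul hn),
    surfaceDiv_smul (hW.inner hn) hn, inner_grad_normal hX hN, surfaceDiv_normal hX hN,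
    inner_grad_gaussWeight hX hN, inner_sub_right, inner_sub_left, real_inner_smul_right,
    real_inner_smul_left, real_inner_self_eq_norm_sq, (hN.2 p).1]
  ring

end DivergenceTheorem

end LambdaHypersurface
end

noncomputable section

namespace LambdaHypersurface

/-! ### Variation of the area element. -/

section Variation

variable {n : ℕ} {M : Type*} [TopologicalSpace M] [ChartedSpace (Euc n) M] [IsManifold (𝓡 n) ∞ M]
  {V : Type*} [NormedAddCommGroup V] [NormedSpace ℝ V] {X N : M → Euc (n + 1)}

/-- The derivative of a family of maps with respect to the parameter. -/
def velocity (Φ : ℝ → M → V) (s : ℝ) (p : M) : V := deriv (fun s => Φ s p) s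

lemma SmoothFamily.velocity {I : Set ℝ} (hI : IsOpen I) {Φ : ℝ → M → V}
    (hΦ : SmoothFamily (n := n) I Φ) : SmoothFamily (n := n) I (velocity Φ) := hΦ.deriv hI

lemma SmoothFamily.hasDerivAt {I : Set ℝ} (hI : IsOpen I) {Φ : ℝ → M → V}
    (hΦ : SmoothFamily (n := n) I Φ) {s : ℝ} (hs : s ∈ I) (p : M) :
    HasDerivAt (fun s => Φ s p) (LambdaHypersurface.velocity Φ s p) s :=
  (hΦ.differentiableAt hI hs p).hasDerivAt

variable {I : Set ℝ} {Xv : ℝ → M → Euc (n + 1)}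

lemma hasDerivAt_coordFrame (hI : IsOpen I) (hXv : SmoothFamily (n := n) I Xv) {s : ℝ}
    (hs : s ∈ I) (p : M) (i : Fin n) :
    HasDerivAt (fun s => coordFrame (Xv s) p (chartAt (Euc n) p p) i)
      (coordFrame (velocity Xv s) p (chartAt (Euc n) p p) i) s :=
  hXv.hasDerivAt_pd hI hs p (mem_chart_target _ p) i

/-- Parameter and coordinate derivatives commute, so the frame of X(s) has as derivative the frame
of the velocity; the denominator does not move. -/
lemma hasDerivAt_relDensity (hI : IsOpen I) (hXv : SmoothFamily (n := n) I Xv)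
    (him : ∀ s ∈ I, IsSmoothImmersion (Xv s)) {s : ℝ} (hs : s ∈ I) (p : M) :
    HasDerivAt (fun s => relDensity X (Xv s) p)
      (relDensity X (Xv s) p * surfaceDiv (Xv s) (velocity Xv s) p) s := by
  have h := (hasDerivAt_sqrt_det_gram
    (e := fun s => coordFrame (Xv s) p (chartAt (Euc n) p p)) ((him s hs).linearIndependent_self p)
    (hasDerivAt_coordFrame hI hXv hs p)).div_const (areaDensity X p (chartAt (Euc n) p p))
  exact h.congr_deriv (mul_div_right_comm _ _ _)

lemma relDensity_self (hX : IsSmoothImmersion X) (p : M) : relDensity X X p = 1 :=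
  div_self (areaDensity_pos hX p (mem_chart_target _ p)).ne'

lemma relDensity_congr (hX : IsSmoothImmersion X) {Y : M → Euc (n + 1)} {p : M}
    (h : Y =ᶠ[𝓝 p] X) : relDensity X Y p = 1 := by
  rw [← relDensity_self hX p, relDensity, relDensity, areaDensity_eq, areaDensity_eq,
    coordFrame_self_congr h]

/-- The second variation of the area element under a normal variation. -/
lemma hasDerivAt_surfaceDiv_velocity (hI : IsOpen I) (h0 : (0 : ℝ) ∈ I)
    (hX : IsSmoothImmersion X) (hN : IsUnitNormal X N) {f : M → ℝ}
    (hf : SmoothInCharts (n := n) f) (hXv : SmoothFamily (n := n) I Xv) (hXv0 : Xv 0 = X)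
    (hvel : velocity Xv 0 = fun p => f p • N p) (p : M) :
    HasDerivAt (fun s => surfaceDiv (Xv s) (velocity Xv s) p)
      (⟪grad X f p, grad X f p⟫_ℝ - f p ^ 2 * sqNormSecondForm X N p
        + surfaceDiv X (velocity (velocity Xv) 0) p) 0 := by
  set x := chartAt (Euc n) p p
  -- By Weingarten the matrix of the frame lemma is minus the second fundamental form; the sign
  -- disappears in the quadratic term S.
  have hsf : innerMat (coordFrame X p x) (coordFrame N p x) = -secondForm X N p := by
    ext i j
    simp only [innerMat, Matrix.of_apply, Matrix.neg_apply]
    rw [real_inner_comm, inner_coordFrame_eq_neg_secondForm hX hN, secondForm_comm hX]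
  have h := hasDerivAt_frameDiv_normal
    (e := fun s => coordFrame (Xv s) p x) (d := fun s => coordFrame (velocity Xv s) p x)
    (e'' := coordFrame (velocity (velocity Xv) 0) p x) (dν := coordFrame N p x) (ν := N p)
    (f := f p) (a := coordFrame f p x) (s := 0)
    (by rw [hXv0]; exact hX.linearIndependent_self p) (hN.2 p).1
    (by rw [hXv0]; exact hN.inner_coordFrame_self hX p) (inner_coordFrame_normal hN p)
    (by
      intro i j
      rw [hXv0, inner_coordFrame_eq_neg_secondForm hX hN, inner_coordFrame_eq_neg_secondForm hX hN,
        secondForm_comm hX])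
    (by
      intro i
      rw [hvel, coordFrame_smul hf hN.smoothInCharts])
    (hasDerivAt_coordFrame hI hXv h0 p) (hasDerivAt_coordFrame hI (hXv.velocity hI) h0 p)
  rw [hXv0, hsf, Matrix.mul_neg, Matrix.neg_mul, Matrix.mul_neg, neg_neg] at h
  exact h

end Variation

/-! ### Derivatives of the Gaussian exponent. -/

section Exponent

variable {E : Type*} [NormedAddCommGroup E] [InnerProductSpace ℝ E]

/-- The derivative of `-|z|²/(2τ)`. -/
lemma hasDerivAt_exponent {z : ℝ → E} {z' : E} {τ : ℝ → ℝ} {τ' : ℝ} {s : ℝ}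
    (hz : HasDerivAt z z' s) (hτ : HasDerivAt τ τ' s) (h0 : τ s ≠ 0) :
    HasDerivAt (fun s => -‖z s‖ ^ 2 / (2 * τ s))
      (-⟪z s, z'⟫_ℝ / τ s + ‖z s‖ ^ 2 * τ' / (2 * τ s ^ 2)) s := by
  have h := (hz.norm_sq.neg).div (hτ.const_mul 2) (by simpa using h0)
  refine h.congr_deriv ?_
  simp only [Pi.neg_apply]
  field_simp
  ring

lemma hasDerivAt_exponent_deriv {z z₁ : ℝ → E} {z₂ : E} {τ τ₁ : ℝ → ℝ} {τ₂ : ℝ} {s : ℝ}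
    (hz : HasDerivAt z (z₁ s) s) (hz₁ : HasDerivAt z₁ z₂ s) (hτ : HasDerivAt τ (τ₁ s) s)
    (hτ₁ : HasDerivAt τ₁ τ₂ s) (h0 : τ s ≠ 0) :
    HasDerivAt (fun s => -⟪z s, z₁ s⟫_ℝ / τ s + ‖z s‖ ^ 2 * τ₁ s / (2 * τ s ^ 2))
      (-(‖z₁ s‖ ^ 2 + ⟪z s, z₂⟫_ℝ) / τ s + 2 * ⟪z s, z₁ s⟫_ℝ * τ₁ s / τ s ^ 2
        + ‖z s‖ ^ 2 * τ₂ / (2 * τ s ^ 2) - ‖z s‖ ^ 2 * τ₁ s ^ 2 / τ s ^ 3) s := by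
  have h := (((hz.inner ℝ hz₁).neg).div hτ h0).add
    ((hz.norm_sq.mul hτ₁).div ((hτ.pow 2).const_mul 2) (by simpa using h0))
  refine h.congr_deriv ?_
  simp only [Pi.neg_apply, Pi.mul_apply, Pi.pow_apply, real_inner_self_eq_norm_sq]
  field_simp
  ring

end Exponent

end LambdaHypersurface
end

noncomputable section

namespace LambdaHypersurface

/-! ### Domination by a wider Gaussian. -/

section Gaussian

lemma exists_polynomial_exp_bound {κ : ℝ} (hκ : 0 < κ) (A : ℝ) :
    ∃ C > 0, ∀ r : ℝ, (1 + r ^ 2) ^ 2 * Real.exp (A * r + A - κ * r ^ 2) ≤ C := by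
  -- Half of the decay κr² pays for the polynomial, through x²/2 ≤ eˣ at x = κ(1 + r²)/2; the other
  -- half absorbs Ar by completing the square. The exponent in the constant is what remains.
  refine ⟨8 / κ ^ 2 * Real.exp (κ / 2 + A ^ 2 / (2 * κ) + A), by positivity, fun r => ?_⟩
  have h1 : (1 + r ^ 2) ^ 2 ≤ 8 / κ ^ 2 * Real.exp (κ / 2 * (1 + r ^ 2)) := by
    have h := Real.quadratic_le_exp_of_nonneg (x := κ / 2 * (1 + r ^ 2)) (by positivity)
    have h2 : (1 + r ^ 2) ^ 2 = 8 / κ ^ 2 * ((κ / 2 * (1 + r ^ 2)) ^ 2 / 2) := by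
      field_simp; ring
    rw [h2]
    refine mul_le_mul_of_nonneg_left ?_ (by positivity)
    have : 0 ≤ κ / 2 * (1 + r ^ 2) := by positivity
    linarith
  have h3 : A * r ≤ κ / 2 * r ^ 2 + A ^ 2 / (2 * κ) := by
    have h4 : κ / 2 * r ^ 2 + A ^ 2 / (2 * κ) - A * r = (κ * r - A) ^ 2 / (2 * κ) := by
      field_simp; ring
    have : 0 ≤ (κ * r - A) ^ 2 / (2 * κ) := by positivity
    linarith
  calc (1 + r ^ 2) ^ 2 * Real.exp (A * r + A - κ * r ^ 2)
      ≤ 8 / κ ^ 2 * Real.exp (κ / 2 * (1 + r ^ 2)) *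
        Real.exp (κ / 2 * r ^ 2 + A ^ 2 / (2 * κ) + A - κ * r ^ 2) := by
        gcongr
    _ = _ := by
        rw [mul_assoc, ← Real.exp_add]
        congr 2
        ring

/-- The gap between the scales t₁ < t leaves a spare factor e^(-κr²). Quartic growth is allowed
because the second derivative of a Gaussian in its parameters has a quartic coefficient. -/
lemma exists_weight_bound {t₁ t : ℝ} (h₁ : 0 < t₁) (h : t₁ < t) (A : ℝ) :
    ∃ C > 0, ∀ r : ℝ, (1 + r ^ 2) ^ 2 * Real.exp (-r ^ 2 / (2 * t₁) + A * r + A)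
      ≤ C * Real.exp (-r ^ 2 / (2 * t)) := by
  have hκ : 0 < 1 / (2 * t₁) - 1 / (2 * t) :=
    sub_pos.2 (one_div_lt_one_div_of_lt (by linarith) (by linarith))
  obtain ⟨C, hC, hb⟩ := exists_polynomial_exp_bound hκ A
  refine ⟨C, hC, fun r => ?_⟩
  have h2 : -r ^ 2 / (2 * t₁) + A * r + A
      = (A * r + A - (1 / (2 * t₁) - 1 / (2 * t)) * r ^ 2) + -r ^ 2 / (2 * t) := by ring
  rw [h2, Real.exp_add, ← mul_assoc]
  exact mul_le_mul_of_nonneg_right (hb r) (Real.exp_pos _).le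

/-- For e^φ with |φ'| and |φ''| at most 2AP, these are the coefficients 1, φ' and φ'² + φ'' of e^φ
in the function and its first two derivatives; one constant serves all three. -/
lemma quadratic_le_coeff {A P : ℝ} (hA : 0 ≤ A) (hP : 1 ≤ P) :
    1 ≤ (1 + 2 * A + 4 * A ^ 2) * P ^ 2 ∧ 2 * A * P ≤ (1 + 2 * A + 4 * A ^ 2) * P ^ 2 ∧
      (2 * A * P) ^ 2 + 2 * A * P ≤ (1 + 2 * A + 4 * A ^ 2) * P ^ 2 := by
  have h1 : P ≤ P ^ 2 := by nlinarith
  have h2 : A * P ≤ A * P ^ 2 := mul_le_mul_of_nonneg_left h1 hA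
  have h3 : 0 ≤ A * P := by positivity
  have h4 : 0 ≤ (A * P) ^ 2 := sq_nonneg _
  refine ⟨?_, ?_, ?_⟩ <;> nlinarith

variable {E : Type*} [NormedAddCommGroup E]

lemma eventually_norm_derivs_le [NormedSpace ℝ E] {I : Set ℝ} (hI : IsOpen I) {s₀ : ℝ}
    (h0 : s₀ ∈ I) {u : ℝ → E} (hu : ContDiffOn ℝ ∞ u I) :
    ∃ A, ∀ᶠ s in 𝓝 s₀, ‖u s‖ ≤ A ∧ ‖deriv u s‖ ≤ A ∧ ‖deriv (deriv u) s‖ ≤ A := by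
  have h1 : ContDiffOn ℝ ∞ (deriv u) I := hu.deriv_of_isOpen hI (by simp)
  have h2 : ContDiffOn ℝ ∞ (deriv (deriv u)) I := h1.deriv_of_isOpen hI (by simp)
  have hb : ∀ v : ℝ → E, ContDiffOn ℝ ∞ v I → ∀ᶠ s in 𝓝 s₀, ‖v s‖ < ‖v s₀‖ + 1 := fun v hv =>
    (hv.continuousOn.continuousAt (hI.mem_nhds h0)).norm.eventually_lt_const (by linarith)
  refine ⟨max (max (‖u s₀‖ + 1) (‖deriv u s₀‖ + 1)) (‖deriv (deriv u) s₀‖ + 1), ?_⟩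
  filter_upwards [hb _ hu, hb _ h1, hb _ h2] with s ha hb hc
  refine ⟨ha.le.trans ?_, hb.le.trans ?_, hc.le.trans ?_⟩ <;> simp

variable [InnerProductSpace ℝ E]

lemma ContDiffOn.hasDerivAt_of_isOpen {F : Type*} [NormedAddCommGroup F] [NormedSpace ℝ F]
    {I : Set ℝ} (hI : IsOpen I) {u : ℝ → F} (hu : ContDiffOn ℝ ∞ u I) {s : ℝ} (hs : s ∈ I) :
    HasDerivAt u (deriv u s) s :=
  ((hu.contDiffAt (hI.mem_nhds hs)).differentiableAt (by simp)).hasDerivAt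

/-- Gaussians with center near `0` and scale near `1`, and their first two derivatives along a
variation of the center and the scale, are dominated by a wider Gaussian. -/
lemma exists_gaussian_bound {I : Set ℝ} (hI : IsOpen I) (h0 : (0 : ℝ) ∈ I) {c : ℝ → E}
    {τ : ℝ → ℝ} (hc : ContDiffOn ℝ ∞ c I) (hτ : ContDiffOn ℝ ∞ τ I) (hpos : ∀ s ∈ I, 0 < τ s)
    (hτ0 : τ 0 = 1) {t : ℝ} (ht : 1 < t) :
    ∃ C, ∀ᶠ s in 𝓝 (0 : ℝ), ∀ x : E,
      ‖Real.exp (-‖x - c s‖ ^ 2 / (2 * τ s))‖ ≤ C * Real.exp (-‖x‖ ^ 2 / (2 * t)) ∧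
      ‖deriv (fun s => Real.exp (-‖x - c s‖ ^ 2 / (2 * τ s))) s‖
        ≤ C * Real.exp (-‖x‖ ^ 2 / (2 * t)) ∧
      ‖deriv (deriv fun s => Real.exp (-‖x - c s‖ ^ 2 / (2 * τ s))) s‖
        ≤ C * Real.exp (-‖x‖ ^ 2 / (2 * t)) := by
  -- The exponent is a quadratic polynomial α|x|² + ⟨x, β⟩ + γ in x whose coefficients depend only
  -- on s, so bounds uniform in x reduce to bounds on these curves.
  set α : ℝ → ℝ := fun s => -(2 * τ s)⁻¹
  set β : ℝ → E := fun s => (τ s)⁻¹ • c s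
  set γ : ℝ → ℝ := fun s => -‖c s‖ ^ 2 * (2 * τ s)⁻¹
  have hτi : ContDiffOn ℝ ∞ (fun s => (2 * τ s)⁻¹) I :=
    (contDiffOn_const.mul hτ).inv fun s hs => by have := hpos s hs; positivity
  have hα : ContDiffOn ℝ ∞ α I := hτi.neg
  have hβ : ContDiffOn ℝ ∞ β I := (hτ.inv fun s hs => (hpos s hs).ne').smul hc
  have hγ : ContDiffOn ℝ ∞ γ I := ((hc.norm_sq ℝ).neg).mul hτi
  have hdα : ContDiffOn ℝ ∞ (deriv α) I := hα.deriv_of_isOpen hI (by simp)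
  have hdβ : ContDiffOn ℝ ∞ (deriv β) I := hβ.deriv_of_isOpen hI (by simp)
  have hdγ : ContDiffOn ℝ ∞ (deriv γ) I := hγ.deriv_of_isOpen hI (by simp)
  obtain ⟨A₁, hA₁⟩ := eventually_norm_derivs_le hI h0 hα
  obtain ⟨A₂, hA₂⟩ := eventually_norm_derivs_le hI h0 hβ
  obtain ⟨A₃, hA₃⟩ := eventually_norm_derivs_le hI h0 hγ
  set A := max (max A₁ A₂) A₃ with hA
  have hle₁ : A₁ ≤ A := by simp [hA]
  have hle₂ : A₂ ≤ A := by simp [hA]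
  have hle₃ : A₃ ≤ A := by simp [hA]
  have hA0 : 0 ≤ A := by
    obtain ⟨s, hs⟩ := hA₁.exists
    exact (norm_nonneg _).trans (hs.1.trans hle₁)
  -- An intermediate scale: for s near 0 the scale τ stays below t₁, and the gap up to t absorbs
  -- linear exponents and polynomial factors.
  set t₁ := (1 + t) / 2 with ht₁
  obtain ⟨C, hC, hCb⟩ := exists_weight_bound (t₁ := t₁) (t := t) (by rw [ht₁]; linarith)
    (by rw [ht₁]; linarith) A
  have hα1 : ∀ᶠ s in 𝓝 (0 : ℝ), α s < -(2 * t₁)⁻¹ := by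
    refine (hα.continuousOn.continuousAt (hI.mem_nhds h0)).eventually_lt_const ?_
    simp only [α, hτ0, neg_lt_neg_iff]
    exact inv_strictAnti₀ (by norm_num) (by rw [ht₁]; linarith)
  refine ⟨(1 + 2 * A + 4 * A ^ 2) * C, ?_⟩
  filter_upwards [hA₁, hA₂, hA₃, hα1, hI.mem_nhds h0] with s hs₁ hs₂ hs₃ hsα hsI x
  set φ : ℝ → ℝ := fun s => α s * ‖x‖ ^ 2 + ⟪x, β s⟫_ℝ + γ s with hφ
  set φ₁ : ℝ → ℝ := fun s => deriv α s * ‖x‖ ^ 2 + ⟪x, deriv β s⟫_ℝ + deriv γ s with hφ₁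
  set φ₂ : ℝ := deriv (deriv α) s * ‖x‖ ^ 2 + ⟪x, deriv (deriv β) s⟫_ℝ + deriv (deriv γ) s
  have hφe : (fun s => -‖x - c s‖ ^ 2 / (2 * τ s)) = φ := by
    funext r
    simp only [hφ, α, β, γ, norm_sub_sq_real, real_inner_smul_right, mul_inv]
    ring
  have hd₁ : ∀ r ∈ I, HasDerivAt φ (φ₁ r) r := fun r hr => by
    have h := (((ContDiffOn.hasDerivAt_of_isOpen hI hα hr).mul_const (‖x‖ ^ 2)).add
      ((hasDerivAt_const r x).inner ℝ (ContDiffOn.hasDerivAt_of_isOpen hI hβ hr))).add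
      (ContDiffOn.hasDerivAt_of_isOpen hI hγ hr)
    exact h.congr_deriv (by simp [hφ₁])
  have hd₂ : HasDerivAt φ₁ φ₂ s := by
    have h := (((ContDiffOn.hasDerivAt_of_isOpen hI hdα hsI).mul_const (‖x‖ ^ 2)).add
      ((hasDerivAt_const s x).inner ℝ (ContDiffOn.hasDerivAt_of_isOpen hI hdβ hsI))).add
      (ContDiffOn.hasDerivAt_of_isOpen hI hdγ hsI)
    exact h.congr_deriv (by simp [φ₂])
  have he : (fun s => Real.exp (-‖x - c s‖ ^ 2 / (2 * τ s))) = fun s => Real.exp (φ s) := by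
    rw [← hφe]
  have hD₁ : ∀ r ∈ I, deriv (fun s => Real.exp (φ s)) r = Real.exp (φ r) * φ₁ r :=
    fun r hr => (hd₁ r hr).exp.deriv
  have hD₂ : deriv (deriv fun s => Real.exp (φ s)) s = Real.exp (φ s) * (φ₁ s ^ 2 + φ₂) := by
    have hev : deriv (fun s => Real.exp (φ s)) =ᶠ[𝓝 s] fun r => Real.exp (φ r) * φ₁ r := by
      filter_upwards [hI.mem_nhds hsI] with r hr using hD₁ r hr
    have h : HasDerivAt (fun r => Real.exp (φ r) * φ₁ r) _ s := (hd₁ s hsI).exp.mul hd₂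
    rw [hev.deriv_eq, h.deriv]
    ring
  set r := ‖x‖ with hr
  have hr0 : 0 ≤ r := norm_nonneg _
  have hr2 : r ≤ 1 + r ^ 2 := by nlinarith [sq_nonneg (r - 1)]
  have hquad : ∀ (a : ℝ) (b : E) (g : ℝ), ‖a‖ ≤ A → ‖b‖ ≤ A → ‖g‖ ≤ A →
      |a * r ^ 2 + ⟪x, b⟫_ℝ + g| ≤ 2 * A * (1 + r ^ 2) := by
    intro a b g ha hb hg
    have h1 : |⟪x, b⟫_ℝ| ≤ r * A := (abs_real_inner_le_norm x b).trans
      (mul_le_mul_of_nonneg_left hb hr0)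
    have h2 : |a * r ^ 2| ≤ A * r ^ 2 := by
      rw [abs_mul, abs_of_nonneg (sq_nonneg r)]
      exact mul_le_mul_of_nonneg_right ha (sq_nonneg r)
    have h3 : |g| ≤ A := hg
    have h4 := abs_add_three (a * r ^ 2) ⟪x, b⟫_ℝ g
    nlinarith
  have hb₁ : |φ₁ s| ≤ 2 * A * (1 + r ^ 2) :=
    hquad _ _ _ (hs₁.2.1.trans hle₁) (hs₂.2.1.trans hle₂) (hs₃.2.1.trans hle₃)
  have hb₂ : |φ₂| ≤ 2 * A * (1 + r ^ 2) :=
    hquad _ _ _ (hs₁.2.2.trans hle₁) (hs₂.2.2.trans hle₂) (hs₃.2.2.trans hle₃)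
  have hb₀ : Real.exp (φ s) ≤ Real.exp (-r ^ 2 / (2 * t₁) + A * r + A) := by
    refine Real.exp_le_exp.2 ?_
    have h1 : ⟪x, β s⟫_ℝ ≤ A * r := by
      refine (real_inner_le_norm x (β s)).trans ?_
      rw [mul_comm]
      exact mul_le_mul_of_nonneg_right (hs₂.1.trans hle₂) hr0
    have h2 : γ s ≤ A := (le_abs_self _).trans (hs₃.1.trans hle₃)
    have h3 : α s * r ^ 2 ≤ -r ^ 2 / (2 * t₁) := by
      have := mul_le_mul_of_nonneg_right hsα.le (sq_nonneg r)
      calc α s * r ^ 2 ≤ -(2 * t₁)⁻¹ * r ^ 2 := this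
        _ = _ := by ring
    simp only [hφ]
    linarith
  have hmain : ∀ q : ℝ, |q| ≤ (1 + 2 * A + 4 * A ^ 2) * (1 + r ^ 2) ^ 2 →
      ‖Real.exp (φ s) * q‖ ≤ (1 + 2 * A + 4 * A ^ 2) * C * Real.exp (-r ^ 2 / (2 * t)) := by
    intro q hq
    rw [norm_mul, Real.norm_eq_abs, Real.norm_eq_abs, abs_of_pos (Real.exp_pos _)]
    calc Real.exp (φ s) * |q|
        ≤ Real.exp (-r ^ 2 / (2 * t₁) + A * r + A)
          * ((1 + 2 * A + 4 * A ^ 2) * (1 + r ^ 2) ^ 2) := by gcongr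
      _ = (1 + 2 * A + 4 * A ^ 2)
          * ((1 + r ^ 2) ^ 2 * Real.exp (-r ^ 2 / (2 * t₁) + A * r + A)) := by ring
      _ ≤ (1 + 2 * A + 4 * A ^ 2) * (C * Real.exp (-r ^ 2 / (2 * t))) := by
          exact mul_le_mul_of_nonneg_left (hCb r) (by positivity)
      _ = _ := by ring
  obtain ⟨hq₁, hq₂, hq₃⟩ := quadratic_le_coeff hA0 (P := 1 + r ^ 2) (by nlinarith [sq_nonneg r])
  rw [he, hD₁ s hsI, hD₂, show Real.exp (-‖x - c s‖ ^ 2 / (2 * τ s)) = Real.exp (φ s) * 1 by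
    rw [← hφe, mul_one]]
  refine ⟨hmain _ ?_, hmain _ ?_, hmain _ ?_⟩
  · rw [abs_one]; exact hq₁
  · exact hb₁.trans hq₂
  · have h1 : φ₁ s ^ 2 ≤ (2 * A * (1 + r ^ 2)) ^ 2 := by
      rw [← sq_abs (φ₁ s)]
      exact pow_le_pow_left₀ (abs_nonneg _) hb₁ 2
    have h2 : |φ₁ s ^ 2 + φ₂| ≤ φ₁ s ^ 2 + |φ₂| := by
      refine (abs_add_le _ _).trans ?_
      rw [abs_of_nonneg (sq_nonneg _)]
    linarith

end Gaussian

/-! ### Differentiation under the integral sign. -/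

section Integrals

open MeasureTheory

variable {n : ℕ} {M : Type*} [TopologicalSpace M] [T2Space M] [ChartedSpace (Euc n) M]
  [IsManifold (𝓡 n) ∞ M] [MeasurableSpace M] [BorelSpace M] {μ : Measure M}

lemma integrable_add_indicator_const [IsFiniteMeasureOnCompacts μ] {g : M → ℝ}
    (hg : Integrable g μ) {K : Set M} (hK : IsCompact K) (C : ℝ) :
    Integrable (fun p => g p + K.indicator (fun _ => C) p) μ :=
  hg.add ((integrable_indicator_iff hK.measurableSet).2
    (integrableOn_const hK.measure_lt_top.ne))

/-- Differentiation under the integral sign for a smooth family that is dominated outside a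
compact set. -/
lemma hasDerivAt_integral_family [IsFiniteMeasureOnCompacts μ] {I : Set ℝ} (hI : IsOpen I)
    {Φ : ℝ → M → ℝ} (hΦ : SmoothFamily (n := n) I Φ) {K : Set M} (hK : IsCompact K) {δ : ℝ}
    (hδ : Set.Icc (-δ) δ ⊆ I) {g : M → ℝ} (hg : Integrable g μ) (hg0 : ∀ p, 0 ≤ g p)
    (hb : ∀ s ∈ Set.Ioo (-δ) δ, ∀ p ∉ K, ‖Φ s p‖ ≤ g p ∧ ‖velocity Φ s p‖ ≤ g p) {s : ℝ}
    (hs : s ∈ Set.Ioo (-δ) δ) :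
    Integrable (Φ s) μ ∧ Integrable (velocity Φ s) μ ∧
      HasDerivAt (fun s => ∫ p, Φ s p ∂μ) (∫ p, velocity Φ s p ∂μ) s := by
  have hbd : ∀ Ψ : ℝ → M → ℝ, SmoothFamily (n := n) I Ψ →
      (∀ s ∈ Set.Ioo (-δ) δ, ∀ p ∉ K, ‖Ψ s p‖ ≤ g p) →
      ∃ G : M → ℝ, Integrable G μ ∧ ∀ s ∈ Set.Ioo (-δ) δ, ∀ p, ‖Ψ s p‖ ≤ G p := by
    intro Ψ hΨ hΨb
    -- Over K the family is bounded by continuity on a compact set of parameters and points, which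
    -- is why the parameter interval is taken closed; off K the given g dominates.
    obtain ⟨C, hC⟩ := (isCompact_Icc.prod hK).exists_bound_of_continuousOn
      ((hΨ.continuousOn hI).mono (Set.prod_mono hδ (Set.subset_univ K)))
    refine ⟨_, integrable_add_indicator_const hg hK C, fun s hs p => ?_⟩
    by_cases hp : p ∈ K
    · rw [Set.indicator_of_mem hp]
      have := hC (s, p) ⟨Set.Ioo_subset_Icc_self hs, hp⟩
      have h2 := hg0 p
      simp only at this
      linarith
    · rw [Set.indicator_of_notMem hp, add_zero]
      exact hΨb s hs p hp
  obtain ⟨G₀, hG₀, hb₀⟩ := hbd Φ hΦ fun s hs p hp => (hb s hs p hp).1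
  obtain ⟨G₁, hG₁, hb₁⟩ := hbd (velocity Φ) (hΦ.velocity hI) fun s hs p hp => (hb s hs p hp).2
  have hsub : Set.Ioo (-δ) δ ⊆ I := Set.Ioo_subset_Icc_self.trans hδ
  have hmeas : ∀ r ∈ Set.Ioo (-δ) δ, AEStronglyMeasurable (Φ r) μ := fun r hr =>
    (hΦ.smoothInCharts (hsub hr)).continuous.aestronglyMeasurable
  have hint : Integrable (Φ s) μ :=
    hG₀.mono' (hmeas s hs) (Filter.Eventually.of_forall (hb₀ s hs))
  have h := hasDerivAt_integral_of_dominated_loc_of_deriv_le (μ := μ) (F := Φ)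
    (F' := velocity Φ) (bound := G₁) (s := Set.Ioo (-δ) δ) (isOpen_Ioo.mem_nhds hs)
    (Filter.eventually_of_mem (isOpen_Ioo.mem_nhds hs) hmeas) hint
    ((hΦ.velocity hI).smoothInCharts (hsub hs)).continuous.aestronglyMeasurable
    (Filter.Eventually.of_forall fun p r hr => hb₁ r hr p) hG₁
    (Filter.Eventually.of_forall fun p r hr => hΦ.hasDerivAt hI (hsub hr) p)
  exact ⟨hint, h⟩

end Integrals

end LambdaHypersurface
end

noncomputable section

namespace LambdaHypersurface

/-! ### Joint variations and the derivatives of their integrands. -/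

section Admissible

variable {n : ℕ} {M : Type*} [TopologicalSpace M] [ChartedSpace (Euc n) M]

/-- A normal variation of `X` together with variations of the center `0` and of the scale `1`,
on an open set `I` of parameters, with the variation of `X` fixed outside the compact set `K`. -/
structure IsJointVariation (X N : M → Euc (n + 1)) (f : M → ℝ) (y : Euc (n + 1)) (h : ℝ)
    (Xv : ℝ → M → Euc (n + 1)) (Xc : ℝ → Euc (n + 1)) (tc : ℝ → ℝ) (I : Set ℝ) (K : Set M) :
    Prop where
  isOpen : IsOpen I
  zero_mem : (0 : ℝ) ∈ I
  smooth : SmoothFamily (n := n) I Xv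
  immersion : ∀ s ∈ I, IsSmoothImmersion (Xv s)
  isCompact : IsCompact K
  fixed : ∀ s ∈ I, ∀ p ∉ K, Xv s p = X p
  start : Xv 0 = X
  speed : velocity Xv 0 = fun p => f p • N p
  center_smooth : ContDiffOn ℝ ∞ Xc I
  center_start : Xc 0 = 0
  center_speed : deriv Xc 0 = y
  scale_smooth : ContDiffOn ℝ ∞ tc I
  scale_pos : ∀ s ∈ I, 0 < tc s
  scale_start : tc 0 = 1
  scale_speed : deriv tc 0 = h

variable [IsManifold (𝓡 n) ∞ M] {X N : M → Euc (n + 1)} {f : M → ℝ} {y : Euc (n + 1)} {h : ℝ}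
  {Xv : ℝ → M → Euc (n + 1)} {Xc : ℝ → Euc (n + 1)} {tc : ℝ → ℝ} {I : Set ℝ} {K : Set M}

lemma exists_isJointVariation (hXv : IsNormalVariation X N f Xv) (hXc : IsPointVariation 0 y Xc)
    (htc : IsPointVariation 1 h tc) :
    ∃ (I : Set ℝ) (K : Set M), IsJointVariation X N f y h Xv Xc tc I K := by
  obtain ⟨hX0, hXd, ε₁, hε₁, hsm, him, K, hK, hfix⟩ := hXv
  obtain ⟨hc0, hcd, ε₂, hε₂, hcs⟩ := hXc
  obtain ⟨ht0, htd, ε₃, hε₃, hts⟩ := htc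
  have hpos : ∀ᶠ s in 𝓝 (0 : ℝ), 0 < tc s :=
    htd.continuousAt.eventually_const_lt (by rw [ht0]; exact one_pos)
  obtain ⟨ε₄, hε₄, hb⟩ := Metric.eventually_nhds_iff_ball.1 hpos
  set ε := min (min ε₁ ε₂) (min ε₃ ε₄) with hε
  have hεpos : 0 < ε := by simp [hε, hε₁, hε₂, hε₃, hε₄]
  have hsub : ∀ {η}, ε ≤ η → Set.Ioo (-ε) ε ⊆ Set.Ioo (-η) η := fun hη =>
    Set.Ioo_subset_Ioo (neg_le_neg hη) hη
  have h₁ : ε ≤ ε₁ := by simp [hε]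
  have h₂ : ε ≤ ε₂ := by simp [hε]
  have h₃ : ε ≤ ε₃ := by simp [hε]
  have h₄ : ε ≤ ε₄ := by simp [hε]
  refine ⟨Set.Ioo (-ε) ε, K, ?_⟩
  exact
    { isOpen := isOpen_Ioo
      zero_mem := ⟨by linarith, hεpos⟩
      smooth := (SmoothFamily.of_contMDiffOn hsm).mono (hsub h₁)
      immersion := fun s hs => him s (hsub h₁ hs)
      isCompact := hK
      fixed := fun s hs => hfix s (hsub h₁ hs)
      start := hX0
      speed := funext fun p => (hXd p).deriv
      center_smooth := hcs.mono (hsub h₂)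
      center_start := hc0
      center_speed := hcd.deriv
      scale_smooth := hts.mono (hsub h₃)
      scale_pos := fun s hs => hb s (by
        rw [Real.ball_eq_Ioo]; simpa using hsub h₄ hs)
      scale_start := ht0
      scale_speed := htd.deriv }

namespace IsJointVariation

variable (H : IsJointVariation X N f y h Xv Xc tc I K)
include H

lemma velocity_eq_zero {s : ℝ} (hs : s ∈ I) {p : M} (hp : p ∉ K) : velocity Xv s p = 0 := by
  have hev : (fun s => Xv s p) =ᶠ[𝓝 s] fun _ => X p := by
    filter_upwards [H.isOpen.mem_nhds hs] with r hr using H.fixed r hr p hp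
  rw [velocity, hev.deriv_eq, deriv_const]

lemma velocity_velocity_eq_zero {s : ℝ} (hs : s ∈ I) {p : M} (hp : p ∉ K) :
    velocity (velocity Xv) s p = 0 := by
  have hev : (fun s => velocity Xv s p) =ᶠ[𝓝 s] fun _ => 0 := by
    filter_upwards [H.isOpen.mem_nhds hs] with r hr using H.velocity_eq_zero hr hp
  rw [velocity, hev.deriv_eq, deriv_const]

lemma isSmoothImmersion : IsSmoothImmersion X := H.start ▸ H.immersion 0 H.zero_mem

/-- No regularity of f is assumed; it is inherited from the variation, since f is the inner product
of the initial velocity with N. -/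
lemma smoothInCharts_speed (hN : IsUnitNormal X N) : SmoothInCharts (n := n) f := by
  have h1 := ((H.smooth.velocity H.isOpen).smoothInCharts H.zero_mem).inner hN.smoothInCharts
  rw [H.speed] at h1
  convert h1 using 2 with p
  rw [real_inner_smul_left, real_inner_self_eq_norm_sq, (hN.2 p).1]
  ring

lemma hasCompactSupport_speed [T2Space M] (hN : IsUnitNormal X N) : HasCompactSupport f :=
  HasCompactSupport.intro H.isCompact fun p hp => by
    have h1 := H.velocity_eq_zero H.zero_mem hp
    rw [H.speed] at h1
    refine (smul_eq_zero.1 h1).resolve_right fun h2 => ?_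
    have h3 := (hN.2 p).1
    rw [h2, norm_zero] at h3
    exact zero_ne_one h3

lemma smoothInCharts_acceleration : SmoothInCharts (n := n) (velocity (velocity Xv) 0) :=
  ((H.smooth.velocity H.isOpen).velocity H.isOpen).smoothInCharts H.zero_mem

lemma hasCompactSupport_acceleration [T2Space M] :
    HasCompactSupport (velocity (velocity Xv) 0) :=
  HasCompactSupport.intro H.isCompact fun _ hp => H.velocity_velocity_eq_zero H.zero_mem hp

end IsJointVariation

/-- The weighted area element of a variation, relative to the area element of `X`. -/
def areaIntegrand (X : M → Euc (n + 1)) (Xv : ℝ → M → Euc (n + 1)) (Xc : ℝ → Euc (n + 1))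
    (tc : ℝ → ℝ) (s : ℝ) (p : M) : ℝ :=
  relDensity X (Xv s) p * Real.exp (-‖Xv s p - Xc s‖ ^ 2 / (2 * tc s))

/-- The integrand of the volume term of the functional. -/
def volumeIntegrand (X N : M → Euc (n + 1)) (Xv : ℝ → M → Euc (n + 1)) (Xc : ℝ → Euc (n + 1))
    (s : ℝ) (p : M) : ℝ :=
  ⟪Xv s p - Xc s, N p⟫_ℝ * gaussWeight X p

/-- The logarithmic derivative of the weighted area element. -/
def logSpeed (Xv : ℝ → M → Euc (n + 1)) (Xc : ℝ → Euc (n + 1)) (tc : ℝ → ℝ) (s : ℝ) (p : M) : ℝ :=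
  (-⟪Xv s p - Xc s, velocity Xv s p - deriv Xc s⟫_ℝ / tc s
    + ‖Xv s p - Xc s‖ ^ 2 * deriv tc s / (2 * tc s ^ 2)) + surfaceDiv (Xv s) (velocity Xv s) p

namespace IsJointVariation

lemma smoothFamily_areaIntegrand (H : IsJointVariation X N f y h Xv Xc tc I K) :
    SmoothFamily (n := n) I (areaIntegrand X Xv Xc tc) := by
  have h1 := SmoothFamily.relDensity H.isOpen H.isSmoothImmersion H.smooth H.immersion
  have h2 := SmoothFamily.of_curve (n := n) (M := M) H.center_smooth
  have h3 := SmoothFamily.of_curve (n := n) (M := M) H.scale_smooth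
  intro p
  exact (h1 p).mul (((((H.smooth p).sub (h2 p)).norm_sq ℝ).neg.div (contDiffOn_const.mul (h3 p))
    fun q hq => mul_ne_zero two_ne_zero (H.scale_pos q.1 hq.1).ne').exp)

lemma smoothFamily_volumeIntegrand (H : IsJointVariation X N f y h Xv Xc tc I K)
    (hN : IsUnitNormal X N) : SmoothFamily (n := n) I (volumeIntegrand X N Xv Xc) := by
  have h2 := SmoothFamily.of_curve (n := n) (M := M) H.center_smooth
  have h3 := hN.smoothInCharts.family I
  have h4 := H.isSmoothImmersion.smoothInCharts.gaussWeight.family I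
  intro p
  exact ((((H.smooth p).sub (h2 p)).inner ℝ (h3 p))).mul (h4 p)

variable (H : IsJointVariation X N f y h Xv Xc tc I K)
include H

lemma hasDerivAt_center {s : ℝ} (hs : s ∈ I) : HasDerivAt Xc (deriv Xc s) s :=
  ContDiffOn.hasDerivAt_of_isOpen H.isOpen H.center_smooth hs

lemma hasDerivAt_center_speed {s : ℝ} (hs : s ∈ I) :
    HasDerivAt (deriv Xc) (deriv (deriv Xc) s) s :=
  ContDiffOn.hasDerivAt_of_isOpen H.isOpen
    (H.center_smooth.deriv_of_isOpen H.isOpen (by simp)) hs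

lemma hasDerivAt_scale {s : ℝ} (hs : s ∈ I) : HasDerivAt tc (deriv tc s) s :=
  ContDiffOn.hasDerivAt_of_isOpen H.isOpen H.scale_smooth hs

lemma hasDerivAt_scale_speed {s : ℝ} (hs : s ∈ I) :
    HasDerivAt (deriv tc) (deriv (deriv tc) s) s :=
  ContDiffOn.hasDerivAt_of_isOpen H.isOpen
    (H.scale_smooth.deriv_of_isOpen H.isOpen (by simp)) hs

lemma hasDerivAt_position {s : ℝ} (hs : s ∈ I) (p : M) :
    HasDerivAt (fun s => Xv s p - Xc s) (velocity Xv s p - deriv Xc s) s :=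
  (H.smooth.hasDerivAt H.isOpen hs p).sub (H.hasDerivAt_center hs)

lemma hasDerivAt_position_speed {s : ℝ} (hs : s ∈ I) (p : M) :
    HasDerivAt (fun s => velocity Xv s p - deriv Xc s)
      (velocity (velocity Xv) s p - deriv (deriv Xc) s) s :=
  ((H.smooth.velocity H.isOpen).hasDerivAt H.isOpen hs p).sub (H.hasDerivAt_center_speed hs)

/-- Writing the derivative as integrand times logarithmic derivative makes the next derivative the
integrand times ℓ² + ℓ'. -/
lemma velocity_areaIntegrand {s : ℝ} (hs : s ∈ I) (p : M) :
    velocity (areaIntegrand X Xv Xc tc) s p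
      = areaIntegrand X Xv Xc tc s p * logSpeed Xv Xc tc s p := by
  have h1 := hasDerivAt_relDensity (X := X) H.isOpen H.smooth H.immersion hs p
  have h2 := (hasDerivAt_exponent (H.hasDerivAt_position hs p) (H.hasDerivAt_scale hs)
    (H.scale_pos s hs).ne').exp
  have h3 : HasDerivAt (fun s => areaIntegrand X Xv Xc tc s p) _ s := h1.mul h2
  rw [velocity, h3.deriv, areaIntegrand, logSpeed]
  ring

lemma areaIntegrand_zero (p : M) : areaIntegrand X Xv Xc tc 0 p = gaussWeight X p := by
  rw [areaIntegrand, H.start, relDensity_self H.isSmoothImmersion, H.center_start, H.scale_start,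
    gaussWeight, sub_zero, one_mul, mul_one]

lemma logSpeed_zero (hN : IsUnitNormal X N) (p : M) :
    logSpeed Xv Xc tc 0 p = -⟪X p, f p • N p - y⟫_ℝ + ‖X p‖ ^ 2 * h / 2
      - f p * meanCurvature X N p := by
  rw [logSpeed, H.start, H.center_start, H.scale_start, H.center_speed, H.scale_speed, H.speed,
    surfaceDiv_smul (H.smoothInCharts_speed hN) hN.smoothInCharts,
    surfaceDiv_normal H.isSmoothImmersion hN, inner_grad_normal H.isSmoothImmersion hN]
  simp only [sub_zero]
  ring

/-- The three groups are the square of the logarithmic derivative, the second derivative of the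
Gaussian exponent, and the second variation of the area element. -/
lemma velocity_velocity_areaIntegrand (hN : IsUnitNormal X N) (p : M) :
    velocity (velocity (areaIntegrand X Xv Xc tc)) 0 p = gaussWeight X p *
      ((-⟪X p, f p • N p - y⟫_ℝ + ‖X p‖ ^ 2 * h / 2 - f p * meanCurvature X N p) ^ 2
        + (-(‖f p • N p - y‖ ^ 2 + ⟪X p, velocity (velocity Xv) 0 p - deriv (deriv Xc) 0⟫_ℝ)
          + 2 * ⟪X p, f p • N p - y⟫_ℝ * h + ‖X p‖ ^ 2 * deriv (deriv tc) 0 / 2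
          - ‖X p‖ ^ 2 * h ^ 2)
        + (⟪grad X f p, grad X f p⟫_ℝ - f p ^ 2 * sqNormSecondForm X N p
          + surfaceDiv X (velocity (velocity Xv) 0) p)) := by
  have h0 := H.zero_mem
  have hl := (hasDerivAt_exponent_deriv (H.hasDerivAt_position h0 p)
    (H.hasDerivAt_position_speed h0 p) (H.hasDerivAt_scale h0) (H.hasDerivAt_scale_speed h0)
    (H.scale_pos 0 h0).ne').add (hasDerivAt_surfaceDiv_velocity H.isOpen h0 H.isSmoothImmersion hN
      (H.smoothInCharts_speed hN) H.smooth H.start H.speed p)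
  have ha := H.smoothFamily_areaIntegrand.hasDerivAt H.isOpen h0 p
  rw [H.velocity_areaIntegrand h0] at ha
  have hm : HasDerivAt (fun s => areaIntegrand X Xv Xc tc s p * logSpeed Xv Xc tc s p) _ 0 :=
    ha.mul hl
  have hev : (fun s => velocity (areaIntegrand X Xv Xc tc) s p) =ᶠ[𝓝 0]
      fun s => areaIntegrand X Xv Xc tc s p * logSpeed Xv Xc tc s p := by
    filter_upwards [H.isOpen.mem_nhds h0] with s hs using H.velocity_areaIntegrand hs p
  rw [velocity, hev.deriv_eq, hm.deriv]
  rw [H.areaIntegrand_zero, H.logSpeed_zero hN, H.start, H.center_start, H.scale_start,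
    H.center_speed, H.scale_speed, H.speed]
  simp only [sub_zero]
  ring

lemma velocity_volumeIntegrand {s : ℝ} (hs : s ∈ I) (p : M) :
    velocity (volumeIntegrand X N Xv Xc) s p
      = ⟪velocity Xv s p - deriv Xc s, N p⟫_ℝ * gaussWeight X p := by
  have h1 := ((H.hasDerivAt_position hs p).inner ℝ (hasDerivAt_const s (N p))).mul_const
    (gaussWeight X p)
  rw [inner_zero_right, zero_add] at h1
  exact h1.deriv

/-- The Gaussian weight and the normal in this term are frozen at s = 0, so the integrand is affine
in position and center and only accelerations survive. -/
lemma velocity_velocity_volumeIntegrand {s : ℝ} (hs : s ∈ I) (p : M) :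
    velocity (velocity (volumeIntegrand X N Xv Xc)) s p
      = ⟪velocity (velocity Xv) s p - deriv (deriv Xc) s, N p⟫_ℝ * gaussWeight X p := by
  have h1 := ((H.hasDerivAt_position_speed hs p).inner ℝ (hasDerivAt_const s (N p))).mul_const
    (gaussWeight X p)
  rw [inner_zero_right, zero_add] at h1
  have hev : (fun s => velocity (volumeIntegrand X N Xv Xc) s p) =ᶠ[𝓝 s]
      fun s => ⟪velocity Xv s p - deriv Xc s, N p⟫_ℝ * gaussWeight X p := by
    filter_upwards [H.isOpen.mem_nhds hs] with r hr using H.velocity_volumeIntegrand hr p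
  rw [velocity, hev.deriv_eq]
  exact h1.deriv

/-- The complement of K is open, so X(s) and X agree near p and have the same area element there.
Only the center and the scale of the Gaussian move, which is the situation of
`exists_gaussian_bound`. -/
lemma areaIntegrand_fixed [T2Space M] {s : ℝ} (hs : s ∈ I) {p : M} (hp : p ∉ K) :
    areaIntegrand X Xv Xc tc s p = Real.exp (-‖X p - Xc s‖ ^ 2 / (2 * tc s)) := by
  have hev : Xv s =ᶠ[𝓝 p] X := by
    filter_upwards [H.isCompact.isClosed.isOpen_compl.mem_nhds hp] with q hq
      using H.fixed s hs q hq
  rw [areaIntegrand, relDensity_congr H.isSmoothImmersion hev, one_mul, H.fixed s hs p hp]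

lemma velocity_areaIntegrand_fixed [T2Space M] {s : ℝ} (hs : s ∈ I) {p : M} (hp : p ∉ K) :
    velocity (areaIntegrand X Xv Xc tc) s p
      = deriv (fun s => Real.exp (-‖X p - Xc s‖ ^ 2 / (2 * tc s))) s := by
  refine Filter.EventuallyEq.deriv_eq ?_
  filter_upwards [H.isOpen.mem_nhds hs] with r hr using H.areaIntegrand_fixed hr hp

lemma velocity_velocity_areaIntegrand_fixed [T2Space M] {s : ℝ} (hs : s ∈ I) {p : M}
    (hp : p ∉ K) : velocity (velocity (areaIntegrand X Xv Xc tc)) s p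
      = deriv (deriv fun s => Real.exp (-‖X p - Xc s‖ ^ 2 / (2 * tc s))) s := by
  refine Filter.EventuallyEq.deriv_eq ?_
  filter_upwards [H.isOpen.mem_nhds hs] with r hr using H.velocity_areaIntegrand_fixed hr hp

lemma exists_areaIntegrand_bound [T2Space M] {t : ℝ} (ht : 1 < t) :
    ∃ C, ∀ᶠ s in 𝓝 (0 : ℝ), ∀ p ∉ K,
      ‖areaIntegrand X Xv Xc tc s p‖ ≤ C * Real.exp (-‖X p‖ ^ 2 / (2 * t)) ∧
      ‖velocity (areaIntegrand X Xv Xc tc) s p‖ ≤ C * Real.exp (-‖X p‖ ^ 2 / (2 * t)) ∧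
      ‖velocity (velocity (areaIntegrand X Xv Xc tc)) s p‖
        ≤ C * Real.exp (-‖X p‖ ^ 2 / (2 * t)) := by
  obtain ⟨C, hC⟩ := exists_gaussian_bound H.isOpen H.zero_mem H.center_smooth H.scale_smooth
    H.scale_pos H.scale_start ht
  refine ⟨C, ?_⟩
  filter_upwards [hC, H.isOpen.mem_nhds H.zero_mem] with s hs hsI p hp
  rw [H.areaIntegrand_fixed hsI hp, H.velocity_areaIntegrand_fixed hsI hp,
    H.velocity_velocity_areaIntegrand_fixed hsI hp]
  exact hs (X p)

lemma exists_volumeIntegrand_bound (hN : IsUnitNormal X N) {t : ℝ} (ht : 1 < t) :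
    ∃ C, ∀ᶠ s in 𝓝 (0 : ℝ), ∀ p ∉ K,
      ‖volumeIntegrand X N Xv Xc s p‖ ≤ C * Real.exp (-‖X p‖ ^ 2 / (2 * t)) ∧
      ‖velocity (volumeIntegrand X N Xv Xc) s p‖ ≤ C * Real.exp (-‖X p‖ ^ 2 / (2 * t)) ∧
      ‖velocity (velocity (volumeIntegrand X N Xv Xc)) s p‖
        ≤ C * Real.exp (-‖X p‖ ^ 2 / (2 * t)) := by
  -- The weight has the fixed scale 1 and no linear term, hence A = 0; the prefactors grow at most
  -- linearly in |X|.
  obtain ⟨C, hC, hCb⟩ := exists_weight_bound one_pos ht 0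
  obtain ⟨A, hA⟩ := eventually_norm_derivs_le H.isOpen H.zero_mem H.center_smooth
  have hA0 : 0 ≤ A := by
    obtain ⟨s, hs⟩ := hA.exists
    exact (norm_nonneg _).trans hs.1
  refine ⟨(1 + A) * C, ?_⟩
  filter_upwards [hA, H.isOpen.mem_nhds H.zero_mem] with s hs hsI p hp
  have hmain : ∀ v : Euc (n + 1), ‖v‖ ≤ ‖X p‖ + A →
      ‖⟪v, N p⟫_ℝ * gaussWeight X p‖ ≤ (1 + A) * C * Real.exp (-‖X p‖ ^ 2 / (2 * t)) := by
    intro v hv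
    have h1 : |⟪v, N p⟫_ℝ| ≤ ‖v‖ := by
      have := abs_real_inner_le_norm v (N p)
      rwa [(hN.2 p).1, mul_one] at this
    have h2 : ‖X p‖ + A ≤ (1 + A) * (1 + ‖X p‖ ^ 2) ^ 2 := by
      set r := ‖X p‖
      have h3 : r ≤ 1 + r ^ 2 := by nlinarith [sq_nonneg (r - 1)]
      have h4 : 1 ≤ 1 + r ^ 2 := by nlinarith [sq_nonneg r]
      have h5 : 1 + r ^ 2 ≤ (1 + r ^ 2) ^ 2 := by nlinarith
      have h6 : A * 1 ≤ A * (1 + r ^ 2) ^ 2 := mul_le_mul_of_nonneg_left (h4.trans h5) hA0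
      linarith
    have h3 := hCb ‖X p‖
    simp only [zero_mul, add_zero, mul_one] at h3
    rw [norm_mul, Real.norm_eq_abs, Real.norm_eq_abs, gaussWeight, abs_of_pos (Real.exp_pos _)]
    calc |⟪v, N p⟫_ℝ| * Real.exp (-‖X p‖ ^ 2 / 2)
        ≤ ((1 + A) * (1 + ‖X p‖ ^ 2) ^ 2) * Real.exp (-‖X p‖ ^ 2 / 2) :=
          mul_le_mul_of_nonneg_right (h1.trans (hv.trans h2)) (Real.exp_pos _).le
      _ = (1 + A) * ((1 + ‖X p‖ ^ 2) ^ 2 * Real.exp (-‖X p‖ ^ 2 / 2)) := by ring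
      _ ≤ (1 + A) * (C * Real.exp (-‖X p‖ ^ 2 / (2 * t))) :=
          mul_le_mul_of_nonneg_left h3 (by linarith)
      _ = _ := by ring
  rw [H.velocity_volumeIntegrand hsI, H.velocity_velocity_volumeIntegrand hsI,
    H.velocity_eq_zero hsI hp, H.velocity_velocity_eq_zero hsI hp, volumeIntegrand,
    H.fixed s hsI p hp]
  refine ⟨hmain _ ?_, hmain _ ?_, hmain _ ?_⟩
  · exact (norm_sub_le _ _).trans (by linarith [hs.1])
  · rw [zero_sub, norm_neg]; linarith [hs.2.1, norm_nonneg (X p)]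
  · rw [zero_sub, norm_neg]; linarith [hs.2.2, norm_nonneg (X p)]

end IsJointVariation

end Admissible

end LambdaHypersurface
end

noncomputable section

namespace LambdaHypersurface

/-! ### Derivatives of the scale factors. -/

section Scalar

/-- The first two derivatives of `τ ^ r * A` at a point where `τ = 1`. -/
lemma exists_hasDerivAt_rpow_mul {τ τ₁ A A₁ : ℝ → ℝ} {τ₂ A₂ : ℝ} (r : ℝ)
    (hτ : ∀ᶠ s in 𝓝 (0 : ℝ), HasDerivAt τ (τ₁ s) s) (hτ₁ : HasDerivAt τ₁ τ₂ 0) (hτ0 : τ 0 = 1)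
    (hA : ∀ᶠ s in 𝓝 (0 : ℝ), HasDerivAt A (A₁ s) s) (hA₁ : HasDerivAt A₁ A₂ 0) :
    ∃ P : ℝ → ℝ, (∀ᶠ s in 𝓝 (0 : ℝ), HasDerivAt (fun s => τ s ^ r * A s) (P s) s) ∧
      P 0 = r * τ₁ 0 * A 0 + A₁ 0 ∧
      HasDerivAt P ((r * (r - 1) * τ₁ 0 ^ 2 + r * τ₂) * A 0 + 2 * r * τ₁ 0 * A₁ 0 + A₂) 0 := by
  have h0 := hτ.self_of_nhds
  have hA0 := hA.self_of_nhds
  have hpos : ∀ᶠ s in 𝓝 (0 : ℝ), 0 < τ s :=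
    h0.continuousAt.eventually_const_lt (by rw [hτ0]; exact one_pos)
  have hp : ∀ q : ℝ, HasDerivAt (fun s => τ s ^ q) (q * τ₁ 0) 0 := fun q => by
    have h := h0.rpow_const (p := q) (Or.inl (by rw [hτ0]; exact one_ne_zero))
    refine h.congr_deriv ?_
    rw [hτ0, Real.one_rpow]
    ring
  refine ⟨fun s => (τ₁ s * r * τ s ^ (r - 1)) * A s + τ s ^ r * A₁ s, ?_, ?_, ?_⟩
  · filter_upwards [hτ, hA, hpos] with s h1 h2 h3
    exact (h1.rpow_const (Or.inl h3.ne')).mul h2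
  · simp only [hτ0, Real.one_rpow]
    ring
  · have h := (((hτ₁.mul_const r).mul (hp (r - 1))).mul hA0).add ((hp r).mul hA₁)
    refine h.congr_deriv ?_
    simp only [Pi.mul_apply, hτ0, Real.one_rpow]
    ring

end Scalar

/-! ### Linear combinations of integrals. -/

section Combination

open MeasureTheory

variable {α : Type*} [MeasurableSpace α] {μ : Measure α} {A B C : α → ℝ}

lemma integrable_combination (hA : Integrable A μ) (hB : Integrable B μ) (hC : Integrable C μ)
    (a b : ℝ) : Integrable (fun p => a * A p + b * B p + C p) μ :=
  ((hA.const_mul a).add (hB.const_mul b)).add hC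

lemma integral_combination (hA : Integrable A μ) (hB : Integrable B μ) (hC : Integrable C μ)
    (a b : ℝ) : ∫ p, (a * A p + b * B p + C p) ∂μ
      = a * (∫ p, A p ∂μ) + b * (∫ p, B p ∂μ) + ∫ p, C p ∂μ := by
  rw [integral_add (f := fun p => a * A p + b * B p) ((hA.const_mul a).add (hB.const_mul b)) hC,
    integral_add (hA.const_mul a) (hB.const_mul b), integral_const_mul, integral_const_mul]

end Combination

/-! ### The first two derivatives of the functional. -/

section Functional

open MeasureTheory

variable {n : ℕ} {M : Type*} [TopologicalSpace M] [T2Space M] [SecondCountableTopology M]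
  [ChartedSpace (Euc n) M] [IsManifold (𝓡 n) ∞ M] [MeasurableSpace M] [BorelSpace M]
  {X N : M → Euc (n + 1)}

/-- Differentiation under the integral is applied to the family and then to its velocity, so bounds
on two derivatives are needed; the first step is carried out on a whole neighbourhood of 0 so that a
second derivative makes sense. -/
lemma exists_integral_derivs (hX : IsSmoothImmersion X) {t : ℝ}
    (hfin : Integrable (fun p => Real.exp (-‖X p‖ ^ 2 / (2 * t))) (areaMeasure X))
    {I : Set ℝ} (hI : IsOpen I) (h0 : (0 : ℝ) ∈ I) {Φ : ℝ → M → ℝ}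
    (hΦ : SmoothFamily (n := n) I Φ) {K : Set M} (hK : IsCompact K)
    (hb : ∃ C, ∀ᶠ s in 𝓝 (0 : ℝ), ∀ p ∉ K,
      ‖Φ s p‖ ≤ C * Real.exp (-‖X p‖ ^ 2 / (2 * t)) ∧
      ‖velocity Φ s p‖ ≤ C * Real.exp (-‖X p‖ ^ 2 / (2 * t)) ∧
      ‖velocity (velocity Φ) s p‖ ≤ C * Real.exp (-‖X p‖ ^ 2 / (2 * t))) :
    Integrable (Φ 0) (areaMeasure X) ∧ Integrable (velocity Φ 0) (areaMeasure X) ∧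
      Integrable (velocity (velocity Φ) 0) (areaMeasure X) ∧
      (∀ᶠ s in 𝓝 (0 : ℝ), HasDerivAt (fun s => ∫ p, Φ s p ∂(areaMeasure X))
        (∫ p, velocity Φ s p ∂(areaMeasure X)) s) ∧
      HasDerivAt (fun s => ∫ p, velocity Φ s p ∂(areaMeasure X))
        (∫ p, velocity (velocity Φ) 0 p ∂(areaMeasure X)) 0 := by
  have := isLocallyFiniteMeasure_areaMeasure hX
  obtain ⟨C, hC⟩ := hb
  obtain ⟨η, hη, hηb⟩ := Metric.eventually_nhds_iff_ball.1 (hC.and (hI.mem_nhds h0))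
  have hsub : Set.Icc (-(η / 2)) (η / 2) ⊆ Metric.ball (0 : ℝ) η := by
    intro s hs
    rw [Real.ball_eq_Ioo]
    exact ⟨by linarith [hs.1], by linarith [hs.2]⟩
  have hmem : ∀ {s : ℝ}, s ∈ Set.Ioo (-(η / 2)) (η / 2) → s ∈ Metric.ball (0 : ℝ) η :=
    fun hs => hsub (Set.Ioo_subset_Icc_self hs)
  have hg : Integrable (fun p => |C| * Real.exp (-‖X p‖ ^ 2 / (2 * t))) (areaMeasure X) :=
    hfin.const_mul _
  have hle : ∀ p, C * Real.exp (-‖X p‖ ^ 2 / (2 * t)) ≤ |C| * Real.exp (-‖X p‖ ^ 2 / (2 * t)) :=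
    fun p => mul_le_mul_of_nonneg_right (le_abs_self C) (Real.exp_pos _).le
  have hI' : Set.Icc (-(η / 2)) (η / 2) ⊆ I := fun s hs => (hηb s (hsub hs)).2
  have hz : (0 : ℝ) ∈ Set.Ioo (-(η / 2)) (η / 2) := ⟨by linarith, by linarith⟩
  have hg0 : ∀ p, 0 ≤ |C| * Real.exp (-‖X p‖ ^ 2 / (2 * t)) := fun p => by positivity
  have h1 := fun s (hs : s ∈ Set.Ioo (-(η / 2)) (η / 2)) =>
    hasDerivAt_integral_family hI hΦ hK hI' hg hg0 (fun s hs p hp =>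
      ⟨((hηb s (hmem hs)).1 p hp).1.trans (hle p), ((hηb s (hmem hs)).1 p hp).2.1.trans (hle p)⟩) hs
  have h2 := hasDerivAt_integral_family hI (hΦ.velocity hI) hK hI' hg hg0 (fun s hs p hp =>
      ⟨((hηb s (hmem hs)).1 p hp).2.1.trans (hle p),
        ((hηb s (hmem hs)).1 p hp).2.2.trans (hle p)⟩) hz
  exact ⟨(h1 0 hz).1, h2.1, h2.2.1,
    Filter.eventually_of_mem (isOpen_Ioo.mem_nhds hz) fun s hs => (h1 s hs).2.2, h2.2.2⟩

/-- The integrand of the first variation of the functional. -/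
def firstIntegrand (X N : M → Euc (n + 1)) (lam : ℝ) (f : M → ℝ) (y : Euc (n + 1)) (h : ℝ)
    (p : M) : ℝ :=
  (-(n : ℝ) / 2 * h
    + (-⟪X p, f p • N p - y⟫_ℝ + ‖X p‖ ^ 2 * h / 2 - f p * meanCurvature X N p)
    + lam * (-(1 / 2) * h * ⟪X p, N p⟫_ℝ + ⟪f p • N p - y, N p⟫_ℝ)) * gaussWeight X p

/-- The integrand of the second variation of the functional, for a variation with acceleration
`W`, `z`, `k` of the hypersurface, of the center and of the scale. -/
def secondIntegrand (X N : M → Euc (n + 1)) (lam : ℝ) (f : M → ℝ) (y : Euc (n + 1)) (h : ℝ)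
    (W : M → Euc (n + 1)) (z : Euc (n + 1)) (k : ℝ) (p : M) : ℝ :=
  ((-(n : ℝ) / 2 * (-(n : ℝ) / 2 - 1) * h ^ 2 + -(n : ℝ) / 2 * k)
    + 2 * (-(n : ℝ) / 2) * h
      * (-⟪X p, f p • N p - y⟫_ℝ + ‖X p‖ ^ 2 * h / 2 - f p * meanCurvature X N p)
    + ((-⟪X p, f p • N p - y⟫_ℝ + ‖X p‖ ^ 2 * h / 2 - f p * meanCurvature X N p) ^ 2
        + (-(‖f p • N p - y‖ ^ 2 + ⟪X p, W p - z⟫_ℝ)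
          + 2 * ⟪X p, f p • N p - y⟫_ℝ * h + ‖X p‖ ^ 2 * k / 2 - ‖X p‖ ^ 2 * h ^ 2)
        + (⟪grad X f p, grad X f p⟫_ℝ - f p ^ 2 * sqNormSecondForm X N p + surfaceDiv X W p))
    + lam * ((-(1 / 2) * (-(1 / 2) - 1) * h ^ 2 + -(1 / 2) * k) * ⟪X p, N p⟫_ℝ
      + 2 * -(1 / 2) * h * ⟪f p • N p - y, N p⟫_ℝ + ⟪W p - z, N p⟫_ℝ)) * gaussWeight X p

variable {f : M → ℝ} {y : Euc (n + 1)} {h : ℝ} {Xv : ℝ → M → Euc (n + 1)}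
  {Xc : ℝ → Euc (n + 1)} {tc : ℝ → ℝ} {I : Set ℝ} {K : Set M}

/-- Both integrals are now over the fixed measure of X, and the remaining dependence on s sits in
two powers of the scale. -/
lemma IsJointVariation.functionalF_eq (H : IsJointVariation X N f y h Xv Xc tc I K) (lam : ℝ)
    {s : ℝ} (hs : s ∈ I) :
    functionalF X N lam 0 1 Xv Xc tc s = (4 * Real.pi) ^ (-(n : ℝ) / 2) *
      (tc s ^ (-(n : ℝ) / 2) * (∫ p, areaIntegrand X Xv Xc tc s p ∂(areaMeasure X))
        + lam * (tc s ^ (-(1 / 2) : ℝ) * ∫ p, volumeIntegrand X N Xv Xc s p ∂(areaMeasure X))) := by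
  have hpos := H.scale_pos s hs
  have hpi : (0 : ℝ) ≤ 4 * Real.pi := by positivity
  rw [functionalF, integral_areaMeasure_eq H.isSmoothImmersion (H.immersion s hs),
    Real.mul_rpow hpi hpos.le, one_div (tc s), Real.inv_rpow hpos.le, ← Real.rpow_neg hpos.le]
  simp only [sub_zero, mul_one]
  simp only [areaIntegrand, volumeIntegrand, gaussWeight]
  ring

/-- The first two derivatives of the functional along a joint variation. -/
theorem IsJointVariation.exists_derivs (H : IsJointVariation X N f y h Xv Xc tc I K)
    (hN : IsUnitNormal X N) (lam : ℝ) {t : ℝ} (ht : 1 < t)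
    (hfin : Integrable (fun p => Real.exp (-‖X p‖ ^ 2 / (2 * t))) (areaMeasure X)) :
    Integrable (firstIntegrand X N lam f y h) (areaMeasure X) ∧
    Integrable (secondIntegrand X N lam f y h (velocity (velocity Xv) 0) (deriv (deriv Xc) 0)
      (deriv (deriv tc) 0)) (areaMeasure X) ∧
    ∃ (F₁ : ℝ → ℝ) (F₂ : ℝ),
      (∀ᶠ s in 𝓝 (0 : ℝ), HasDerivAt (functionalF X N lam 0 1 Xv Xc tc) (F₁ s) s) ∧
      HasDerivAt F₁ F₂ 0 ∧
      (4 * Real.pi) ^ ((n : ℝ) / 2) * F₁ 0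
        = ∫ p, firstIntegrand X N lam f y h p ∂(areaMeasure X) ∧
      (4 * Real.pi) ^ ((n : ℝ) / 2) * F₂
        = ∫ p, secondIntegrand X N lam f y h (velocity (velocity Xv) 0) (deriv (deriv Xc) 0)
          (deriv (deriv tc) 0) p ∂(areaMeasure X) := by
  have hX := H.isSmoothImmersion
  have h0 := H.zero_mem
  obtain ⟨iA0, iA1, iA2, hA, hA1⟩ := exists_integral_derivs hX hfin H.isOpen h0
    H.smoothFamily_areaIntegrand H.isCompact (H.exists_areaIntegrand_bound ht)
  obtain ⟨iB0, iB1, iB2, hB, hB1⟩ := exists_integral_derivs hX hfin H.isOpen h0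
    (H.smoothFamily_volumeIntegrand hN) H.isCompact (H.exists_volumeIntegrand_bound hN ht)
  have hτ : ∀ᶠ s in 𝓝 (0 : ℝ), HasDerivAt tc (deriv tc s) s :=
    Filter.eventually_of_mem (H.isOpen.mem_nhds h0) fun s hs => H.hasDerivAt_scale hs
  have hτ1 := H.hasDerivAt_scale_speed h0
  obtain ⟨P, hP, hP0, hP1⟩ := exists_hasDerivAt_rpow_mul (-(n : ℝ) / 2) hτ hτ1 H.scale_start hA hA1
  obtain ⟨Q, hQ, hQ0, hQ1⟩ := exists_hasDerivAt_rpow_mul (-(1 / 2)) hτ hτ1 H.scale_start hB hB1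
  have eA1 : ∀ p, velocity (areaIntegrand X Xv Xc tc) 0 p = gaussWeight X p *
      (-⟪X p, f p • N p - y⟫_ℝ + ‖X p‖ ^ 2 * h / 2 - f p * meanCurvature X N p) :=
    fun p => by rw [H.velocity_areaIntegrand h0, H.areaIntegrand_zero, H.logSpeed_zero hN]
  have eB0 : ∀ p, volumeIntegrand X N Xv Xc 0 p = ⟪X p, N p⟫_ℝ * gaussWeight X p :=
    fun p => by rw [volumeIntegrand, H.start, H.center_start, sub_zero]
  have eB1 : ∀ p, velocity (volumeIntegrand X N Xv Xc) 0 p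
      = ⟪f p • N p - y, N p⟫_ℝ * gaussWeight X p :=
    fun p => by rw [H.velocity_volumeIntegrand h0, H.speed, H.center_speed]
  rw [H.scale_speed] at hP0 hQ0 hP1 hQ1
  set r : ℝ := -(n : ℝ) / 2 with hr
  have hk : (4 * Real.pi) ^ ((n : ℝ) / 2) * (4 * Real.pi) ^ r = 1 := by
    rw [← Real.rpow_add (by positivity), hr]
    rw [show (n : ℝ) / 2 + -(n : ℝ) / 2 = 0 by ring, Real.rpow_zero]
  set z := deriv (deriv Xc) 0
  set k := deriv (deriv tc) 0
  set A₀ := areaIntegrand X Xv Xc tc 0 with hA₀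
  set A₁ := velocity (areaIntegrand X Xv Xc tc) 0
  set A₂ := velocity (velocity (areaIntegrand X Xv Xc tc)) 0 with hA₂
  set B₀ := volumeIntegrand X N Xv Xc 0
  set B₁ := velocity (volumeIntegrand X N Xv Xc) 0
  set B₂ := velocity (velocity (volumeIntegrand X N Xv Xc)) 0 with hB₂
  -- The combination lemma takes three functions; here the middle one is a filler with coefficient
  -- 0.
  have j1 := integrable_combination iB0 iB1 iB1 (-(1 / 2) * h) 0
  have j2 := integrable_combination iB0 iB1 iB2 (-(1 / 2) * (-(1 / 2) - 1) * h ^ 2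
    + -(1 / 2) * k) (2 * -(1 / 2) * h)
  have j3 := integrable_combination iA0 iA1 iA2 (r * (r - 1) * h ^ 2 + r * k) (2 * r * h)
  have j0 : Integrable (fun _ : M => (0 : ℝ)) (areaMeasure X) := integrable_zero _ _ _
  have e1 : firstIntegrand X N lam f y h = fun p => (r * h) * A₀ p
      + lam * (-(1 / 2) * h * B₀ p + 0 * B₁ p + B₁ p) + A₁ p := by
    funext p
    rw [firstIntegrand, hA₀, H.areaIntegrand_zero, eA1, eB0, eB1, hr]
    ring
  have e2 : secondIntegrand X N lam f y h (velocity (velocity Xv) 0) z k = fun p =>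
      1 * ((r * (r - 1) * h ^ 2 + r * k) * A₀ p + 2 * r * h * A₁ p + A₂ p)
      + lam * ((-(1 / 2) * (-(1 / 2) - 1) * h ^ 2 + -(1 / 2) * k) * B₀ p
        + 2 * -(1 / 2) * h * B₁ p + B₂ p) + 0 := by
    funext p
    rw [secondIntegrand, hA₀, H.areaIntegrand_zero, eA1, eB0, eB1, hA₂, hB₂,
      H.velocity_velocity_areaIntegrand hN, H.velocity_velocity_volumeIntegrand h0, hr]
    ring
  refine ⟨?_, ?_, fun s => (4 * Real.pi) ^ r * (P s + lam * Q s), _, ?_,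
    (hP1.add (hQ1.const_mul lam)).const_mul _, ?_, ?_⟩
  · rw [e1]
    exact integrable_combination iA0 j1 iA1 _ _
  · rw [e2]
    exact integrable_combination j3 j2 j0 _ _
  · filter_upwards [hP, hQ, H.isOpen.mem_nhds h0] with s h1 h2 hs
    refine ((h1.add (h2.const_mul lam)).const_mul ((4 * Real.pi) ^ r)).congr_of_eventuallyEq ?_
    filter_upwards [H.isOpen.mem_nhds hs] with u hu using H.functionalF_eq lam hu
  · rw [e1, ← mul_assoc, hk, one_mul, integral_combination iA0 j1 iA1,
      integral_combination iB0 iB1 iB1, hP0, hQ0]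
    ring
  · rw [e2, ← mul_assoc, hk, one_mul, integral_combination j3 j2 j0,
      integral_combination iA0 iA1 iA2, integral_combination iB0 iB1 iB2, integral_zero]
    ring

end Functional

end LambdaHypersurface
end

noncomputable section

namespace LambdaHypersurface

/-! ### Existence of enough variations. -/

section Perturbation

variable {n : ℕ} {M : Type*} [TopologicalSpace M] [ChartedSpace (Euc n) M]
  [IsManifold (𝓡 n) ∞ M] {X N : M → Euc (n + 1)}

lemma isSmoothImmersion_of_linearIndependent
    (hX : ContMDiff (𝓡 n) 𝓘(ℝ, Euc (n + 1)) ∞ X)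
    (h : ∀ p, LinearIndependent ℝ (coordFrame X p (chartAt (Euc n) p p))) :
    IsSmoothImmersion X := by
  refine ⟨hX, fun p => (injective_iff_map_eq_zero _).2 fun v hv => ?_⟩
  have hm : MDifferentiableAt (𝓡 n) 𝓘(ℝ, Euc (n + 1)) X p := hX.mdifferentiableAt (by simp)
  have h1 := fderiv_eq_sum_pd (rep X p) (chartAt (Euc n) p p) v
  rw [← mfderiv_single hm v] at h1
  have h2 := Fintype.linearIndependent_iff.1 (h p) (v : Euc n).ofLp (h1.symm.trans hv)
  exact PiLp.ext h2

lemma linearIndependent_coordFrame_self {u : M → Euc (n + 1)} (hu : SmoothInCharts (n := n) u)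
    {p q : M} (hq : q ∈ (chartAt (Euc n) p).source)
    (h : LinearIndependent ℝ (coordFrame u p (chartAt (Euc n) p q))) :
    LinearIndependent ℝ (coordFrame u q (chartAt (Euc n) q q)) := by
  have ho := transition_mem (mem_overlap_self hq)
  rw [transition_self hq] at ho
  have ht : transition q p (chartAt (Euc n) q q) = chartAt (Euc n) p q := by
    rw [transition, (chartAt (Euc n) q).left_inv (mem_chart_source _ q)]
  rw [coordFrame_transition hu ho, ht]
  exact linearIndependent_lin (isUnit_det_transitionMat ho) h

/-- Immersions are stable under perturbations with compact support. -/
lemma eventually_isSmoothImmersion [T2Space M] (hX : IsSmoothImmersion X) {I : Set ℝ}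
    (hI : IsOpen I) (h0 : (0 : ℝ) ∈ I) {Φ : ℝ → M → Euc (n + 1)} (hΦ : SmoothFamily (n := n) I Φ)
    (hs : ∀ s ∈ I, ContMDiff (𝓡 n) 𝓘(ℝ, Euc (n + 1)) ∞ (Φ s)) (hΦ0 : Φ 0 = X) {K : Set M}
    (hK : IsCompact K) (hfix : ∀ s ∈ I, ∀ p ∉ K, Φ s p = X p) :
    ∀ᶠ s in 𝓝 (0 : ℝ), IsSmoothImmersion (Φ s) := by
  have hK' : ∀ᶠ s in 𝓝 (0 : ℝ), ∀ q ∈ K,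
      LinearIndependent ℝ (coordFrame (Φ s) q (chartAt (Euc n) q q)) := by
    -- Compactness of K reduces the claim to neighbourhoods of the points (0, p). There the frame is
    -- taken in the single chart at p, where its Gram determinant is continuous in (s, q) and
    -- nonzero at (0, p).
    refine hK.eventually_forall_of_forall_eventually fun p _ => ?_
    set c := chartAt (Euc n) p with hc
    have hcont : ContinuousOn
        (fun r : ℝ × Euc n => (Matrix.gram ℝ (coordFrame (Φ r.1) p r.2)).det) (I ×ˢ c.target) :=
      (contDiffOn_det (contDiffOn_gram fun i => hΦ.contDiffOn_pd hI p i)).continuousOn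
    have hat : ContinuousAt (fun z : ℝ × M =>
        (Matrix.gram ℝ (coordFrame (Φ z.1) p (c z.2))).det) (0, p) := by
      have h1 := hcont.continuousAt (x := ((0 : ℝ), c p))
        ((hI.prod c.open_target).mem_nhds ⟨h0, mem_chart_target _ p⟩)
      have h2 : ContinuousAt (fun z : ℝ × M => (z.1, c z.2)) (0, p) :=
        continuousAt_fst.prodMk
          (ContinuousAt.comp (f := Prod.snd) (x := ((0 : ℝ), p))
            (c.continuousAt (mem_chart_source _ p)) continuousAt_snd)
      exact ContinuousAt.comp (f := fun z : ℝ × M => (z.1, c z.2)) (x := ((0 : ℝ), p)) h1 h2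
    have hne : (Matrix.gram ℝ (coordFrame (Φ 0) p (c p))).det ≠ 0 := by
      rw [hΦ0]
      exact (gram_det_pos (hX.linearIndependent_self p)).ne'
    filter_upwards [hat.eventually_ne hne,
      (hI.prod c.open_source).mem_nhds (⟨h0, mem_chart_source _ p⟩ : ((0 : ℝ), p) ∈ I ×ˢ c.source)]
      with z hz hzm
    exact linearIndependent_coordFrame_self (hΦ.smoothInCharts hzm.1) hzm.2
      (Matrix.det_gram_ne_zero_iff_linearIndependent.1 hz)
  filter_upwards [hK', hI.mem_nhds h0] with s h1 hsI
  refine isSmoothImmersion_of_linearIndependent (hs s hsI) fun p => ?_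
  by_cases hp : p ∈ K
  · exact h1 p hp
  · have hev : Φ s =ᶠ[𝓝 p] X := by
      filter_upwards [hK.isClosed.isOpen_compl.mem_nhds hp] with q hq using hfix s hsI q hq
    rw [coordFrame_self_congr hev]
    exact hX.linearIndependent_self p

/-- Every compactly supported function is the speed of a normal variation. -/
lemma isNormalVariation_add_smul [T2Space M] (hX : IsSmoothImmersion X) (hN : IsUnitNormal X N)
    {φ : M → ℝ} (hφ : ContMDiff (𝓡 n) 𝓘(ℝ, ℝ) ∞ φ) (hc : HasCompactSupport φ) :
    IsNormalVariation X N φ fun s p => X p + s • φ p • N p := by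
  have hsm : ContMDiff (𝓘(ℝ, ℝ).prod (𝓡 n)) 𝓘(ℝ, Euc (n + 1)) ∞
      (fun q : ℝ × M => X q.2 + q.1 • φ q.2 • N q.2) :=
    (hX.1.comp contMDiff_snd).add (contMDiff_fst.smul
      ((hφ.comp contMDiff_snd).smul (hN.1.comp contMDiff_snd)))
  have hfix : ∀ s : ℝ, ∀ p ∉ tsupport φ, X p + s • φ p • N p = X p := fun s p hp => by
    rw [image_eq_zero_of_notMem_tsupport hp, zero_smul, smul_zero, add_zero]
  have him := eventually_isSmoothImmersion hX isOpen_univ (Set.mem_univ 0)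
    (Φ := fun s p => X p + s • φ p • N p)
    (SmoothFamily.of_contMDiffOn (I := Set.univ) hsm.contMDiffOn)
    (fun s _ => hsm.comp (g := fun q : ℝ × M => X q.2 + q.1 • φ q.2 • N q.2)
      ((contMDiff_const (c := s) (I' := 𝓘(ℝ, ℝ))).prodMk contMDiff_id))
    (by funext p; simp) hc.isCompact fun s _ => hfix s
  obtain ⟨ε, hε, hb⟩ := Metric.eventually_nhds_iff_ball.1 him
  refine ⟨by funext p; simp, fun p => ?_, ε, hε, hsm.contMDiffOn, fun s hs => hb s ?_,
    tsupport φ, hc.isCompact, fun s _ => hfix s⟩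
  · have h := ((hasDerivAt_id (0 : ℝ)).smul_const (φ p • N p)).const_add (X p)
    rwa [one_smul] at h
  · rw [Real.ball_eq_Ioo]
    simpa using hs

lemma isPointVariation_line {V : Type*} [NormedAddCommGroup V] [NormedSpace ℝ V] (c v : V) :
    IsPointVariation c v fun s => c + s • v := by
  refine ⟨by simp, ?_, 1, one_pos, (contDiff_const.add (contDiff_id.smul contDiff_const)).contDiffOn⟩
  have h := ((hasDerivAt_id (0 : ℝ)).smul_const v).const_add c
  rwa [one_smul] at h

end Perturbation

/-! ### Consequences of criticality. -/

section Critical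

open MeasureTheory

variable {n : ℕ} {M : Type*} [TopologicalSpace M] [T2Space M] [SecondCountableTopology M]
  [ChartedSpace (Euc n) M] [IsManifold (𝓡 n) ∞ M] [MeasurableSpace M] [BorelSpace M]
  {X N : M → Euc (n + 1)} {lam t : ℝ}

/-- Straight-line variations realise every smooth compactly supported normal speed and every pair
(y, h), so criticality becomes an integral identity. -/
lemma IsCriticalPoint.integral_firstIntegrand (hcrit : IsCriticalPoint X N lam 0 1)
    (hX : IsSmoothImmersion X) (hN : IsUnitNormal X N) (ht : 1 < t)
    (hfin : Integrable (fun p => Real.exp (-‖X p‖ ^ 2 / (2 * t))) (areaMeasure X))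
    {φ : M → ℝ} (hφ : ContMDiff (𝓡 n) 𝓘(ℝ, ℝ) ∞ φ) (hc : HasCompactSupport φ)
    (y : Euc (n + 1)) (h : ℝ) :
    Integrable (firstIntegrand X N lam φ y h) (areaMeasure X) ∧
      ∫ p, firstIntegrand X N lam φ y h p ∂(areaMeasure X) = 0 := by
  have hv := isNormalVariation_add_smul hX hN hφ hc
  have hy := isPointVariation_line (0 : Euc (n + 1)) y
  have hh := isPointVariation_line (1 : ℝ) h
  obtain ⟨I, K, H⟩ := exists_isJointVariation hv hy hh
  obtain ⟨h1, -, F₁, F₂, hF, -, hF1, -⟩ := H.exists_derivs hN lam ht hfin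
  refine ⟨h1, ?_⟩
  rw [← hF1, hF.self_of_nhds.unique (hcrit φ y h _ _ _ hv hy hh), mul_zero]

/-- Critical points of the functional satisfy `H + ⟨X, N⟩ = λ`. -/
lemma IsCriticalPoint.meanCurvature_eq (hcrit : IsCriticalPoint X N lam 0 1)
    (hX : IsSmoothImmersion X) (hN : IsUnitNormal X N) (ht : 1 < t)
    (hfin : Integrable (fun p => Real.exp (-‖X p‖ ^ 2 / (2 * t))) (areaMeasure X)) (p : M) :
    meanCurvature X N p = lam - ⟪X p, N p⟫_ℝ := by
  have := isLocallyFiniteMeasure_areaMeasure hX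
  have := isOpenPosMeasure_areaMeasure hX
  have := ChartedSpace.locallyCompactSpace (Euc n) M
  have hn := hN.smoothInCharts
  have hsd := (hn.surfaceDiv hX).continuous
  have hip := (hX.smoothInCharts.inner hn).continuous
  have hw := hX.smoothInCharts.gaussWeight.continuous
  have hcont : Continuous fun p => (lam - ⟪X p, N p⟫_ℝ + surfaceDiv X N p) * gaussWeight X p :=
    ((continuous_const.sub hip).add hsd).mul hw
  -- Fundamental lemma of the calculus of variations. For y = 0 and h = 0 the first integrand is φ(λ
  -- - H - ⟨X, N⟩)w, with H written as -div N so that continuity is available.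
  have hae := ae_eq_zero_of_integral_contMDiff_smul_eq_zero (𝓡 n) (μ := areaMeasure X)
    (hcont.locallyIntegrable) fun φ hφ hc => by
      rw [← (hcrit.integral_firstIntegrand hX hN ht hfin hφ hc 0 0).2]
      refine integral_congr_ae (Filter.Eventually.of_forall fun p => ?_)
      simp only [firstIntegrand, surfaceDiv_normal hX hN, sub_zero, real_inner_smul_left,
        real_inner_smul_right, real_inner_self_eq_norm_sq, (hN.2 p).1, smul_eq_mul]
      ring
  -- Two continuous functions that agree almost everywhere agree everywhere, since the area measure
  -- charges nonempty open sets.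
  have h0 := congrFun (hcont.ae_eq_iff_eq (areaMeasure X) (continuous_const (y := (0 : ℝ))) |>.1 hae) p
  have h1 := (mul_eq_zero.1 h0).resolve_right (Real.exp_pos _).ne'
  rw [surfaceDiv_normal hX hN] at h1
  linarith

end Critical

end LambdaHypersurface
end

noncomputable section

namespace LambdaHypersurface

/-! ### Integrability of the terms and the pointwise identity. -/

section SecondVariation

open MeasureTheory

variable {n : ℕ} {M : Type*} [TopologicalSpace M] [T2Space M] [SecondCountableTopology M]
  [ChartedSpace (Euc n) M] [IsManifold (𝓡 n) ∞ M] [MeasurableSpace M] [BorelSpace M]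
  {X N : M → Euc (n + 1)} {lam t : ℝ}

/-- Continuous functions of at most quartic growth in `X` are integrable for the Gaussian weight. -/
lemma integrable_mul_gaussWeight (hX : IsSmoothImmersion X) (ht : 1 < t)
    (hfin : Integrable (fun p => Real.exp (-‖X p‖ ^ 2 / (2 * t))) (areaMeasure X))
    {g : M → ℝ} (hg : Continuous g) {A : ℝ} (hA : ∀ p, |g p| ≤ A * (1 + ‖X p‖ ^ 2) ^ 2) :
    Integrable (fun p => g p * gaussWeight X p) (areaMeasure X) := by
  obtain ⟨C, hC, hCb⟩ := exists_weight_bound one_pos ht 0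
  refine (hfin.const_mul (|A| * C)).mono'
    (hg.mul hX.smoothInCharts.gaussWeight.continuous).measurable.aestronglyMeasurable
    (Filter.Eventually.of_forall fun p => ?_)
  have h3 := hCb ‖X p‖
  simp only [zero_mul, add_zero, mul_one] at h3
  rw [norm_mul, Real.norm_eq_abs, Real.norm_eq_abs, gaussWeight, abs_of_pos (Real.exp_pos _)]
  calc |g p| * Real.exp (-‖X p‖ ^ 2 / 2)
      ≤ (|A| * (1 + ‖X p‖ ^ 2) ^ 2) * Real.exp (-‖X p‖ ^ 2 / 2) :=
        mul_le_mul_of_nonneg_right ((hA p).trans (mul_le_mul_of_nonneg_right (le_abs_self A)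
          (by positivity))) (Real.exp_pos _).le
    _ = |A| * ((1 + ‖X p‖ ^ 2) ^ 2 * Real.exp (-‖X p‖ ^ 2 / 2)) := by ring
    _ ≤ |A| * (C * Real.exp (-‖X p‖ ^ 2 / (2 * t))) :=
        mul_le_mul_of_nonneg_left h3 (abs_nonneg A)
    _ = _ := by ring

lemma integrable_termY (hX : IsSmoothImmersion X) (ht : 1 < t)
    (hfin : Integrable (fun p => Real.exp (-‖X p‖ ^ 2 / (2 * t))) (areaMeasure X))
    (y : Euc (n + 1)) : Integrable (termY X y) (areaMeasure X) := by
  have hc := hX.smoothInCharts.continuous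
  refine integrable_mul_gaussWeight hX ht hfin (A := ‖y‖ ^ 2)
    (g := fun p => -‖y‖ ^ 2 + ⟪X p, y⟫_ℝ ^ 2)
    (continuous_const.add ((hc.inner continuous_const).pow 2)) fun p => ?_
  have h1 : ⟪X p, y⟫_ℝ ^ 2 ≤ ‖X p‖ ^ 2 * ‖y‖ ^ 2 := by
    rw [← mul_pow, ← sq_abs]
    exact pow_le_pow_left₀ (abs_nonneg _) (abs_real_inner_le_norm _ _) 2
  have h2 : 0 ≤ ‖X p‖ ^ 2 * ‖y‖ ^ 2 := by positivity
  have h3 : 0 ≤ ‖y‖ ^ 2 * (‖X p‖ ^ 2) ^ 2 := by positivity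
  rw [abs_le]
  constructor <;> nlinarith [sq_nonneg ⟪X p, y⟫_ℝ, sq_nonneg ‖y‖]

lemma integrable_termYH (hX : IsSmoothImmersion X) (ht : 1 < t)
    (hfin : Integrable (fun p => Real.exp (-‖X p‖ ^ 2 / (2 * t))) (areaMeasure X))
    (y : Euc (n + 1)) (h : ℝ) : Integrable (termYH X y h) (areaMeasure X) := by
  have hc := hX.smoothInCharts.continuous
  refine integrable_mul_gaussWeight hX ht hfin (A := (n + 1) * (‖y‖ * |h|))
    (g := fun p => (‖X p‖ ^ 2 - (n : ℝ) - 1) * ⟪X p, y⟫_ℝ * h)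
    (((((hc.norm.pow 2).sub continuous_const).sub continuous_const).mul
      (hc.inner continuous_const)).mul continuous_const) fun p => ?_
  set r := ‖X p‖ with hr
  have hr0 : 0 ≤ r := norm_nonneg _
  have hn : (0 : ℝ) ≤ n := n.cast_nonneg
  have h1 : |⟪X p, y⟫_ℝ| ≤ (1 + r ^ 2) * ‖y‖ :=
    (abs_real_inner_le_norm _ _).trans
      (mul_le_mul_of_nonneg_right (by nlinarith [sq_nonneg (r - 1)]) (norm_nonneg y))
  have h2 : |r ^ 2 - (n : ℝ) - 1| ≤ (n + 1) * (1 + r ^ 2) := by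
    rw [abs_le]
    constructor <;> nlinarith [mul_nonneg hn (sq_nonneg r)]
  rw [abs_mul, abs_mul]
  calc |r ^ 2 - (n : ℝ) - 1| * |⟪X p, y⟫_ℝ| * |h|
      ≤ ((n + 1) * (1 + r ^ 2)) * ((1 + r ^ 2) * ‖y‖) * |h| := by gcongr
    _ = _ := by ring

lemma integrable_termH (hX : IsSmoothImmersion X) (hN : IsUnitNormal X N) (ht : 1 < t)
    (hfin : Integrable (fun p => Real.exp (-‖X p‖ ^ 2 / (2 * t))) (areaMeasure X))
    (hH : ∀ p, meanCurvature X N p = lam - ⟪X p, N p⟫_ℝ) (h : ℝ) :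
    Integrable (termH X N lam h) (areaMeasure X) := by
  have hc := hX.smoothInCharts.continuous
  have hn := hN.smoothInCharts.continuous
  -- H has no a priori growth bound; the equation for critical points replaces λ - H by ⟨X, N⟩,
  -- which grows at most linearly in |X|.
  have e : termH X N lam h = fun p => ((((n : ℝ) ^ 2 + 2 * n) / 4 - ((n : ℝ) + 2) / 2 * ‖X p‖ ^ 2
      + ‖X p‖ ^ 4 / 4 + 3 * lam / 4 * ⟪X p, N p⟫_ℝ) * h ^ 2) * gaussWeight X p := by
    funext p
    rw [termH, hH, sub_sub_cancel]
  rw [e]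
  refine integrable_mul_gaussWeight hX ht hfin
    (A := (((n : ℝ) ^ 2 + 2 * n) / 4 + ((n : ℝ) + 2) / 2 + 1 / 4 + 3 * |lam| / 4) * h ^ 2)
    (((((continuous_const.sub (continuous_const.mul (hc.norm.pow 2))).add
      ((hc.norm.pow 4).div_const 4)).add (continuous_const.mul (hc.inner hn))).mul
        continuous_const)) fun p => ?_
  set r := ‖X p‖ with hr
  have hr0 : 0 ≤ r := norm_nonneg _
  have hn : (0 : ℝ) ≤ n := n.cast_nonneg
  have hq : 1 ≤ (1 + r ^ 2) ^ 2 := one_le_pow₀ (by nlinarith [sq_nonneg r])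
  have hq2 : r ^ 2 ≤ (1 + r ^ 2) ^ 2 := by nlinarith [sq_nonneg r, sq_nonneg (r ^ 2)]
  have hq4 : r ^ 4 ≤ (1 + r ^ 2) ^ 2 := by nlinarith [sq_nonneg r]
  have hq1 : r ≤ (1 + r ^ 2) ^ 2 := by nlinarith [sq_nonneg (r - 1), sq_nonneg (r ^ 2)]
  have h1 : |⟪X p, N p⟫_ℝ| ≤ (1 + r ^ 2) ^ 2 := by
    have h := abs_real_inner_le_norm (X p) (N p)
    rw [(hN.2 p).1, mul_one] at h
    exact h.trans hq1
  set Q := (1 + r ^ 2) ^ 2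
  have hQ : 0 ≤ Q := by positivity
  rw [abs_mul, abs_of_nonneg (sq_nonneg h), mul_right_comm]
  refine mul_le_mul_of_nonneg_right ?_ (sq_nonneg h)
  have t1 : |((n : ℝ) ^ 2 + 2 * n) / 4| ≤ ((n : ℝ) ^ 2 + 2 * n) / 4 * Q := by
    rw [abs_of_nonneg (by positivity)]
    exact le_mul_of_one_le_right (by positivity) hq
  have t2 : |((n : ℝ) + 2) / 2 * r ^ 2| ≤ ((n : ℝ) + 2) / 2 * Q := by
    rw [abs_of_nonneg (by positivity)]
    exact mul_le_mul_of_nonneg_left hq2 (by positivity)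
  have t3 : |r ^ 4 / 4| ≤ 1 / 4 * Q := by
    rw [abs_of_nonneg (by positivity)]
    linarith
  have t4 : |3 * lam / 4 * ⟪X p, N p⟫_ℝ| ≤ 3 * |lam| / 4 * Q := by
    rw [abs_mul, abs_div, abs_mul, abs_of_pos (three_pos : (0 : ℝ) < 3),
      abs_of_pos (four_pos : (0 : ℝ) < 4)]
    exact mul_le_mul_of_nonneg_left h1 (by positivity)
  calc _ ≤ |((n : ℝ) ^ 2 + 2 * n) / 4| + |((n : ℝ) + 2) / 2 * r ^ 2| + |r ^ 4 / 4|
        + |3 * lam / 4 * ⟪X p, N p⟫_ℝ| :=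
        (abs_add_le _ _).trans (add_le_add_left ((abs_add_le _ _).trans
          (add_le_add_left (abs_sub _ _) _)) _)
    _ ≤ _ := by linarith

lemma continuous_meanCurvature (hX : IsSmoothImmersion X) (hN : IsUnitNormal X N) :
    Continuous (meanCurvature X N) :=
  (hN.smoothInCharts.surfaceDiv hX).continuous.neg.congr fun p => by
    rw [Pi.neg_apply, surfaceDiv_normal hX hN, neg_neg]

lemma integrable_termF (hX : IsSmoothImmersion X) (hN : IsUnitNormal X N) {f : M → ℝ}
    (hf : Continuous f) (hc : HasCompactSupport f) (lam : ℝ) (y : Euc (n + 1)) (h : ℝ) :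
    Integrable (termF X N lam f y h) (areaMeasure X) := by
  have hXc := hX.smoothInCharts.continuous
  have hNc := hN.smoothInCharts.continuous
  have hw := hX.smoothInCharts.gaussWeight.continuous
  have hH := continuous_meanCurvature hX hN
  refine integrable_of_compactSupport hX ?_ (HasCompactSupport.intro hc fun p hp => ?_)
  · unfold termF
    fun_prop
  · rw [termF, image_eq_zero_of_notMem_tsupport hp, mul_zero, zero_mul]

variable {f : M → ℝ} {y : Euc (n + 1)} {h : ℝ} {Xv : ℝ → M → Euc (n + 1)}
  {Xc : ℝ → Euc (n + 1)} {tc : ℝ → ℝ} {I : Set ℝ} {K : Set M}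

lemma integrable_grad_sq_add_driftLaplacian (hX : IsSmoothImmersion X)
    (hf : SmoothInCharts (n := n) f) (hc : HasCompactSupport f) :
    Integrable (fun p => (⟪grad X f p, grad X f p⟫_ℝ + f p * driftLaplacian X f p)
      * gaussWeight X p) (areaMeasure X) := by
  have hg := hf.grad hX
  have hd : Continuous (driftLaplacian X f) :=
    ((hg.surfaceDiv hX).continuous.sub (hX.smoothInCharts.inner hg).continuous).congr fun p => by
      rw [driftLaplacian, laplacian_eq_surfaceDiv hX hf]
      rfl
  refine integrable_of_compactSupport hX (((hg.inner hg).continuous.add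
    (hf.continuous.mul hd)).mul hX.smoothInCharts.gaussWeight.continuous)
    (HasCompactSupport.intro hc fun p hp => ?_)
  have hz : grad X f p = 0 := by
    rw [grad_eq, coordFrame_self_congr (notMem_tsupport_iff_eventuallyEq.1 hp)]
    have : rep (n := n) (0 : M → ℝ) p = fun _ => 0 := rfl
    simp [frameGrad, coordFrame, pd, this]
  rw [hz, image_eq_zero_of_notMem_tsupport hp, inner_zero_left, zero_mul, zero_add, zero_mul]

lemma integrable_first_variation (hX : IsSmoothImmersion X) (hN : IsUnitNormal X N)
    {W : M → Euc (n + 1)} (hW : SmoothInCharts (n := n) W) (hc : HasCompactSupport W) :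
    Integrable (fun p => (surfaceDiv X W p - ⟪X p, W p⟫_ℝ
      + ⟪W p, N p⟫_ℝ * (meanCurvature X N p + ⟪X p, N p⟫_ℝ)) * gaussWeight X p)
      (areaMeasure X) := by
  have hn := hN.smoothInCharts
  have hH := continuous_meanCurvature hX hN
  refine integrable_of_compactSupport hX ((((hW.surfaceDiv hX).continuous.sub
    (hX.smoothInCharts.inner hW).continuous).add ((hW.inner hn).continuous.mul
      (hH.add (hX.smoothInCharts.inner hn).continuous))).mul
        hX.smoothInCharts.gaussWeight.continuous)
    (HasCompactSupport.intro hc fun p hp => ?_)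
  rw [surfaceDiv_eq_zero_of_notMem_tsupport hp, image_eq_zero_of_notMem_tsupport hp]
  simp

/-- The integrand of the second variation agrees with the integrand of the asserted formula up to
terms with vanishing integral. -/
lemma secondIntegrand_eq (hN : IsUnitNormal X N)
    (hH : ∀ p, meanCurvature X N p = lam - ⟪X p, N p⟫_ℝ) (f : M → ℝ) (y : Euc (n + 1)) (h : ℝ)
    (W : M → Euc (n + 1)) (z : Euc (n + 1)) (k : ℝ) (p : M) :
    secondIntegrand X N lam f y h W z k p
      = -termL X N lam f p + termY X y p + termF X N lam f y h p + termYH X y h p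
        + termH X N lam h p
        + (firstIntegrand X N lam (fun _ => 0) z k p
          + -h * firstIntegrand X N lam (fun _ => 0) y 0 p
          + (⟪grad X f p, grad X f p⟫_ℝ + f p * driftLaplacian X f p) * gaussWeight X p
          + (surfaceDiv X W p - ⟪X p, W p⟫_ℝ
            + ⟪W p, N p⟫_ℝ * (meanCurvature X N p + ⟪X p, N p⟫_ℝ)) * gaussWeight X p) := by
  have hNN : ⟪N p, N p⟫_ℝ = 1 := by rw [real_inner_self_eq_norm_sq, (hN.2 p).1, one_pow]
  -- After H is eliminated through H = λ - ⟨X, N⟩, both sides are polynomials in inner products. In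
  -- particular -f⟨X, N⟩ - fH becomes -λf, the source of the λ² in L.
  simp only [secondIntegrand, firstIntegrand, termL, termY, termF, termYH, termH, stabilityOp,
    hH, ← real_inner_self_eq_norm_sq, inner_sub_left, inner_sub_right, real_inner_smul_left,
    real_inner_smul_right, hNN, zero_smul, inner_zero_left, inner_zero_right,
    real_inner_comm (N p) y]
  rw [show ‖X p‖ ^ 4 = ⟪X p, X p⟫_ℝ ^ 2 by rw [real_inner_self_eq_norm_sq]; ring]
  ring

end SecondVariation

end LambdaHypersurface
end

/-! ### Assembly of the second variation formula. -/

open LambdaHypersurface in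
theorem mainTheorem7 {n : ℕ} {M : Type*} [TopologicalSpace M] [T2Space M]
    [SecondCountableTopology M] [ChartedSpace (Euc n) M] [IsManifold (𝓡 n) ∞ M]
    [MeasurableSpace M] [BorelSpace M]
    (X N : M → Euc (n + 1)) (lam : ℝ)
    (hX : IsSmoothImmersion X) (hN : IsUnitNormal X N)
    -- the weighted area is finite for parameters `(X₀, t₀)` near `(0, 1)`
    (hfin : ∃ t > (1 : ℝ), MeasureTheory.Integrable
      (fun p => Real.exp (-‖X p‖ ^ 2 / (2 * t))) (areaMeasure X))
    (hcrit : IsCriticalPoint X N lam 0 1)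
    (f : M → ℝ) (y : Euc (n + 1)) (h : ℝ)
    (Xv : ℝ → M → Euc (n + 1)) (Xc : ℝ → Euc (n + 1)) (tc : ℝ → ℝ)
    (hXv : IsNormalVariation X N f Xv)
    (hXc : IsPointVariation 0 y Xc) (htc : IsPointVariation 1 h tc) :
    -- all integrals converge
    (MeasureTheory.Integrable (termL X N lam f) (areaMeasure X) ∧
      MeasureTheory.Integrable (termY X y) (areaMeasure X) ∧
      MeasureTheory.Integrable (termF X N lam f y h) (areaMeasure X) ∧
      MeasureTheory.Integrable (termYH X y h) (areaMeasure X) ∧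
      MeasureTheory.Integrable (termH X N lam h) (areaMeasure X)) ∧
    -- the functional is differentiable near `0` and twice differentiable at `0`
    (∀ᶠ s in 𝓝 (0 : ℝ), DifferentiableAt ℝ (functionalF X N lam 0 1 Xv Xc tc) s) ∧
    -- its second derivative at `0` is given by the formula
    ∃ F'' : ℝ, HasDerivAt (deriv (functionalF X N lam 0 1 Xv Xc tc)) F'' 0 ∧
      (4 * Real.pi) ^ ((n : ℝ) / 2) * F'' =
        -(∫ p, termL X N lam f p ∂(areaMeasure X))
          + (∫ p, termY X y p ∂(areaMeasure X))
          + (∫ p, termF X N lam f y h p ∂(areaMeasure X))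
          + (∫ p, termYH X y h p ∂(areaMeasure X))
          + ∫ p, termH X N lam h p ∂(areaMeasure X) := by
  obtain ⟨t, ht, hfin⟩ := hfin
  obtain ⟨I, K, J⟩ := exists_isJointVariation hXv hXc htc
  have hH := hcrit.meanCurvature_eq hX hN ht hfin
  have hf := J.smoothInCharts_speed hN
  have hfc := J.hasCompactSupport_speed hN
  have hW := J.smoothInCharts_acceleration
  have hWc := J.hasCompactSupport_acceleration
  obtain ⟨-, i2, F₁, F₂, hF, hF₁, -, hF₂⟩ := J.exists_derivs hN lam ht hfin
  set W := velocity (velocity Xv) 0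
  set z := deriv (deriv Xc) 0
  set k := deriv (deriv tc) 0
  have iY := integrable_termY hX ht hfin y
  have iF := integrable_termF hX hN hf.continuous hfc lam y h
  have iYH := integrable_termYH hX ht hfin y h
  have iH := integrable_termH hX hN ht hfin hH h
  -- Criticality with zero normal speed: only the center and the scale are varied.
  have first := fun (v : Euc (n + 1)) (r : ℝ) =>
    hcrit.integral_firstIntegrand hX hN ht hfin (φ := fun _ => 0) contMDiff_const
      HasCompactSupport.zero v r
  have iG := integrable_grad_sq_add_driftLaplacian hX hf hfc
  have iV := integrable_first_variation hX hN hW hWc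
  have iR := (((first z k).1.add ((first y 0).1.const_mul (-h))).add iG).add iV
  have hR := secondIntegrand_eq hN hH f y h W z k
  -- The four null terms: the accelerations z and k, the correction of the yh-coefficient, Green's
  -- formula for f, and the acceleration W.
  have hR0 : ∫ p, (firstIntegrand X N lam (fun _ => 0) z k p
      + -h * firstIntegrand X N lam (fun _ => 0) y 0 p
      + (⟪grad X f p, grad X f p⟫_ℝ + f p * driftLaplacian X f p) * gaussWeight X p
      + (surfaceDiv X W p - ⟪X p, W p⟫_ℝ
        + ⟪W p, N p⟫_ℝ * (meanCurvature X N p + ⟪X p, N p⟫_ℝ)) * gaussWeight X p)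
      ∂(areaMeasure X) = 0 := by
    refine (MeasureTheory.integral_add (((first z k).1.add
      ((first y 0).1.const_mul (-h))).add iG) iV).trans ?_
    rw [integral_first_variation hX hN hW hWc, add_zero]
    refine (MeasureTheory.integral_add ((first z k).1.add
      ((first y 0).1.const_mul (-h))) iG).trans ?_
    rw [integral_grad_sq_add_driftLaplacian hX hN hf hfc, add_zero]
    refine (MeasureTheory.integral_add (first z k).1 ((first y 0).1.const_mul (-h))).trans ?_
    rw [MeasureTheory.integral_const_mul, (first z k).2, (first y 0).2, mul_zero, add_zero]
  -- The pointwise identity expresses this term through functions already known to be integrable,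
  -- including the second integrand itself.
  have iL : MeasureTheory.Integrable (termL X N lam f) (areaMeasure X) := by
    refine (((((iY.add iF).add iYH).add iH).add iR).sub i2).congr
      (Filter.Eventually.of_forall fun p => ?_)
    simp only [Pi.sub_apply, Pi.add_apply, hR]
    ring
  refine ⟨⟨iL, iY, iF, iYH, iH⟩, hF.mono fun s hs => hs.differentiableAt, F₂,
    hF₁.congr_of_eventuallyEq (hF.mono fun s hs => hs.deriv), ?_⟩
  rw [hF₂, MeasureTheory.integral_congr_ae (Filter.Eventually.of_forall hR)]
  refine (MeasureTheory.integral_add ((((iL.neg.add iY).add iF).add iYH).add iH) iR).trans ?_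
  refine (congrArg _ hR0).trans ((add_zero _).trans ?_)
  refine (MeasureTheory.integral_add (((iL.neg.add iY).add iF).add iYH) iH).trans ?_
  congr 1
  refine (MeasureTheory.integral_add ((iL.neg.add iY).add iF) iYH).trans ?_
  congr 1
  refine (MeasureTheory.integral_add (iL.neg.add iY) iF).trans ?_
  congr 1
  refine (MeasureTheory.integral_add iL.neg iY).trans ?_
  congr 1
  exact MeasureTheory.integral_neg _
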